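/- Let $\sigma$ be the surface measure on the unit sphere $\mathbb S^2$, let $L^2(\mathbb S^2)=L^2(\mathbb S^2,\sigma;\mathbb C)$, and let $Y_{\ell m}$, $\ell\ge 0$, $-\ell\le m\le \ell$, be the (orthonormal) spherical harmonics, so that $Y_{\ell,-m}=(-1)^m\overline{Y_{\ell m}}$. Let $0<T<\infty$, let $(\Omega,\mathcal A,\mathbb P)$ be a probability space, let $X_0\in L^2(\Omega;L^2(\mathbb S^2))$, and let $(A_\ell)_{\ell\ge 0}$ be nonnegative reals such that $A_\ell\le C\ell^{-\alpha}$ for all $\ell>\ell_0$, for some $\ell_0\in\mathbb N_0$, $\alpha>0$ and a constant $C$. For a family of reals $b=(b^i_{\ell m})$ put $a_{\ell 0}(b)=\sqrt{A_\ell}\,b^1_{\ell 0}$, $a_{\ell m}(b)=\sqrt{A_\ell/2}\,(b^1_{\ell m}-i\,b^2_{\ell m})$ and $a_{\ell,-m}(b)=(-1)^m\overline{a_{\ell m}(b)}$ for $1\le m\le\ell$. For $f\in L^2(\mathbb S^2)$ let $f^\kappa=\sum_{\ell=0}^{\kappa}\sum_{m=-\ell}^{\ell}(f,Y_{\ell m})Y_{\ell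 m}$. (1) Let $\beta^i_{\ell m}$ ($\ell\ge0$, $0\le m\le \ell$, $i\in\{1,2\}$, without $\beta^2_{\ell 0}$) be independent standard real Brownian motions, and let $W(t)=\sum_{\ell,m}a_{\ell m}(\beta(t))Y_{\ell m}$ be the (possibly only formal) isotropic $Q$-Wiener process with angular power spectrum $(A_\ell)$. Let $X$ be a solution of $dX(t)=\Delta_{\mathbb S^2}X(t)\,dt+dW(t)$, $X(0)=X_0$, i.e. an $L^2(\mathbb S^2)$-valued process on $[0,T]$ such that $\mathbb P$-a.s., for all $t\in[0,T]$ and all $\ell,m$, the map $s\mapsto (X(s),\Delta_{\mathbb S^2}Y_{\ell m})$ is integrable on $[0,T]$ and $$(X(t),Y_{\ell m})=(X_0,Y_{\ell m})+\int_0^t (X(s),\Delta_{\mathbb S^2}Y_{\ell m})\,ds+a_{\ell m}(\beta(t)).$$ Then $\mathbb P$-a.s., for every $\beta<\alpha/2$ and every $\varepsilon>0$ there is $\kappa_0$ such that $$\|X(t)-X^\kappa(t)\|_{L^2(\mathbb S^2)}\le\kappa^{-\beta}\qquad\text{for all }\kappa\ge\kappa_0\text{ and all }t\in[\varepsilon,T],$$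 where $X^\kappa(t)=X(t)^\kappa$. Moreover, for $\mathbb P$-almost every $\omega$ for which the initial value satisfies such a bound, i.e. for which for every $\beta<\alpha/2$ one has $\|X_0-X_0^\kappa\|_{L^2(\mathbb S^2)}\le\kappa^{-\beta}$ for all large $\kappa$ (for instance if $X_0=0$), the bound holds for every $\beta<\alpha/2$ and all large $\kappa$ uniformly in $t\in[0,T]$. (2) The same holds for the recursive representation on any time grid. Let $0=t_0<\dots<t_n\le T$, $h_k=t_{k+1}-t_k$, let $\xi^i_{\ell m}(j)$ ($0\le j<n$, $0\le m\le\ell$, $i\in\{1,2\}$, without $i=2$ for $m=0$) be independent standard normal random variables, and let $X_\ell(t_0)=\sum_{m=-\ell}^{\ell}(X_0,Y_{\ell m})Y_{\ell m}$ and $$X_\ell(t_{k+1})=e^{-\ell(\ell+1)h_k}X_\ell(t_k)+\sigma_{\ell h_k}\sum_{m=-\ell}^{\ell}a_{\ell m}(\xi(k))\,Y_{\ell m},\qquad \sigma_{\ell h}^2=\frac{1-e^{-2\ell(\ell+1)h}}{2\ell(\ell+1)}\ (\ell\ge1),\quad \sigma_{0h}^2=h.$$ Then $\mathbb P$-a.s.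 the series $X(t_k)=\sum_{\ell\ge0}X_\ell(t_k)$ converges in $L^2(\mathbb S^2)$ for all $k\le n$, and for every $\beta<\alpha/2$ there is $\kappa_0$ such that $\bigl\|X(t_k)-\sum_{\ell=0}^{\kappa}X_\ell(t_k)\bigr\|_{L^2(\mathbb S^2)}\le\kappa^{-\beta}$ for all $\kappa\ge\kappa_0$ and all $1\le k\le n$. -/

import Mathlib

open MeasureTheory ProbabilityTheory Filter Topology
open scoped NNReal ENNReal

noncomputable section

namespace SphereHeat

/-- The unit sphere `𝕊²` in `ℝ³`. -/
abbrev S2 : Type := Metric.sphere (0 : EuclideanSpace ℝ (Fin 3)) 1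

/-- The Lebesgue (surface) measure `dσ = sin ϑ dϑ dφ` on `𝕊²`, of total mass `4π`. -/
abbrev surf : Measure S2 := (volume : Measure (EuclideanSpace ℝ (Fin 3))).toSphere

/-- `L²(𝕊²; ℂ)`. -/
abbrev L2S : Type := Lp ℂ 2 surf

/-- The colatitude `ϑ ∈ [0, π]` of a point `y = (sin ϑ cos φ, sin ϑ sin φ, cos ϑ)`. -/
def colat (y : S2) : ℝ := Real.arccos ((y : EuclideanSpace ℝ (Fin 3)) 2)

/-- The longitude `φ` of `y = (sin ϑ cos φ, sin ϑ sin φ, cos ϑ)`, normalised to lie in `(-π, π]`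
(all functions of `φ` below are `2π`-periodic). -/
def lon (y : S2) : ℝ :=
  Complex.arg ⟨(y : EuclideanSpace ℝ (Fin 3)) 0, (y : EuclideanSpace ℝ (Fin 3)) 1⟩

/-- A function of the angles `(ϑ, φ)`, regarded as a function on the sphere. -/
def onSphere (f : ℝ → ℝ → ℂ) (y : S2) : ℂ := f (colat y) (lon y)

/-- The Legendre polynomial `P_ℓ`, by Rodrigues' formula. -/
def legendre (l : ℕ) : Polynomial ℝ :=
  Polynomial.C (((2 : ℝ) ^ l * (l.factorial : ℝ))⁻¹) *
    (Polynomial.derivative^[l]) ((Polynomial.X ^ 2 - 1) ^ l)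

/-- The associated Legendre function
`P_{ℓm}(μ) = (-1)^m (1 - μ²)^{m/2} (d/dμ)^m P_ℓ(μ)`, for `μ ∈ [-1, 1]`. -/
def assocLegendre (l m : ℕ) (x : ℝ) : ℝ :=
  (-1) ^ m * Real.sqrt (1 - x ^ 2) ^ m * ((Polynomial.derivative^[m]) (legendre l)).eval x

/-- The spherical harmonic `Y_{ℓm}(ϑ, φ)` for `0 ≤ m ≤ ℓ`. -/
def harmNonneg (l m : ℕ) (θ φ : ℝ) : ℂ :=
  (Real.sqrt ((2 * l + 1) / (4 * Real.pi) * (((l - m).factorial : ℝ) / ((l + m).factorial : ℝ))) *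
    assocLegendre l m (Real.cos θ) : ℝ) * Complex.exp (Complex.I * m * φ)

/-- The spherical harmonic `Y_{ℓm}(ϑ, φ)` for `-ℓ ≤ m ≤ ℓ`, with
`Y_{ℓm} = (-1)^m conj Y_{ℓ,-m}` for `m < 0`. -/
def harm (l : ℕ) (m : ℤ) (θ φ : ℝ) : ℂ :=
  if 0 ≤ m then harmNonneg l m.natAbs θ φ
  else (-1) ^ m.natAbs * (starRingEnd ℂ) (harmNonneg l m.natAbs θ φ)

/-- The spherical Laplacian (Laplace-Beltrami operator) in spherical coordinates,
`Δ = (sin ϑ)⁻¹ ∂_ϑ (sin ϑ ∂_ϑ) + (sin ϑ)⁻² ∂_φ²`. -/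
def laplaceS2 (f : ℝ → ℝ → ℂ) (θ φ : ℝ) : ℂ :=
  (Real.sin θ : ℂ)⁻¹ *
      deriv (fun x : ℝ => (Real.sin x : ℂ) * deriv (fun x' : ℝ => f x' φ) x) θ +
    ((Real.sin θ : ℂ) ^ 2)⁻¹ * deriv (fun p : ℝ => deriv (fun p' : ℝ => f θ p') p) φ

theorem continuous_harmNonneg (l m : ℕ) :
    Continuous fun p : ℝ × ℝ => harmNonneg l m p.1 p.2 := by
  unfold harmNonneg assocLegendre
  fun_prop

theorem continuous_harm (l : ℕ) (m : ℤ) : Continuous fun p : ℝ × ℝ => harm l m p.1 p.2 := by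
  unfold harm
  have h := continuous_harmNonneg l m.natAbs
  split_ifs
  · exact h
  · exact continuous_const.mul (Complex.continuous_conj.comp h)

theorem measurable_colat : Measurable colat := by
  unfold colat
  have : Continuous fun y : S2 => (y : EuclideanSpace ℝ (Fin 3)) 2 := by fun_prop
  exact (Real.continuous_arccos.comp this).measurable

theorem measurable_lon : Measurable lon := by
  unfold lon
  refine Complex.measurable_arg.comp ?_
  have h0 : Continuous fun y : S2 => (y : EuclideanSpace ℝ (Fin 3)) 0 := by fun_prop
  have h1 : Continuous fun y : S2 => (y : EuclideanSpace ℝ (Fin 3)) 1 := by fun_prop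
  exact (Complex.measurableEquivRealProd.symm.measurable).comp
    (h0.measurable.prodMk h1.measurable)

theorem measurable_onSphere {f : ℝ → ℝ → ℂ} (hf : Continuous fun p : ℝ × ℝ => f p.1 p.2) :
    Measurable (onSphere f) :=
  hf.measurable.comp (measurable_colat.prodMk measurable_lon)

theorem exists_bound_harm (l : ℕ) (m : ℤ) : ∃ C : ℝ, ∀ y : S2, ‖onSphere (harm l m) y‖ ≤ C := by
  have hc := continuous_harm l m
  have hK : IsCompact (Set.Icc (0 : ℝ) Real.pi ×ˢ Set.Icc (-Real.pi) Real.pi) :=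
    isCompact_Icc.prod isCompact_Icc
  obtain ⟨C, hC⟩ := hK.exists_bound_of_continuousOn hc.continuousOn
  refine ⟨C, fun y => ?_⟩
  have h1 : colat y ∈ Set.Icc (0 : ℝ) Real.pi := ⟨Real.arccos_nonneg _, Real.arccos_le_pi _⟩
  have h2 : lon y ∈ Set.Icc (-Real.pi) Real.pi :=
    ⟨(Complex.neg_pi_lt_arg _).le, Complex.arg_le_pi _⟩
  exact hC (colat y, lon y) (Set.mk_mem_prod h1 h2)

/-- Spherical harmonics are square integrable over the sphere. -/
theorem memLp_harm (l : ℕ) (m : ℤ) : MemLp (onSphere (harm l m)) 2 surf := by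
  obtain ⟨C, hC⟩ := exists_bound_harm l m
  exact MemLp.of_bound (measurable_onSphere (continuous_harm l m)).aestronglyMeasurable C
    (Eventually.of_forall hC)

/-- The spherical harmonic `Y_{ℓm}` as an element of `L²(𝕊²)`. -/
def Y (l : ℕ) (m : ℤ) : L2S := (memLp_harm l m).toLp _

/-- The pairing `(f, g)_{L²(𝕊²)} = ∫ f conj(g) dσ`, with `g` given as a function of the angles. -/
def pair (f : L2S) (g : ℝ → ℝ → ℂ) : ℂ :=
  ∫ y, f y * (starRingEnd ℂ) (onSphere g y) ∂surf

/-- The component `∑_{m=-ℓ}^{ℓ} (f, Y_{ℓm}) Y_{ℓm}` of degree `ℓ` of `f`. -/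
def degreePart (l : ℕ) (f : L2S) : L2S :=
  ∑ m ∈ Finset.Icc (-(l : ℤ)) l, pair f (harm l m) • Y l m

/-- The truncation `f^κ = ∑_{ℓ=0}^{κ} ∑_{m=-ℓ}^{ℓ} (f, Y_{ℓm}) Y_{ℓm}`. -/
def truncate (κ : ℕ) (f : L2S) : L2S := ∑ l ∈ Finset.range (κ + 1), degreePart l f

/-- The indices `(ℓ, m, i)` of the real random inputs: `0 ≤ m ≤ ℓ` and `i ∈ {1, 2}`
(coded as `0, 1`), where `i = 2` does not occur for `m = 0`. -/
def IsMode (p : ℕ × ℕ × Fin 2) : Prop := p.2.1 ≤ p.1 ∧ (p.2.2 = 0 ∨ 1 ≤ p.2.1)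

/-- The coefficients `a_{ℓm}` of the isotropic field with angular power spectrum `A` and real
inputs `b`: `a_{ℓ0} = √A_ℓ b¹_{ℓ0}`, `a_{ℓm} = √(A_ℓ/2) (b¹_{ℓm} - i b²_{ℓm})` for `m > 0` and
`a_{ℓm} = (-1)^m conj a_{ℓ,-m}` for `m < 0`; see `sum_noiseCoeff`. -/
def noiseCoeff (A : ℕ → ℝ) (b : ℕ → ℕ → Fin 2 → ℝ) (l : ℕ) (m : ℤ) : ℂ :=
  if m = 0 then (Real.sqrt (A l) : ℂ) * (b l 0 0 : ℂ)
  else if 0 < m then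
    (Real.sqrt (A l / 2) : ℂ) * ((b l m.natAbs 0 : ℂ) - Complex.I * (b l m.natAbs 1 : ℂ))
  else
    (-1) ^ m.natAbs * ((Real.sqrt (A l / 2) : ℂ) *
      ((b l m.natAbs 0 : ℂ) + Complex.I * (b l m.natAbs 1 : ℂ)))

theorem sum_Icc_symm (l : ℕ) (f : ℤ → ℂ) :
    ∑ m ∈ Finset.Icc (-(l : ℤ)) l, f m =
      f 0 + ∑ m ∈ Finset.Icc 1 l, (f (m : ℤ) + f (-(m : ℤ))) := by
  induction l with
  | zero => simp
  | succ k ih =>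
    have h : Finset.Icc (-((k + 1 : ℕ) : ℤ)) ((k + 1 : ℕ) : ℤ) =
        insert (-((k + 1 : ℕ) : ℤ)) (insert (((k + 1 : ℕ) : ℤ))
          (Finset.Icc (-(k : ℤ)) (k : ℤ))) := by
      ext x
      simp only [Finset.mem_Icc, Finset.mem_insert]
      omega
    rw [h, Finset.sum_insert, Finset.sum_insert, ih, Finset.sum_Icc_succ_top (by omega)]
    · ring
    · simp only [Finset.mem_Icc]; omega
    · simp only [Finset.mem_Icc, Finset.mem_insert]; omega

/-- The complex and the real form of an isotropic field agree in each degree. -/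
theorem sum_noiseCoeff (A : ℕ → ℝ) (b : ℕ → ℕ → Fin 2 → ℝ) (l : ℕ) (hA : 0 ≤ A l) (θ φ : ℝ) :
    ∑ m ∈ Finset.Icc (-(l : ℤ)) l, noiseCoeff A b l m * harm l m θ φ =
      (Real.sqrt (A l) : ℂ) * ((b l 0 0 : ℂ) * harm l 0 θ φ +
        (Real.sqrt 2 : ℂ) * ∑ m ∈ Finset.Icc 1 l,
          ((b l m 0 : ℂ) * ((harm l (m : ℤ) θ φ).re : ℂ) +
            (b l m 1 : ℂ) * ((harm l (m : ℤ) θ φ).im : ℂ))) := by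
  rw [sum_Icc_symm, mul_add, Finset.mul_sum, Finset.mul_sum]
  congr 1
  · simp [noiseCoeff, mul_assoc]
  · refine Finset.sum_congr rfl fun m hm => ?_
    have hm1 : 1 ≤ m := (Finset.mem_Icc.1 hm).1
    have e1 : noiseCoeff A b l (m : ℤ) =
        (Real.sqrt (A l / 2) : ℂ) * ((b l m 0 : ℂ) - Complex.I * (b l m 1 : ℂ)) := by
      unfold noiseCoeff
      rw [if_neg (by omega), if_pos (by omega)]
      simp
    have e2 : noiseCoeff A b l (-(m : ℤ)) = (-1) ^ m * ((Real.sqrt (A l / 2) : ℂ) *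
        ((b l m 0 : ℂ) + Complex.I * (b l m 1 : ℂ))) := by
      unfold noiseCoeff
      rw [if_neg (by omega), if_neg (by omega)]
      simp
    have e3 : harm l (-(m : ℤ)) θ φ = (-1) ^ m * (starRingEnd ℂ) (harm l (m : ℤ) θ φ) := by
      unfold harm
      rw [if_neg (by omega), if_pos (by omega)]
      simp
    have hs : (-1 : ℂ) ^ m * (-1) ^ m = 1 := by rw [← mul_pow]; simp
    have hr : Real.sqrt (A l) * Real.sqrt 2 = 2 * Real.sqrt (A l / 2) := by
      have h4 : (2 : ℝ) = Real.sqrt 4 := by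
        rw [show (4 : ℝ) = 2 ^ 2 by norm_num, Real.sqrt_sq (by norm_num)]
      conv_rhs => rw [h4]
      rw [← Real.sqrt_mul hA, ← Real.sqrt_mul (by norm_num)]
      congr 1
      ring
    have hrc : (Real.sqrt (A l) : ℂ) * (Real.sqrt 2 : ℂ) = 2 * (Real.sqrt (A l / 2) : ℂ) := by
      exact_mod_cast hr
    rw [e1, e2, e3, ← mul_assoc (Real.sqrt (A l) : ℂ), hrc]
    generalize harm l (m : ℤ) θ φ = z
    have hz : (starRingEnd ℂ) z = (z.re : ℂ) - Complex.I * (z.im : ℂ) := by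
      apply Complex.ext <;> simp
    have hz' : z = (z.re : ℂ) + Complex.I * (z.im : ℂ) := by
      apply Complex.ext <;> simp
    rw [hz]
    conv_lhs => rw [hz']
    simp only [Complex.add_re, Complex.add_im, Complex.mul_re, Complex.mul_im, Complex.ofReal_re,
      Complex.ofReal_im, Complex.I_re, Complex.I_im, zero_mul, one_mul, sub_zero, zero_add,
      add_zero, mul_zero]
    linear_combination ((Real.sqrt (A l / 2) : ℂ) * ((b l m 0 : ℂ) + Complex.I * (b l m 1 : ℂ)) *
      ((z.re : ℂ) - Complex.I * (z.im : ℂ))) * hs -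
      2 * (Real.sqrt (A l / 2) : ℂ) * (b l m 1 : ℂ) * (z.im : ℂ) * Complex.I_sq

/-- `β` is a family of independent standard real Brownian motions
`β^i_{ℓm}`, `0 ≤ m ≤ ℓ`, `i ∈ {1, 2}` (without `β²_{ℓ0}`). The isotropic `Q`-Wiener process `W`
with angular power spectrum `A` is the (in general only formal) series
`W(t) = ∑ a_{ℓm}(t) Y_{ℓm}` whose coefficients are the `noiseCoeff` of `β(t)`. -/
structure IsBrownianFamily {Ω : Type*} [MeasurableSpace Ω] (P : Measure Ω)
    (β : ℕ → ℕ → Fin 2 → ℝ≥0 → Ω → ℝ) : Prop where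
  brownian : ∀ l m i, IsMode (l, m, i) → IsBrownianReal (β l m i) P
  indep : iIndepFun
    (fun (p : {p : ℕ × ℕ × Fin 2 // IsMode p}) (ω : Ω) (t : ℝ≥0) =>
      β p.1.1 p.1.2.1 p.1.2.2 t ω) P

/-- `X` is a solution on `[0, T]` of `dX(t) = Δ X(t) dt + dW(t)`, `X(0) = X₀`, in `L²(𝕊²)`: almost
surely, for all `t ∈ [0, T]` and all spherical harmonics,
`(X(t), Y_{ℓm}) = (X₀, Y_{ℓm}) + ∫₀ᵗ (X(s), Δ Y_{ℓm}) ds + (W(t), Y_{ℓm})`. -/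
structure IsSolution {Ω : Type*} [MeasurableSpace Ω] (P : Measure Ω) (A : ℕ → ℝ)
    (β : ℕ → ℕ → Fin 2 → ℝ≥0 → Ω → ℝ) (T : ℝ) (X₀ : Ω → L2S) (X : ℝ → Ω → L2S) : Prop where
  aestronglyMeasurable : ∀ t ∈ Set.Icc 0 T, AEStronglyMeasurable (X t) P
  equation : ∀ᵐ ω ∂P, ∀ l : ℕ, ∀ m ∈ Finset.Icc (-(l : ℤ)) l,
    IntervalIntegrable (fun s => pair (X s ω) (laplaceS2 (harm l m))) volume 0 T ∧
    ∀ t ∈ Set.Icc 0 T,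
      pair (X t ω) (harm l m) =
        pair (X₀ ω) (harm l m) + (∫ s in (0 : ℝ)..t, pair (X s ω) (laplaceS2 (harm l m))) +
          noiseCoeff A (fun l' m' i => β l' m' i t.toNNReal ω) l m

/-- `ξ^i_{ℓm}(j)`, `j < n`, `0 ≤ m ≤ ℓ`, `i ∈ {1, 2}` (without `i = 2` for `m = 0`), are
independent standard normal random variables. -/
structure IsNormalFamily {Ω : Type*} [MeasurableSpace Ω] (P : Measure Ω) (n : ℕ)
    (ξ : ℕ → ℕ → ℕ → Fin 2 → Ω → ℝ) : Prop where
  normal : ∀ j < n, ∀ l m i, IsMode (l, m, i) → HasLaw (ξ j l m i) (gaussianReal 0 1) P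
  indep : iIndepFun
    (fun (p : {p : ℕ × ℕ × ℕ × Fin 2 // p.1 < n ∧ IsMode p.2}) (ω : Ω) =>
      ξ p.1.1 p.1.2.1 p.1.2.2.1 p.1.2.2.2 ω) P

/-- The standard deviation `σ_{ℓh}` of `∫_t^{t+h} e^{-ℓ(ℓ+1)(t+h-s)} dβ(s)`. -/
def convStd (l : ℕ) (h : ℝ) : ℝ :=
  if l = 0 then Real.sqrt h
  else Real.sqrt ((1 - Real.exp (-2 * ((l : ℝ) * (l + 1)) * h)) / (2 * ((l : ℝ) * (l + 1))))

/-- The recursive representation on the time grid `τ` of the component `X_ℓ` of the solution: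
`X_ℓ(τ_{k+1}) = e^{-ℓ(ℓ+1)h_k} X_ℓ(τ_k) + ψ_ℓ(k)` with `h_k = τ_{k+1} - τ_k`, where the increment is
`ψ_ℓ(k) = √A_ℓ σ_{ℓh_k} (ξ¹_{ℓ0}(k) Y_{ℓ0} + √2 ∑_{m=1}^ℓ (ξ¹_{ℓm}(k) Re Y_{ℓm} + ξ²_{ℓm}(k) Im Y_{ℓm}))`
(written in the complex form, see `sum_noiseCoeff`). -/
def gridPart (A : ℕ → ℝ) (τ : ℕ → ℝ) (ξ : ℕ → ℕ → ℕ → Fin 2 → ℝ) (x₀ : L2S) (l : ℕ) : ℕ → L2S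
  | 0 => degreePart l x₀
  | k + 1 =>
      Real.exp (-((l : ℝ) * (l + 1)) * (τ (k + 1) - τ k)) • gridPart A τ ξ x₀ l k +
        convStd l (τ (k + 1) - τ k) •
          ∑ m ∈ Finset.Icc (-(l : ℤ)) l, noiseCoeff A (ξ k) l m • Y l m

end SphereHeat

end

open MeasureTheory ProbabilityTheory Filter Topology
open scoped NNReal ENNReal

noncomputable section

namespace SphereHeat

/-! The error is computed degree by degree. The spherical harmonics form a Hilbert basis of
eigenfunctions of the Laplacian, so `‖f - truncate κ f‖ ^ 2` is the sum of `degreeSq l f` over `l >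
κ` (`norm_sub_truncate_sq`). It therefore suffices to bound `degreeSq l (X t ω)` by a sequence
independent of `t` that stays summable with the weight `l ^ (2 * b)`.

Each coefficient of a solution satisfies a scalar equation `y' = -λ y + w'` with `λ = l(l+1)` and
`w` a combination of at most two Brownian paths times a multiple of `√A_l`. This is solved path by
path: if `w` is `γ`-Hölder with constant `M`, then `y(t) - exp(-λt) y(0)` is at most `6 M λ^(-γ)`,
uniformly in `t` (`norm_sub_exp_mul_le`). With `γ = 1/2 - δ`, Gaussian tails and Borel-Cantelli over
all dyadic increments of all modes bound the Hölder constants of the Brownian paths by a random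
multiple of `(l+1)^δ` (`ae_exists_holder`). The deviation is then `O(√A_l l^(-1+3δ))`; squared and
summed over the `2l+1` orders it is `O(l^(-1-α+6δ))`, and small `δ` reaches every exponent `b <
α/2`.

The initial value enters through `exp(-λt)`. For `t ≥ ε` this factor absorbs any power of `l`; down
to `t = 0` the assumed rate of the initial value is used instead. On a grid the noise of one step
has size at most `√A_l l^(-1+δ)` up to a random constant, and each positive step smooths the
preceding state completely, so an induction over the grid suffices (`ae_rate_grid`).

Orthonormality, the eigenvalue relation and completeness are derived from Rodrigues' formula: the
Legendre equation with integration by parts, the surface measure in spherical coordinates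
(`map_angles_surf`), and Stone-Weierstrass (`dense_harmSpan`). -/

/-! ### Legendre polynomials: differential equation, leading coefficients and scalar products. -/

-- Logarithmic differentiation of `(X² - 1)^l` gives a first-order relation `hb`; its derivative is
-- the case `k = 0`, and differentiating the case `k` gives the case `k + 1`.
open Polynomial in
theorem rodrigues_ode (l k : ℕ) :
    (X ^ 2 - 1 : ℝ[X]) * derivative^[k + 2] ((X ^ 2 - 1) ^ l) +
      C (2 * ((k : ℝ) + 1) - 2 * l) * X * derivative^[k + 1] ((X ^ 2 - 1) ^ l) +
      C (((k : ℝ) + 1) * (k - 2 * l)) * derivative^[k] ((X ^ 2 - 1) ^ l) = 0 := by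
  have hb : (X ^ 2 - 1 : ℝ[X]) * derivative ((X ^ 2 - 1) ^ l) =
      C (2 * (l : ℝ)) * X * (X ^ 2 - 1) ^ l := by
    rcases l with _ | l
    · simp
    · rw [derivative_pow]
      simp only [derivative_sub, derivative_one, map_mul, map_ofNat,
        map_natCast, map_add, map_one, pow_succ, Nat.cast_add, Nat.cast_one]
      simp
      ring
  induction k with
  | zero =>
    have h := congrArg derivative hb
    simp only [derivative_mul, derivative_sub, derivative_X_pow, derivative_one, derivative_C,
      derivative_X] at h
    simp only [Function.iterate_succ, Function.iterate_zero, Function.comp, id]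
    simp only [map_mul, map_sub, map_add, map_ofNat, map_natCast, map_one] at h ⊢
    push_cast at h ⊢
    linear_combination h
  | succ k ih =>
    have h := congrArg derivative ih
    simp only [derivative_add, derivative_mul, derivative_sub, derivative_X_pow, derivative_one,
      derivative_C, derivative_X, derivative_zero, ← Function.iterate_succ_apply' derivative] at h
    simp only [map_mul, map_sub, map_add, map_ofNat, map_natCast, map_one] at h ⊢
    push_cast at h ⊢
    linear_combination h

open Polynomial in
/-- The differential equation of the derivatives of the Legendre polynomials. -/
theorem legendre_ode (l m : ℕ) :
    (X ^ 2 - 1 : ℝ[X]) * derivative^[m + 2] (legendre l) +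
      C (2 * ((m : ℝ) + 1)) * X * derivative^[m + 1] (legendre l) +
      C (((l : ℝ) + m + 1) * (m - l)) * derivative^[m] (legendre l) = 0 := by
  have h := rodrigues_ode l (m + l)
  unfold legendre
  simp only [iterate_derivative_C_mul, ← Function.iterate_add_apply]
  rw [show m + 2 + l = m + l + 2 by ring, show m + 1 + l = m + l + 1 by ring]
  simp only [map_mul, map_sub, map_add, map_ofNat, map_natCast, map_one] at h ⊢
  push_cast at h ⊢
  linear_combination C (((2 : ℝ) ^ l * (l.factorial : ℝ))⁻¹) * h

open Polynomial in
theorem natDegree_iterate_derivative_legendre_le (l m : ℕ) :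
    (derivative^[m] (legendre l)).natDegree ≤ l - m := by
  unfold legendre
  rw [iterate_derivative_C_mul, ← Function.iterate_add_apply]
  refine (natDegree_C_mul_le _ _).trans ((natDegree_iterate_derivative _ _).trans ?_)
  have : ((X ^ 2 - 1 : ℝ[X]) ^ l).natDegree ≤ l * 2 :=
    natDegree_pow_le_of_le l (by compute_degree)
  omega

-- Only the top coefficient of the monic polynomial `(X² - 1)^(n+m)` survives at this position after
-- `n + 2m` differentiations. Its being nonzero makes the family triangular in `n`, which
-- completeness needs; the case `n = 0` feeds the normalisation.
open Polynomial in
theorem coeff_iterate_derivative_legendre (n m : ℕ) :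
    (derivative^[m] (legendre (n + m))).coeff n =
      ((2 : ℝ) ^ (n + m) * ((n + m).factorial : ℝ))⁻¹ *
        ((2 * (n + m)).descFactorial (n + 2 * m) : ℝ) := by
  unfold legendre
  rw [iterate_derivative_C_mul, ← Function.iterate_add_apply, coeff_C_mul,
    coeff_iterate_derivative, show n + (m + (n + m)) = 2 * (n + m) by ring,
    show m + (n + m) = n + 2 * m by ring]
  have : ((X ^ 2 - 1 : ℝ[X]) ^ (n + m)).coeff (2 * (n + m)) = 1 := by
    have hm : (X ^ 2 - 1 : ℝ[X]).Monic := by monicity!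
    have hd : (X ^ 2 - 1 : ℝ[X]).natDegree = 2 := by compute_degree!
    have := (hm.pow (n + m)).coeff_natDegree
    rwa [hm.natDegree_pow, hd, mul_comm] at this
  rw [this]
  simp

open Polynomial in
theorem coeff_iterate_derivative_legendre_ne_zero (n m : ℕ) :
    (derivative^[m] (legendre (n + m))).coeff n ≠ 0 := by
  rw [coeff_iterate_derivative_legendre]
  refine mul_ne_zero (by positivity) ?_
  have : 0 < (2 * (n + m)).descFactorial (n + 2 * m) := by
    rw [Nat.descFactorial_pos]; omega
  positivity

open Polynomial in
theorem iterate_derivative_legendre_self (l : ℕ) :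
    derivative^[l] (legendre l) =
      C (((2 * l).factorial : ℝ) / ((2 : ℝ) ^ l * (l.factorial : ℝ))) := by
  have h := natDegree_iterate_derivative_legendre_le l l
  rw [Nat.sub_self] at h
  rw [eq_C_of_natDegree_le_zero h]
  have := coeff_iterate_derivative_legendre 0 l
  simp only [zero_add, Nat.descFactorial_self] at this
  rw [this]
  congr 1
  field_simp

open Polynomial in
theorem integral_eval_derivative (p : ℝ[X]) (h1 : p.eval 1 = 0) (h2 : p.eval (-1) = 0) :
    ∫ x in (-1 : ℝ)..1, (derivative p).eval x = 0 := by
  rw [intervalIntegral.integral_eq_sub_of_hasDerivAt (fun x _ => p.hasDerivAt x)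
    (Continuous.intervalIntegrable (by fun_prop) _ _), h1, h2, sub_zero]

open Polynomial in
/-- The scalar product of `P_{ℓm}` and `P_{ℓ'm}`, as an integral of polynomials. -/
def legendreIntegral (m l l' : ℕ) : ℝ :=
  ∫ x in (-1 : ℝ)..1, ((1 - X ^ 2) ^ m * derivative^[m] (legendre l) *
    derivative^[m] (legendre l')).eval x

theorem legendreIntegral_comm (m l l' : ℕ) :
    legendreIntegral m l l' = legendreIntegral m l' l := by
  unfold legendreIntegral
  congr 1
  ext x
  congr 1
  ring

-- Integration by parts: the factor `(1 - X²)^(m+1)` kills the boundary terms, and the Legendre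
-- equation is the statement that the derivative of `(1 - X²)^(m+1) P_l^(m+1)` is `-(l-m)(l+m+1) (1
-- - X²)^m P_l^(m)`.
open Polynomial in
theorem legendreIntegral_succ (m l l' : ℕ) :
    legendreIntegral (m + 1) l l' =
      ((l : ℝ) - m) * (l + m + 1) * legendreIntegral m l l' := by
  have h0 := integral_eval_derivative ((1 - X ^ 2) ^ (m + 1) * derivative^[m + 1] (legendre l) *
    derivative^[m] (legendre l')) (by simp) (by simp)
  have hd : derivative ((1 - X ^ 2) ^ (m + 1) * derivative^[m + 1] (legendre l) *
      derivative^[m] (legendre l')) =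
      (1 - X ^ 2) ^ (m + 1) * derivative^[m + 1] (legendre l) *
        derivative^[m + 1] (legendre l') -
      C (((l : ℝ) - m) * (l + m + 1)) * ((1 - X ^ 2) ^ m * derivative^[m] (legendre l) *
        derivative^[m] (legendre l')) := by
    have h := legendre_ode l m
    rw [derivative_mul, derivative_mul, derivative_pow_succ,
      ← Function.iterate_succ_apply' derivative, ← Function.iterate_succ_apply' derivative]
    simp only [derivative_sub, derivative_X_pow, derivative_one]
    simp only [map_mul, map_sub, map_add, map_ofNat, map_natCast, map_one] at h ⊢
    push_cast at h ⊢
    rw [pow_succ]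
    linear_combination (-(1 - X ^ 2) ^ m * derivative^[m] (legendre l')) * h
  rw [hd] at h0
  simp only [eval_sub, eval_C_mul] at h0
  rw [intervalIntegral.integral_sub (Continuous.intervalIntegrable (Polynomial.continuous _) _ _)
    ((Continuous.intervalIntegrable (Polynomial.continuous _) _ _).const_mul _),
    intervalIntegral.integral_const_mul] at h0
  unfold legendreIntegral
  linarith

/-- The usual argument for eigenvectors of a symmetric operator: applying the recursion to either
index produces two factors, whose difference is `(l - l')(l + l' + 1)`. -/
theorem legendreIntegral_of_ne (m : ℕ) {l l' : ℕ} (h : l ≠ l') : legendreIntegral m l l' = 0 := by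
  have h1 := legendreIntegral_succ m l l'
  have h2 := legendreIntegral_succ m l' l
  rw [legendreIntegral_comm, legendreIntegral_comm m l' l] at h2
  have h3 : (((l : ℝ) - l') * (l + l' + 1)) * legendreIntegral m l l' = 0 := by
    linear_combination h2 - h1
  rcases mul_eq_zero.1 h3 with h4 | h4
  · rcases mul_eq_zero.1 h4 with h5 | h5
    · exact absurd (by exact_mod_cast sub_eq_zero.1 h5) h
    · have : (0 : ℝ) < (l : ℝ) + l' + 1 := by positivity
      exact absurd h5 this.ne'
  · exact h4

open Polynomial in
theorem integral_one_sub_sq_pow_succ (l : ℕ) :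
    ((2 : ℝ) * l + 3) * ∫ x in (-1 : ℝ)..1, ((1 - X ^ 2 : ℝ[X]) ^ (l + 1)).eval x =
      (2 * l + 2) * ∫ x in (-1 : ℝ)..1, ((1 - X ^ 2 : ℝ[X]) ^ l).eval x := by
  have h0 := integral_eval_derivative (X * (1 - X ^ 2) ^ (l + 1)) (by simp) (by simp)
  have hd : derivative (X * (1 - X ^ 2) ^ (l + 1)) =
      C ((2 : ℝ) * l + 3) * (1 - X ^ 2) ^ (l + 1) - C ((2 : ℝ) * l + 2) * (1 - X ^ 2) ^ l := by
    rw [derivative_mul, derivative_pow_succ]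
    simp only [derivative_sub, derivative_X_pow, derivative_one, derivative_X]
    simp only [map_mul, map_add, map_ofNat, map_natCast, map_one]
    push_cast
    rw [pow_succ]
    ring
  rw [hd] at h0
  simp only [eval_sub, eval_C_mul] at h0
  rw [intervalIntegral.integral_sub
    ((Continuous.intervalIntegrable (Polynomial.continuous _) _ _).const_mul _)
    ((Continuous.intervalIntegrable (Polynomial.continuous _) _ _).const_mul _),
    intervalIntegral.integral_const_mul, intervalIntegral.integral_const_mul] at h0
  linarith

open Polynomial in
theorem integral_one_sub_sq_pow (l : ℕ) :
    ∫ x in (-1 : ℝ)..1, ((1 - X ^ 2 : ℝ[X]) ^ l).eval x =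
      2 * ((2 : ℝ) ^ l * (l.factorial : ℝ)) ^ 2 / ((2 * l + 1) * ((2 * l).factorial : ℝ)) := by
  induction l with
  | zero => simp; norm_num
  | succ l ih =>
    have h := integral_one_sub_sq_pow_succ l
    rw [ih] at h
    have h3 : (2 * (l : ℝ) + 3) ≠ 0 := by positivity
    rw [← mul_right_inj' h3, h, show 2 * (l + 1) = 2 * l + 1 + 1 by ring, Nat.factorial_succ,
      Nat.factorial_succ, Nat.factorial_succ]
    push_cast
    have h4 : (2 * ((l : ℝ) + 1) + 1) ≠ 0 := by positivity
    have h5 : (2 * (l : ℝ) + 1) ≠ 0 := by positivity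
    have h6 : (2 * (l : ℝ) + 1 + 1) ≠ 0 := by positivity
    have h7 : ((2 * l).factorial : ℝ) ≠ 0 := by positivity
    field_simp
    ring

-- At the top order `m = l` the derivative of `P_l` is constant, and only a Beta integral remains.
open Polynomial in
theorem legendreIntegral_self_self (l : ℕ) :
    legendreIntegral l l l = 2 * ((2 * l).factorial : ℝ) / (2 * l + 1) := by
  unfold legendreIntegral
  rw [iterate_derivative_legendre_self]
  simp only [eval_mul, eval_C]
  rw [intervalIntegral.integral_mul_const, intervalIntegral.integral_mul_const,
    integral_one_sub_sq_pow]
  have h5 : (2 * (l : ℝ) + 1) ≠ 0 := by positivity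
  field_simp

theorem legendreIntegral_mul_factorial (l m : ℕ) (h : m ≤ l) :
    legendreIntegral m l l * ((l - m).factorial : ℝ) =
      ((l + m).factorial : ℝ) * legendreIntegral 0 l l := by
  induction m with
  | zero => simp [mul_comm]
  | succ m ih =>
    have h1 := ih (by omega)
    obtain ⟨k, rfl⟩ : ∃ k, l = m + 1 + k := ⟨l - (m + 1), by omega⟩
    rw [legendreIntegral_succ]
    rw [show m + 1 + k - m = k + 1 by omega, Nat.factorial_succ] at h1
    rw [show m + 1 + k - (m + 1) = k by omega, show m + 1 + k + (m + 1) = m + 1 + k + m + 1 by ring,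
      Nat.factorial_succ]
    push_cast at h1 ⊢
    linear_combination (2 * (m : ℝ) + k + 2) * h1

/-- The recursion in `m` is used twice: at `m = l`, where the value is known, to calibrate order
`0`, and then from order `0` to `m`. -/
theorem legendreIntegral_self (l m : ℕ) (h : m ≤ l) :
    legendreIntegral m l l =
      2 / (2 * l + 1) * (((l + m).factorial : ℝ) / ((l - m).factorial : ℝ)) := by
  have h1 := legendreIntegral_mul_factorial l m h
  have h2 := legendreIntegral_mul_factorial l l le_rfl
  rw [legendreIntegral_self_self, Nat.sub_self, ← two_mul] at h2
  have h5 : (2 * (l : ℝ) + 1) ≠ 0 := by positivity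
  have h6 : ((2 * l).factorial : ℝ) ≠ 0 := by positivity
  have h7 : ((l - m).factorial : ℝ) ≠ 0 := by positivity
  have h0 : legendreIntegral 0 l l = 2 / (2 * l + 1) := by
    rw [← mul_right_inj' h6, ← h2]
    simp
    ring
  rw [h0] at h1
  rw [← mul_left_inj' h7, h1]
  field_simp

/-! ### Separated form of the harmonics and the eigenvalue equation. -/

/-- The normalising constant (with sign) of `Y_{ℓm}`. -/
def harmConst (l : ℕ) (m : ℤ) : ℝ :=
  (if 0 ≤ m then (-1) ^ m.natAbs else 1) *
    Real.sqrt ((2 * l + 1) / (4 * Real.pi) *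
      (((l - m.natAbs).factorial : ℝ) / ((l + m.natAbs).factorial : ℝ)))

/-- The polynomial factor of `Y_{ℓm}`, the `|m|`-th derivative of `P_ℓ`. -/
def harmPoly (l : ℕ) (m : ℤ) : Polynomial ℝ := Polynomial.derivative^[m.natAbs] (legendre l)

/-- One formula for both signs of `m` and all real angles. The absolute value comes from `√(1 -
cos²)`; for `m < 0` the sign in `harm` cancels the phase `(-1)^|m|` of `assocLegendre`. -/
theorem harm_eq (l : ℕ) (m : ℤ) (θ φ : ℝ) :
    harm l m θ φ =
      ((harmConst l m * (|Real.sin θ| ^ m.natAbs * (harmPoly l m).eval (Real.cos θ)) : ℝ) : ℂ) *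
        Complex.exp (Complex.I * m * φ) := by
  have hs : Real.sqrt (1 - Real.cos θ ^ 2) = |Real.sin θ| := by
    rw [← Real.sqrt_sq_eq_abs, ← Real.sin_sq]
  unfold harm harmConst harmNonneg assocLegendre harmPoly
  rw [hs]
  split_ifs with h
  · have : ((m.natAbs : ℕ) : ℂ) = m := by
      rw [Nat.cast_natAbs, abs_of_nonneg h]
    rw [this]
    push_cast
    ring
  · have hm : ((m.natAbs : ℕ) : ℂ) = -m := by
      rw [Nat.cast_natAbs, abs_of_neg (not_le.1 h)]; simp
    have h1 : (-1 : ℂ) ^ m.natAbs * (-1) ^ m.natAbs = 1 := by rw [← mul_pow]; simp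
    rw [map_mul, ← Complex.exp_conj, hm, Complex.conj_ofReal]
    simp only [map_mul, Complex.conj_I, map_neg, Complex.conj_ofReal, map_intCast]
    rw [show -Complex.I * -(m : ℂ) * φ = Complex.I * m * φ by ring]
    push_cast
    linear_combination (Real.sqrt ((2 * l + 1) / (4 * Real.pi) *
      (((l - m.natAbs).factorial : ℝ) / ((l + m.natAbs).factorial : ℝ))) *
      ((|Real.sin θ| : ℝ) : ℂ) ^ m.natAbs *
      (((Polynomial.derivative^[m.natAbs] (legendre l)).eval (Real.cos θ) : ℝ) : ℂ) *
      Complex.exp (Complex.I * m * φ)) * h1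

theorem hasDerivAt_sin_pow_mul (p : Polynomial ℝ) (k : ℕ) {θ : ℝ} (h : Real.sin θ ≠ 0) :
    HasDerivAt (fun x => Real.sin x ^ k * p.eval (Real.cos x))
      (Real.sin θ ^ k * (k * Real.cos θ / Real.sin θ * p.eval (Real.cos θ) -
        Real.sin θ * p.derivative.eval (Real.cos θ))) θ := by
  have h1 := ((Real.hasDerivAt_sin θ).pow k).mul
    ((p.hasDerivAt (Real.cos θ)).comp θ (Real.hasDerivAt_cos θ))
  refine h1.congr_deriv ?_
  rcases k with _ | k
  · simp; ring
  · simp only [Function.comp, pow_succ, Nat.add_sub_cancel, Pi.pow_apply]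
    field_simp
    ring

/-- Separation of variables: the longitude contributes `-m²`, and the colatitude part becomes the
Legendre equation at `cos θ`. At the poles the coordinates are singular and `|sin|` need not be
smooth, hence the restriction on `θ`. -/
theorem laplaceS2_harm (l : ℕ) (m : ℤ) {θ : ℝ} (φ : ℝ) (hθ : 0 < Real.sin θ) :
    laplaceS2 (harm l m) θ φ = -((l : ℝ) * (l + 1) : ℝ) * harm l m θ φ := by
  set k := m.natAbs with hk
  set q := harmPoly l m with hq
  set c : ℂ := (harmConst l m : ℂ) with hc
  have hev : ∀ᶠ x in 𝓝 θ, 0 < Real.sin x :=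
    Real.continuous_sin.continuousAt.eventually (lt_mem_nhds hθ)
  have hform : ∀ x, 0 < Real.sin x → ∀ p : ℝ, harm l m x p =
      ((Real.sin x ^ k * q.eval (Real.cos x) : ℝ) : ℂ) *
        (c * Complex.exp (Complex.I * m * p)) := by
    intro x hx p
    rw [harm_eq, abs_of_pos hx]
    push_cast
    ring
  set e : ℂ := c * Complex.exp (Complex.I * m * φ) with he
  have hd1 : ∀ x, 0 < Real.sin x → deriv (fun x' : ℝ => harm l m x' φ) x =
      ((Real.sin x ^ k * (k * Real.cos x / Real.sin x * q.eval (Real.cos x) -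
        Real.sin x * q.derivative.eval (Real.cos x)) : ℝ) : ℂ) * e := by
    intro x hx
    have hevx : ∀ᶠ x' in 𝓝 x, 0 < Real.sin x' :=
      Real.continuous_sin.continuousAt.eventually (lt_mem_nhds hx)
    have h1 : (fun x' : ℝ => harm l m x' φ) =ᶠ[𝓝 x]
        fun x' => ((Real.sin x' ^ k * q.eval (Real.cos x') : ℝ) : ℂ) * e := by
      filter_upwards [hevx] with x' hx'
      rw [hform x' hx']
    rw [h1.deriv_eq]
    exact ((hasDerivAt_sin_pow_mul q k hx.ne').ofReal_comp.mul_const e).deriv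
  -- Multiplication by `sin` turns the first derivative back into powers of `sin` times polynomials
  -- in `cos`, so that `hasDerivAt_sin_pow_mul` applies a second time.
  have h2 : (fun x : ℝ => (Real.sin x : ℂ) * deriv (fun x' : ℝ => harm l m x' φ) x) =ᶠ[𝓝 θ]
      fun x => ((Real.sin x ^ k * (Polynomial.C (k : ℝ) * Polynomial.X * q).eval (Real.cos x) -
        Real.sin x ^ (k + 2) * q.derivative.eval (Real.cos x) : ℝ) : ℂ) * e := by
    filter_upwards [hev] with x hx
    rw [hd1 x hx, ← mul_assoc, ← Complex.ofReal_mul]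
    congr 2
    simp only [Polynomial.eval_mul, Polynomial.eval_C, Polynomial.eval_X]
    field_simp
    ring
  have h3 : deriv (fun x : ℝ => (Real.sin x : ℂ) * deriv (fun x' : ℝ => harm l m x' φ) x) θ = _ :=
    h2.deriv_eq.trans (((hasDerivAt_sin_pow_mul (Polynomial.C (k : ℝ) * Polynomial.X * q) k
      hθ.ne').sub (hasDerivAt_sin_pow_mul q.derivative (k + 2)
      hθ.ne')).ofReal_comp.mul_const e).deriv
  have hE : ∀ p : ℝ, HasDerivAt (fun p : ℝ => Complex.exp (Complex.I * m * p))
      (Complex.exp (Complex.I * m * p) * (Complex.I * m)) p := by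
    intro p
    have := ((hasDerivAt_id (p : ℂ)).const_mul (Complex.I * m)).cexp.comp_ofReal
    simpa using this
  have h4 : ∀ p : ℝ, deriv (fun p' : ℝ => harm l m θ p') p =
      ((Real.sin θ ^ k * q.eval (Real.cos θ) : ℝ) : ℂ) *
        (c * (Complex.exp (Complex.I * m * p) * (Complex.I * m))) := by
    intro p
    rw [funext (hform θ hθ)]
    exact (((hE p).const_mul c).const_mul _).deriv
  have h5 : deriv (fun p : ℝ => deriv (fun p' : ℝ => harm l m θ p') p) φ =
      ((Real.sin θ ^ k * q.eval (Real.cos θ) : ℝ) : ℂ) * (-(k : ℂ) ^ 2 * e) := by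
    rw [funext h4]
    rw [((((hE φ).mul_const _).const_mul c).const_mul _).deriv, he]
    have : (m : ℂ) ^ 2 = (k : ℂ) ^ 2 := by
      rw [hk, Nat.cast_natAbs, ← Int.cast_pow, ← Int.cast_pow, sq_abs]
    rw [← this]
    linear_combination (((Real.sin θ ^ k * q.eval (Real.cos θ) : ℝ) : ℂ) * c *
      Complex.exp (Complex.I * m * φ) * m ^ 2) * Complex.I_sq
  unfold laplaceS2
  rw [h3, h5, hform θ hθ φ, ← he]
  have hode := congrArg (Polynomial.eval (Real.cos θ)) (legendre_ode l k)
  have hd2 : Polynomial.derivative^[k + 1] (legendre l) = q.derivative := by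
    rw [Function.iterate_succ_apply']; rfl
  have hd3 : Polynomial.derivative^[k + 2] (legendre l) = q.derivative.derivative := by
    rw [Function.iterate_succ_apply', hd2]
  have hd0 : Polynomial.derivative^[k] (legendre l) = q := rfl
  rw [hd0, hd2, hd3] at hode
  simp only [Polynomial.eval_add, Polynomial.eval_mul, Polynomial.eval_sub, Polynomial.eval_pow,
    Polynomial.eval_X, Polynomial.eval_one, Polynomial.eval_C, Polynomial.eval_zero] at hode
  simp only [Polynomial.eval_mul, Polynomial.eval_C, Polynomial.eval_X, Polynomial.derivative_mul,
    Polynomial.derivative_C, Polynomial.derivative_X, Polynomial.eval_add, zero_mul, mul_one,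
    zero_add]
  have hcos : Real.cos θ ^ 2 = 1 - Real.sin θ ^ 2 := by rw [Real.cos_sq']
  have key : (Real.sin θ)⁻¹ * (Real.sin θ ^ k * (k * Real.cos θ / Real.sin θ *
      (k * Real.cos θ * q.eval (Real.cos θ)) - Real.sin θ * (k * q.eval (Real.cos θ) +
        k * Real.cos θ * q.derivative.eval (Real.cos θ))) -
      Real.sin θ ^ (k + 2) * ((k + 2 : ℝ) * Real.cos θ / Real.sin θ *
        q.derivative.eval (Real.cos θ) -
        Real.sin θ * q.derivative.derivative.eval (Real.cos θ))) +
      (Real.sin θ ^ 2)⁻¹ * (Real.sin θ ^ k * q.eval (Real.cos θ) * -(k : ℝ) ^ 2) =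
      -((l : ℝ) * (l + 1)) * (Real.sin θ ^ k * q.eval (Real.cos θ)) := by
    have hs := hθ.ne'
    set S := Real.sin θ
    set c' := Real.cos θ
    set a := q.eval c'
    set b := q.derivative.eval c'
    set d := q.derivative.derivative.eval c'
    rw [pow_add]
    field_simp
    linear_combination (-S ^ 2) * hode + (S ^ 2 * d + (k : ℝ) ^ 2 * a) * hcos
  have key' := congrArg (fun r : ℝ => (r : ℂ) * e) key
  beta_reduce at key'
  push_cast at key' ⊢
  linear_combination key'

/-! ### The surface measure in spherical coordinates. -/

/-- The measure `sin ϑ dϑ` on `(0, π)`. -/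
def colatMeasure : Measure ℝ :=
  (volume.restrict (Set.Ioo 0 Real.pi)).withDensity fun θ => ENNReal.ofReal (Real.sin θ)

/-- The measure `dφ` on `(-π, π)`. -/
def lonMeasure : Measure ℝ := volume.restrict (Set.Ioo (-Real.pi) Real.pi)

instance : IsFiniteMeasure lonMeasure := by unfold lonMeasure; infer_instance

instance : IsFiniteMeasure colatMeasure := by
  unfold colatMeasure
  refine isFiniteMeasure_withDensity (ne_of_lt ?_)
  refine (lintegral_mono (g := fun _ => (1 : ℝ≥0∞)) fun θ => ?_).trans_lt ?_
  · rw [← ENNReal.ofReal_one]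
    exact ENNReal.ofReal_le_ofReal (Real.sin_le_one θ)
  · simp

/-- The volume preserving identification `x ↦ (x₂, (x₀, x₁))` of `ℝ³` with `ℝ × ℝ²`. -/
def axisPlaneEquiv : EuclideanSpace ℝ (Fin 3) ≃ᵐ ℝ × ℝ × ℝ :=
  ((MeasurableEquiv.toLp 2 (Fin 3 → ℝ)).symm.trans
    (MeasurableEquiv.piFinSuccAbove (fun _ => ℝ) 2)).trans
      ((MeasurableEquiv.refl ℝ).prodCongr MeasurableEquiv.finTwoArrow)

theorem axisPlaneEquiv_apply (x : EuclideanSpace ℝ (Fin 3)) :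
    axisPlaneEquiv x = (x 2, x 0, x 1) := rfl

theorem measurePreserving_axisPlaneEquiv : MeasurePreserving axisPlaneEquiv := by
  have h1 := EuclideanSpace.volume_preserving_symm_measurableEquiv_toLp (Fin 3)
  have h2 := volume_preserving_piFinSuccAbove (fun _ : Fin 3 => ℝ) 2
  have h3 : MeasurePreserving ((MeasurableEquiv.refl ℝ).prodCongr
      (MeasurableEquiv.finTwoArrow (α := ℝ))) volume volume :=
    (MeasurePreserving.id volume).prod (volume_preserving_finTwoArrow ℝ)
  exact h3.comp (h2.comp h1)

theorem norm_eq_sqrt_coords (x : EuclideanSpace ℝ (Fin 3)) :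
    ‖x‖ = Real.sqrt (x 2 ^ 2 + (x 0 ^ 2 + x 1 ^ 2)) := by
  rw [EuclideanSpace.norm_eq, Fin.sum_univ_three]
  congr 1
  simp only [Real.norm_eq_abs, sq_abs]
  ring

/-- The part of the unit ball over a set of angles, in the coordinates of `axisPlaneEquiv`. -/
def ballSector (S : Set (ℝ × ℝ)) : Set (ℝ × ℝ × ℝ) :=
  {p | 0 < p.1 ^ 2 + (p.2.1 ^ 2 + p.2.2 ^ 2) ∧ p.1 ^ 2 + (p.2.1 ^ 2 + p.2.2 ^ 2) < 1 ∧
    (Real.arccos (p.1 / Real.sqrt (p.1 ^ 2 + (p.2.1 ^ 2 + p.2.2 ^ 2))),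
      Complex.arg ⟨p.2.1, p.2.2⟩) ∈ S}

theorem measurableSet_ballSector {S : Set (ℝ × ℝ)} (hS : MeasurableSet S) :
    MeasurableSet (ballSector S) := by
  have h1 : Measurable fun p : ℝ × ℝ × ℝ => p.1 ^ 2 + (p.2.1 ^ 2 + p.2.2 ^ 2) := by fun_prop
  have h2 : Measurable fun p : ℝ × ℝ × ℝ => Complex.arg ⟨p.2.1, p.2.2⟩ :=
    Complex.measurable_arg.comp
      (Complex.measurableEquivRealProd.symm.measurable.comp (by fun_prop))
  have h3 : Measurable fun p : ℝ × ℝ × ℝ =>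
      Real.arccos (p.1 / Real.sqrt (p.1 ^ 2 + (p.2.1 ^ 2 + p.2.2 ^ 2))) :=
    Real.continuous_arccos.measurable.comp
      (measurable_fst.div (Real.continuous_sqrt.measurable.comp h1))
  exact (measurableSet_lt measurable_const h1).inter
    ((measurableSet_lt h1 measurable_const).inter ((h3.prodMk h2) hS))

theorem arg_smul_coords {r : ℝ} (hr : 0 < r) (a b : ℝ) :
    Complex.arg ⟨r * a, r * b⟩ = Complex.arg ⟨a, b⟩ := by
  rw [← Complex.arg_real_mul ⟨a, b⟩ hr]
  congr 1
  apply Complex.ext <;> simp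

-- Both angles are invariant under positive scaling, so the cone over a set of angles is cut out by
-- the angles of the point itself.
open scoped Pointwise in
theorem Ioo_smul_preimage_angles (S : Set (ℝ × ℝ)) :
    Set.Ioo (0 : ℝ) 1 • (Subtype.val '' ((fun y : S2 => (colat y, lon y)) ⁻¹' S)) =
      axisPlaneEquiv ⁻¹' ballSector S := by
  ext x
  simp only [Set.mem_smul, Set.mem_image, Set.mem_preimage, axisPlaneEquiv_apply, ballSector,
    Set.mem_ofPred_eq]
  rw [← norm_eq_sqrt_coords]
  have hsq : x 2 ^ 2 + (x 0 ^ 2 + x 1 ^ 2) = ‖x‖ ^ 2 := by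
    rw [norm_eq_sqrt_coords, Real.sq_sqrt (by positivity)]
  rw [hsq]
  constructor
  · rintro ⟨r, ⟨hr0, hr1⟩, _, ⟨y, hy, rfl⟩, rfl⟩
    have hn : ‖r • (y : EuclideanSpace ℝ (Fin 3))‖ = r := by
      rw [norm_smul, norm_eq_of_mem_sphere y, mul_one, Real.norm_of_nonneg hr0.le]
    rw [hn]
    refine ⟨by positivity, by nlinarith, ?_⟩
    simp only [PiLp.smul_apply, smul_eq_mul]
    rw [arg_smul_coords hr0, mul_div_cancel_left₀ _ hr0.ne']
    exact hy
  · rintro ⟨h0, h1, h2⟩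
    have hr0 : 0 < ‖x‖ := by
      rcases (norm_nonneg x).lt_or_eq with h | h
      · exact h
      · rw [← h] at h0; simp at h0
    have hr1 : ‖x‖ < 1 := by nlinarith
    refine ⟨‖x‖, ⟨hr0, hr1⟩, ‖x‖⁻¹ • x, ⟨⟨‖x‖⁻¹ • x, ?_⟩, ?_, rfl⟩, ?_⟩
    · simp [norm_smul, hr0.ne']
    · unfold colat lon
      simp only [PiLp.smul_apply, smul_eq_mul]
      rw [arg_smul_coords (inv_pos.2 hr0), inv_mul_eq_div]
      exact h2
    · rw [smul_smul, mul_inv_cancel₀ hr0.ne', one_smul]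

/-- The density of a sector of the ball in cylindrical coordinates `(z, ρ, φ)`. -/
def cylDensity (S : Set (ℝ × ℝ)) (z ρ φ : ℝ) : ℝ≥0∞ :=
  {p : ℝ × ℝ × ℝ | 0 < p.2.1 ∧ p.1 ^ 2 + p.2.1 ^ 2 < 1 ∧
    (Real.arccos (p.1 / Real.sqrt (p.1 ^ 2 + p.2.1 ^ 2)), p.2.2) ∈ S}.indicator
      (fun p => ENNReal.ofReal p.2.1) (z, ρ, φ)

open Classical in
theorem cylDensity_eq (S : Set (ℝ × ℝ)) (z ρ φ : ℝ) :
    cylDensity S z ρ φ = if 0 < ρ ∧ z ^ 2 + ρ ^ 2 < 1 ∧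
      (Real.arccos (z / Real.sqrt (z ^ 2 + ρ ^ 2)), φ) ∈ S then ENNReal.ofReal ρ else 0 := by
  simp only [cylDensity, Set.indicator_apply, Set.mem_ofPred_eq]

theorem measurable_cylDensity {S : Set (ℝ × ℝ)} (hS : MeasurableSet S) :
    Measurable fun p : ℝ × ℝ × ℝ => cylDensity S p.1 p.2.1 p.2.2 := by
  have h1 : Measurable fun p : ℝ × ℝ × ℝ => p.1 ^ 2 + p.2.1 ^ 2 := by fun_prop
  have h3 : Measurable fun p : ℝ × ℝ × ℝ =>
      Real.arccos (p.1 / Real.sqrt (p.1 ^ 2 + p.2.1 ^ 2)) :=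
    Real.continuous_arccos.measurable.comp
      (measurable_fst.div (Real.continuous_sqrt.measurable.comp h1))
  unfold cylDensity
  refine Measurable.indicator (by fun_prop) ?_
  exact (measurableSet_lt measurable_const (measurable_fst.comp measurable_snd)).inter
    ((measurableSet_lt h1 measurable_const).inter
      ((h3.prodMk (measurable_snd.comp measurable_snd)) hS))

/-- Polar coordinates in the horizontal plane at height `z`; the Jacobian `ρ` is built into
`cylDensity`. -/
theorem lintegral_ballSector_slice (S : Set (ℝ × ℝ)) (z : ℝ) :
    ∫⁻ p : ℝ × ℝ, (ballSector S).indicator 1 (z, p) =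
      ∫⁻ p in Set.Ioi (0 : ℝ) ×ˢ Set.Ioo (-Real.pi) Real.pi, cylDensity S z p.1 p.2 := by
  rw [← lintegral_comp_polarCoord_symm, polarCoord_target]
  refine setLIntegral_congr_fun (measurableSet_Ioi.prod measurableSet_Ioo) fun p hp => ?_
  obtain ⟨ρ, φ⟩ := p
  have hρ : 0 < ρ := hp.1
  have hφ : φ ∈ Set.Ioo (-Real.pi) Real.pi := hp.2
  have harg : Complex.arg ⟨ρ * Real.cos φ, ρ * Real.sin φ⟩ = φ := by
    refine Eq.trans ?_ (Complex.arg_mul_cos_add_sin_mul_I hρ ⟨hφ.1, hφ.2.le⟩)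
    congr 1
    apply Complex.ext <;> simp [Complex.cos_ofReal_re, Complex.sin_ofReal_re]
  have hsq : (ρ * Real.cos φ) ^ 2 + (ρ * Real.sin φ) ^ 2 = ρ ^ 2 := by
    linear_combination ρ ^ 2 * Real.sin_sq_add_cos_sq φ
  have : 0 < z ^ 2 + ρ ^ 2 := by positivity
  classical
  rw [polarCoord_symm_apply]
  simp only [cylDensity_eq, ballSector, Set.indicator_apply, Set.mem_ofPred_eq, harg,
    hsq, hρ, true_and, Pi.one_apply, smul_eq_mul, this, mul_ite, mul_one, mul_zero]

/-- A second polar change, in the `(z, ρ)` plane: the Jacobian `r` times the density `ρ = r sin θ`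
is `r² sin θ`, and the condition `r < 1` decouples from the angles. Angles `θ ≤ 0` correspond to `ρ
≤ 0`, where the density vanishes. -/
theorem cylDensity_polar (S : Set (ℝ × ℝ)) {r θ : ℝ} (φ : ℝ) (hr : 0 < r)
    (hθ : θ ∈ Set.Ioo (-Real.pi) Real.pi) :
    ENNReal.ofReal r * cylDensity S (r * Real.cos θ) (r * Real.sin θ) φ =
      (Set.Iio 1).indicator (fun r => ENNReal.ofReal (r ^ 2)) r *
        (Set.Ioo 0 Real.pi).indicator
          (fun θ => ENNReal.ofReal (Real.sin θ) * S.indicator 1 (θ, φ)) θ := by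
  have hsq : (r * Real.cos θ) ^ 2 + (r * Real.sin θ) ^ 2 = r ^ 2 := by
    linear_combination r ^ 2 * Real.sin_sq_add_cos_sq θ
  by_cases h0 : 0 < θ
  · have hs : 0 < Real.sin θ := Real.sin_pos_of_pos_of_lt_pi h0 hθ.2
    have hc : Real.arccos (Real.cos θ) = θ := Real.arccos_cos h0.le hθ.2.le
    have hr1 : r ^ 2 < 1 ↔ r < 1 := by
      rw [sq_lt_one_iff₀ hr.le]
    rw [Set.indicator_of_mem (s := Set.Ioo 0 Real.pi) ⟨h0, hθ.2⟩]
    classical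
    simp only [cylDensity_eq, Set.indicator_apply, hsq, Real.sqrt_sq hr.le,
      mul_div_cancel_left₀ _ hr.ne', hc, mul_pos hr hs, true_and, hr1, Set.mem_Iio, Pi.one_apply]
    by_cases h1 : r < 1 <;> by_cases h2 : (θ, φ) ∈ S <;> simp only [h1, h2, and_self, and_true,
      and_false, if_true, if_false, mul_one, mul_zero, zero_mul]
    rw [ENNReal.ofReal_mul hr.le, pow_two, ENNReal.ofReal_mul hr.le, mul_assoc]
  · have hs : ¬ 0 < r * Real.sin θ := by
      have := Real.sin_nonpos_of_nonpos_of_neg_pi_le (not_lt.1 h0) hθ.1.le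
      exact not_lt.2 (mul_nonpos_of_nonneg_of_nonpos hr.le this)
    rw [Set.indicator_of_notMem (s := Set.Ioo 0 Real.pi) (fun h => h0 h.1), mul_zero,
      cylDensity_eq, if_neg (fun h => hs h.1), mul_zero]

theorem lintegral_unit_interval_sq :
    ∫⁻ r in Set.Ioi (0 : ℝ), (Set.Iio 1).indicator (fun r => ENNReal.ofReal (r ^ 2)) r = 3⁻¹ := by
  rw [lintegral_indicator measurableSet_Iio, Measure.restrict_restrict measurableSet_Iio,
    Set.inter_comm, Set.Ioi_inter_Iio, Measure.restrict_congr_set Ioo_ae_eq_Ioc,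
    ← ofReal_integral_eq_lintegral_ofReal, ← intervalIntegral.integral_of_le zero_le_one,
    integral_pow]
  · norm_num
    rw [ENNReal.ofReal_div_of_pos (by norm_num)]
    simp
  · exact ((continuous_pow 2).intervalIntegrable 0 1).1
  · exact Eventually.of_forall fun r => by positivity

/-- In spherical coordinates the surface measure is `sin ϑ dϑ dφ`. -/
theorem map_angles_surf :
    Measure.map (fun y : S2 => (colat y, lon y)) surf = colatMeasure.prod lonMeasure := by
  ext S hS
  have hm : Measurable fun y : S2 => (colat y, lon y) := measurable_colat.prodMk measurable_lon
  -- The surface measure of a set is three times the volume of the cone over it in the unit ball;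
  -- the factor `3` cancels against `∫ r² dr = 1/3` at the end.
  rw [Measure.map_apply hm hS, Measure.toSphere_apply' _ (hm hS), Ioo_smul_preimage_angles,
    measurePreserving_axisPlaneEquiv.measure_preimage_equiv,
    ← lintegral_indicator_one (measurableSet_ballSector hS), Measure.volume_eq_prod,
    lintegral_prod _ (measurable_one.indicator (measurableSet_ballSector hS)).aemeasurable]
  simp only [lintegral_ballSector_slice]
  have hcyl := measurable_cylDensity hS
  have h1 : ∀ z : ℝ, ∫⁻ p in Set.Ioi (0 : ℝ) ×ˢ Set.Ioo (-Real.pi) Real.pi,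
      cylDensity S z p.1 p.2 = ∫⁻ ρ in Set.Ioi (0 : ℝ), ∫⁻ φ, cylDensity S z ρ φ ∂lonMeasure := by
    intro z
    have hz : Measurable fun p : ℝ × ℝ => cylDensity S z p.1 p.2 :=
      hcyl.comp (measurable_const.prodMk measurable_id)
    rw [Measure.volume_eq_prod, ← Measure.prod_restrict, lintegral_prod _ hz.aemeasurable]
    rfl
  -- The integral in `ρ` is extended to the whole line so that `(z, ρ)` fills a plane and polar
  -- coordinates apply again.
  have h2 : ∀ z : ℝ, ∫⁻ ρ in Set.Ioi (0 : ℝ), ∫⁻ φ, cylDensity S z ρ φ ∂lonMeasure =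
      ∫⁻ ρ, ∫⁻ φ, cylDensity S z ρ φ ∂lonMeasure := by
    intro z
    rw [← lintegral_indicator measurableSet_Ioi]
    refine lintegral_congr fun ρ => ?_
    by_cases hρ : 0 < ρ
    · rw [Set.indicator_of_mem (show ρ ∈ Set.Ioi (0 : ℝ) from hρ)]
    · rw [Set.indicator_of_notMem (show ρ ∉ Set.Ioi (0 : ℝ) from hρ)]
      symm
      convert lintegral_zero with φ
      rw [cylDensity_eq, if_neg (fun h => hρ h.1)]
  simp only [h1, h2]
  have h3 : ∫⁻ z : ℝ, ∫⁻ ρ : ℝ, ∫⁻ φ, cylDensity S z ρ φ ∂lonMeasure =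
      ∫⁻ φ, (∫⁻ p : ℝ × ℝ, cylDensity S p.1 p.2 φ) ∂lonMeasure := by
    have hm3 : Measurable fun q : (ℝ × ℝ) × ℝ => cylDensity S q.1.1 q.1.2 q.2 :=
      hcyl.comp (by fun_prop : Measurable fun q : (ℝ × ℝ) × ℝ => (q.1.1, q.1.2, q.2))
    rw [← lintegral_lintegral_swap (f := fun (p : ℝ × ℝ) φ => cylDensity S p.1 p.2 φ)
      hm3.aemeasurable, Measure.volume_eq_prod, lintegral_prod]
    exact (Measurable.lintegral_prod_right' hm3).aemeasurable
  rw [h3, Measure.prod_apply_symm hS]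
  have hfr : (Module.finrank ℝ (EuclideanSpace ℝ (Fin 3)) : ℝ≥0∞) = 3 := by simp
  rw [hfr, ← lintegral_const_mul]
  swap
  · have hm3 : Measurable fun q : ℝ × (ℝ × ℝ) => cylDensity S q.2.1 q.2.2 q.1 :=
      hcyl.comp (by fun_prop : Measurable fun q : ℝ × (ℝ × ℝ) => (q.2.1, q.2.2, q.1))
    exact hm3.lintegral_prod_right'
  refine lintegral_congr fun φ => ?_
  have hSφ : MeasurableSet ((fun θ => (θ, φ)) ⁻¹' S) := measurable_prodMk_right hS
  rw [← lintegral_comp_polarCoord_symm, polarCoord_target]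
  have h4 : ∫⁻ p in Set.Ioi (0 : ℝ) ×ˢ Set.Ioo (-Real.pi) Real.pi, ENNReal.ofReal p.1 •
      cylDensity S (polarCoord.symm p).1 (polarCoord.symm p).2 φ =
      ∫⁻ p in Set.Ioi (0 : ℝ) ×ˢ Set.Ioo (-Real.pi) Real.pi,
        (Set.Iio 1).indicator (fun r => ENNReal.ofReal (r ^ 2)) p.1 *
        (Set.Ioo 0 Real.pi).indicator
          (fun θ => ENNReal.ofReal (Real.sin θ) * S.indicator 1 (θ, φ)) p.2 := by
    refine setLIntegral_congr_fun (measurableSet_Ioi.prod measurableSet_Ioo) fun p hp => ?_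
    exact cylDensity_polar S φ hp.1 hp.2
  have hmθ : Measurable fun θ => ENNReal.ofReal (Real.sin θ) * S.indicator 1 (θ, φ) :=
    (by fun_prop : Measurable fun θ => ENNReal.ofReal (Real.sin θ)).mul
      ((measurable_one.indicator hS).comp measurable_prodMk_right)
  rw [h4, Measure.volume_eq_prod, ← Measure.prod_restrict, lintegral_prod_mul,
    lintegral_unit_interval_sq, ← mul_assoc, ENNReal.mul_inv_cancel (by simp) (by simp), one_mul,
    lintegral_indicator measurableSet_Ioo, Measure.restrict_restrict measurableSet_Ioo,
    Set.inter_eq_left.2 (Set.Ioo_subset_Ioo_left (by linarith [Real.pi_pos]))]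
  · unfold colatMeasure
    rw [withDensity_apply _ hSφ, ← lintegral_indicator hSφ]
    refine lintegral_congr fun θ => ?_
    by_cases h : (θ, φ) ∈ S
    · rw [Set.indicator_of_mem h, Set.indicator_of_mem (show θ ∈ (fun θ => (θ, φ)) ⁻¹' S from h)]
      simp
    · rw [Set.indicator_of_notMem h,
        Set.indicator_of_notMem (show θ ∉ (fun θ => (θ, φ)) ⁻¹' S from h)]
      simp
  · exact (Measurable.indicator (by fun_prop) measurableSet_Iio).aemeasurable
  · exact (hmθ.indicator measurableSet_Ioo).aemeasurable

/-- The poles are null, so the pointwise eigenvalue equation can be used under the integral. -/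
theorem ae_sin_colat_pos : ∀ᵐ y : S2 ∂surf, 0 < Real.sin (colat y) := by
  have hm : Measurable fun y : S2 => (colat y, lon y) := measurable_colat.prodMk measurable_lon
  have h1 : ∀ᵐ θ ∂colatMeasure, 0 < Real.sin θ := by
    have : ∀ᵐ θ ∂(volume.restrict (Set.Ioo 0 Real.pi)), 0 < Real.sin θ := by
      filter_upwards [ae_restrict_mem measurableSet_Ioo] with θ hθ
      exact Real.sin_pos_of_pos_of_lt_pi hθ.1 hθ.2
    exact (withDensity_absolutelyContinuous _ _).ae_le this
  have h2 : ∀ᵐ p ∂(Measure.map (fun y : S2 => (colat y, lon y)) surf), 0 < Real.sin p.1 := by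
    rw [map_angles_surf]
    exact Measure.quasiMeasurePreserving_fst.ae h1
  exact ae_of_ae_map hm.aemeasurable h2

/-! ### Orthonormality and the eigenvalue relation in `L²`. -/

open Polynomial in
theorem integral_eval_cos_colatMeasure (p : ℝ[X]) :
    ∫ θ, p.eval (Real.cos θ) ∂colatMeasure = ∫ x in (-1 : ℝ)..1, p.eval x := by
  unfold colatMeasure
  rw [integral_withDensity_eq_integral_toReal_smul (by fun_prop)
    (Eventually.of_forall fun θ => ENNReal.ofReal_lt_top)]
  have h1 : ∫ θ in Set.Ioo 0 Real.pi,
      (ENNReal.ofReal (Real.sin θ)).toReal • p.eval (Real.cos θ) =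
      ∫ θ in Set.Ioo 0 Real.pi, -(p.eval (Real.cos θ) * -Real.sin θ) := by
    refine setIntegral_congr_fun measurableSet_Ioo fun θ hθ => ?_
    have := Real.sin_pos_of_pos_of_lt_pi hθ.1 hθ.2
    simp only [ENNReal.toReal_ofReal this.le, smul_eq_mul]
    ring
  rw [h1, integral_neg, ← integral_Ioc_eq_integral_Ioo,
    ← intervalIntegral.integral_of_le Real.pi_pos.le]
  have h2 := intervalIntegral.integral_comp_mul_deriv (a := 0) (b := Real.pi)
    (f := Real.cos) (f' := fun θ => -Real.sin θ) (g := fun x => p.eval x)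
    (fun x _ => Real.hasDerivAt_cos x) (by fun_prop) (by fun_prop)
  simp only [Function.comp, Real.cos_zero, Real.cos_pi] at h2
  rw [h2, intervalIntegral.integral_symm, neg_neg]

theorem integral_exp_lonMeasure (n : ℤ) :
    ∫ φ : ℝ, Complex.exp (Complex.I * n * φ) ∂lonMeasure =
      if n = 0 then 2 * (Real.pi : ℂ) else 0 := by
  unfold lonMeasure
  rw [← integral_Ioc_eq_integral_Ioo,
    ← intervalIntegral.integral_of_le (by linarith [Real.pi_pos])]
  split_ifs with h
  · subst h
    simp
    ring
  · have hc : Complex.I * (n : ℂ) ≠ 0 := mul_ne_zero Complex.I_ne_zero (by exact_mod_cast h)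
    rw [integral_exp_mul_complex hc, div_eq_zero_iff]
    left
    have := Complex.exp_int_mul_two_pi_mul_I n
    rw [sub_eq_zero, show Complex.I * (n : ℂ) * (Real.pi : ℝ) =
      Complex.I * n * ((-Real.pi : ℝ) : ℂ) + n * (2 * Real.pi * Complex.I) by push_cast; ring,
      Complex.exp_add, this, mul_one]

theorem harmConst_mul_harmConst (l : ℕ) (m : ℤ) :
    harmConst l m * harmConst l m = (2 * l + 1) / (4 * Real.pi) *
      (((l - m.natAbs).factorial : ℝ) / ((l + m.natAbs).factorial : ℝ)) := by
  have h1 : (if 0 ≤ m then (-1 : ℝ) ^ m.natAbs else 1) * (if 0 ≤ m then (-1) ^ m.natAbs else 1) =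
      1 := by
    split_ifs
    · rw [← mul_pow]; simp
    · simp
  have h2 := Real.mul_self_sqrt (show 0 ≤ (2 * (l : ℝ) + 1) / (4 * Real.pi) *
    (((l - m.natAbs).factorial : ℝ) / ((l + m.natAbs).factorial : ℝ)) by positivity)
  unfold harmConst
  rw [mul_mul_mul_comm, h1, h2, one_mul]

theorem harmConst_ne_zero (l : ℕ) (m : ℤ) : harmConst l m ≠ 0 := by
  have h : 0 < harmConst l m * harmConst l m := by
    rw [harmConst_mul_harmConst]
    positivity
  exact fun h0 => by simp [h0] at h

/-- In spherical coordinates the integral factorises: the longitude separates different orders, and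
for equal orders the substitution `x = cos θ` leaves `legendreIntegral`. The restriction on `m`
matters only for the norm, since `harm l m` vanishes when `|m| > l`. -/
theorem integral_harm_mul_conj (l l' : ℕ) (m m' : ℤ) (hm : m.natAbs ≤ l) :
    ∫ y, onSphere (harm l m) y * (starRingEnd ℂ) (onSphere (harm l' m') y) ∂surf =
      if l = l' ∧ m = m' then 1 else 0 := by
  have hang : Measurable fun y : S2 => (colat y, lon y) := measurable_colat.prodMk measurable_lon
  have hcont : Continuous fun p : ℝ × ℝ =>
      harm l m p.1 p.2 * (starRingEnd ℂ) (harm l' m' p.1 p.2) :=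
    (continuous_harm l m).mul (Complex.continuous_conj.comp (continuous_harm l' m'))
  have h1 := integral_map (μ := surf) hang.aemeasurable
    (f := fun p : ℝ × ℝ => harm l m p.1 p.2 * (starRingEnd ℂ) (harm l' m' p.1 p.2))
    hcont.aestronglyMeasurable
  have h1' : ∫ y, onSphere (harm l m) y * (starRingEnd ℂ) (onSphere (harm l' m') y) ∂surf = _ :=
    h1.symm
  rw [h1', map_angles_surf]
  have h2 : ∀ p : ℝ × ℝ, harm l m p.1 p.2 * (starRingEnd ℂ) (harm l' m' p.1 p.2) =
      ((harmConst l m * harmConst l' m' *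
        (|Real.sin p.1| ^ m.natAbs * (harmPoly l m).eval (Real.cos p.1) *
          (|Real.sin p.1| ^ m'.natAbs * (harmPoly l' m').eval (Real.cos p.1))) : ℝ) : ℂ) *
        Complex.exp (Complex.I * (m - m' : ℤ) * p.2) := by
    intro p
    rw [harm_eq, harm_eq, map_mul, Complex.conj_ofReal, ← Complex.exp_conj]
    simp only [map_mul, Complex.conj_I, Complex.conj_ofReal, map_intCast]
    rw [mul_mul_mul_comm, ← Complex.exp_add, ← Complex.ofReal_mul]
    congr 2
    · ring
    · push_cast; ring
  simp only [h2]
  rw [integral_prod_mul (μ := colatMeasure) (ν := lonMeasure)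
    (fun θ : ℝ => ((harmConst l m * harmConst l' m' *
        (|Real.sin θ| ^ m.natAbs * (harmPoly l m).eval (Real.cos θ) *
          (|Real.sin θ| ^ m'.natAbs * (harmPoly l' m').eval (Real.cos θ))) : ℝ) : ℂ))
    (fun φ : ℝ => Complex.exp (Complex.I * (m - m' : ℤ) * φ)), integral_exp_lonMeasure]
  by_cases hmm : m = m'
  · subst hmm
    have h3 : ∀ θ : ℝ, |Real.sin θ| ^ m.natAbs * (harmPoly l m).eval (Real.cos θ) *
          (|Real.sin θ| ^ m.natAbs * (harmPoly l' m).eval (Real.cos θ)) =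
        ((1 - Polynomial.X ^ 2) ^ m.natAbs * Polynomial.derivative^[m.natAbs] (legendre l) *
          Polynomial.derivative^[m.natAbs] (legendre l')).eval (Real.cos θ) := by
      intro θ
      have : |Real.sin θ| ^ m.natAbs * |Real.sin θ| ^ m.natAbs =
          (1 - Real.cos θ ^ 2) ^ m.natAbs := by
        rw [← mul_pow, abs_mul_abs_self, ← Real.sin_sq, pow_two]
      simp only [Polynomial.eval_mul, Polynomial.eval_pow, Polynomial.eval_sub,
        Polynomial.eval_one, Polynomial.eval_X, harmPoly, ← this]
      ring
    have h4 : ∫ θ, ((harmConst l m * harmConst l' m *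
        (|Real.sin θ| ^ m.natAbs * (harmPoly l m).eval (Real.cos θ) *
          (|Real.sin θ| ^ m.natAbs * (harmPoly l' m).eval (Real.cos θ))) : ℝ) : ℂ)
        ∂colatMeasure =
        ((harmConst l m * harmConst l' m * legendreIntegral m.natAbs l l' : ℝ) : ℂ) := by
      rw [integral_complex_ofReal, integral_const_mul]
      simp only [h3]
      rw [integral_eval_cos_colatMeasure]
      rfl
    rw [h4, sub_self, if_pos rfl]
    by_cases hl : l = l'
    · subst hl
      rw [if_pos ⟨rfl, rfl⟩, harmConst_mul_harmConst, legendreIntegral_self l _ hm]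
      have h5 : ((l - m.natAbs).factorial : ℝ) ≠ 0 := by positivity
      have h6 : ((l + m.natAbs).factorial : ℝ) ≠ 0 := by positivity
      have h7 : (2 * (l : ℝ) + 1) ≠ 0 := by positivity
      rw [← Complex.ofReal_one, ← Complex.ofReal_ofNat 2, ← Complex.ofReal_mul,
        ← Complex.ofReal_mul]
      congr 1
      field_simp
      ring
    · rw [legendreIntegral_of_ne _ hl, if_neg (fun h => hl h.1)]
      simp
  · rw [if_neg (sub_ne_zero.2 hmm), if_neg (fun h => hmm h.2), mul_zero]

theorem pair_harm (f : L2S) (l : ℕ) (m : ℤ) : pair f (harm l m) = inner ℂ (Y l m) f := by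
  rw [L2.inner_def]
  unfold pair Y
  refine integral_congr_ae ?_
  filter_upwards [(memLp_harm l m).coeFn_toLp] with y hy
  rw [hy, RCLike.inner_apply]

theorem inner_Y (l l' : ℕ) (m m' : ℤ) (hm' : m'.natAbs ≤ l') :
    inner ℂ (Y l m) (Y l' m') = if l = l' ∧ m = m' then 1 else 0 := by
  rw [← pair_harm]
  unfold pair Y
  have h := integral_harm_mul_conj l' l m' m hm'
  rw [show (if l = l' ∧ m = m' then (1 : ℂ) else 0) = if l' = l ∧ m' = m then 1 else 0 by
    simp only [eq_comm], ← h]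
  refine integral_congr_ae ?_
  filter_upwards [(memLp_harm l' m').coeFn_toLp] with y hy
  rw [hy]

/-- The eigenvalue relation for the pairing with `Δ Y_{ℓm}`. -/
theorem pair_laplaceS2_harm (f : L2S) (l : ℕ) (m : ℤ) :
    pair f (laplaceS2 (harm l m)) = -((l : ℝ) * (l + 1) : ℝ) * pair f (harm l m) := by
  unfold pair
  rw [← integral_const_mul]
  refine integral_congr_ae ?_
  filter_upwards [ae_sin_colat_pos] with y hy
  unfold onSphere
  rw [laplaceS2_harm l m _ hy, map_mul, map_neg, Complex.conj_ofReal]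
  ring

/-- The indices `(ℓ, m)`, `-ℓ ≤ m ≤ ℓ`, of the spherical harmonics. -/
abbrev HarmIndex : Type := (l : ℕ) × {m : ℤ // m ∈ Finset.Icc (-(l : ℤ)) l}

theorem natAbs_le_of_mem_Icc {l : ℕ} {m : ℤ} (h : m ∈ Finset.Icc (-(l : ℤ)) l) :
    m.natAbs ≤ l := by
  rw [Finset.mem_Icc] at h
  omega

theorem orthonormal_Y : Orthonormal ℂ fun i : HarmIndex => Y i.1 i.2.1 := by
  classical
  rw [orthonormal_iff_ite]
  rintro ⟨l, m, hm⟩ ⟨l', m', hm'⟩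
  rw [inner_Y l l' m m' (natAbs_le_of_mem_Icc hm')]
  refine if_congr ⟨?_, ?_⟩ rfl rfl
  · rintro ⟨rfl, rfl⟩; rfl
  · intro h
    have h1 : l = l' := congrArg Sigma.fst h
    subst h1
    simp only [Sigma.mk.injEq, heq_eq_eq, Subtype.mk.injEq, true_and] at h
    exact ⟨rfl, h⟩

/-! ### Completeness of the spherical harmonics. -/

/-- The coordinate `z = cos ϑ` on the sphere. -/
def coordZ : C(S2, ℂ) := ⟨fun y => (((y : EuclideanSpace ℝ (Fin 3)) 2 : ℝ) : ℂ), by fun_prop⟩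

/-- The coordinate `x + i y = sin ϑ e^{iφ}` on the sphere. -/
def coordW : C(S2, ℂ) :=
  ⟨fun y => (((y : EuclideanSpace ℝ (Fin 3)) 0 : ℝ) : ℂ) +
    (((y : EuclideanSpace ℝ (Fin 3)) 1 : ℝ) : ℂ) * Complex.I, by fun_prop⟩

theorem coord_sq_sum (y : S2) :
    (y : EuclideanSpace ℝ (Fin 3)) 2 ^ 2 + ((y : EuclideanSpace ℝ (Fin 3)) 0 ^ 2 +
      (y : EuclideanSpace ℝ (Fin 3)) 1 ^ 2) = 1 := by
  have h := norm_eq_sqrt_coords (y : EuclideanSpace ℝ (Fin 3))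
  rw [norm_eq_of_mem_sphere y] at h
  exact (Real.sqrt_eq_one.1 h.symm)

theorem coordW_mul_star : coordW * star coordW = 1 - coordZ ^ 2 := by
  ext y
  have h := coord_sq_sum y
  have h' := congrArg (fun r : ℝ => (r : ℂ)) h
  push_cast at h'
  simp only [coordW, coordZ, ContinuousMap.mul_apply, ContinuousMap.star_apply,
    ContinuousMap.coe_mk, ContinuousMap.sub_apply, ContinuousMap.one_apply,
    ContinuousMap.pow_apply, Complex.star_def, map_add, map_mul, Complex.conj_ofReal,
    Complex.conj_I]
  linear_combination h' - (((y : EuclideanSpace ℝ (Fin 3)) 1 : ℝ) : ℂ) ^ 2 * Complex.I_sq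

theorem star_coordZ : star coordZ = coordZ := by
  ext y
  simp [coordZ]

theorem cos_colat (y : S2) : Real.cos (colat y) = (y : EuclideanSpace ℝ (Fin 3)) 2 := by
  have h := coord_sq_sum y
  unfold colat
  refine Real.cos_arccos ?_ ?_ <;>
    nlinarith [sq_nonneg ((y : EuclideanSpace ℝ (Fin 3)) 0),
      sq_nonneg ((y : EuclideanSpace ℝ (Fin 3)) 1)]

theorem coordW_eq (y : S2) :
    coordW y = (|Real.sin (colat y)| : ℝ) * Complex.exp (Complex.I * lon y) := by
  have h := coord_sq_sum y
  have h1 : |Real.sin (colat y)| = ‖coordW y‖ := by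
    rw [← Real.sqrt_sq_eq_abs, Real.sin_sq, cos_colat]
    simp only [coordW, ContinuousMap.coe_mk]
    rw [Complex.norm_add_mul_I]
    congr 1
    linarith
  have h2 : lon y = Complex.arg (coordW y) := by
    unfold lon
    congr 1
    apply Complex.ext <;> simp [coordW]
  rw [h1, h2, mul_comm Complex.I, Complex.norm_mul_exp_arg_mul_I]

open Polynomial in
/-- A real polynomial in `z`. -/
def polyZ (p : ℝ[X]) : C(S2, ℂ) :=
  ⟨fun y => ((p.eval ((y : EuclideanSpace ℝ (Fin 3)) 2) : ℝ) : ℂ), by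
    have := p.continuous
    fun_prop⟩

/-- Since `sin^k e^{ikφ} = (x + iy)^k`, the harmonic is a polynomial in the coordinates, hence
continuous at the poles and across the cut of the longitude. -/
theorem onSphere_harm_of_nonneg (l k : ℕ) (y : S2) :
    onSphere (harm l k) y =
      ((harmConst l k : ℂ) • (polyZ (harmPoly l k) * coordW ^ k)) y := by
  unfold onSphere
  rw [harm_eq, cos_colat]
  simp only [ContinuousMap.smul_apply, ContinuousMap.mul_apply, ContinuousMap.pow_apply, coordW_eq,
    smul_eq_mul, mul_pow, ← Complex.exp_nat_mul, Int.natAbs_natCast, polyZ, ContinuousMap.coe_mk]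
  push_cast
  rw [show (k : ℂ) * (Complex.I * lon y) = Complex.I * k * lon y by ring]
  ring

theorem onSphere_harm_of_nonpos (l k : ℕ) (y : S2) :
    onSphere (harm l (-(k : ℤ))) y =
      ((harmConst l (-(k : ℤ)) : ℂ) •
        (polyZ (harmPoly l (-(k : ℤ))) * (star coordW) ^ k)) y := by
  unfold onSphere
  rw [harm_eq, cos_colat]
  simp only [ContinuousMap.smul_apply, ContinuousMap.mul_apply, ContinuousMap.pow_apply, coordW_eq,
    smul_eq_mul, mul_pow, Int.natAbs_natCast, Int.natAbs_neg, polyZ, ContinuousMap.coe_mk,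
    ContinuousMap.star_apply, Complex.star_def, map_mul, Complex.conj_ofReal, ← Complex.exp_conj,
    Complex.conj_I, ← Complex.exp_nat_mul]
  push_cast
  rw [show (k : ℂ) * (-Complex.I * lon y) = Complex.I * -k * lon y by ring]
  ring

/-- The span of the spherical harmonics among the continuous functions. -/
def harmSpan : Submodule ℂ C(S2, ℂ) :=
  Submodule.span ℂ {f | ∃ i : HarmIndex, ∀ y, f y = onSphere (harm i.1 i.2.1) y}

-- The `k`-th derivative of `P_{n+k}` has degree exactly `n`, so these polynomials are a triangular
-- basis: the leading coefficient is removed with the one of degree `n`, and the degree drops.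
open Polynomial in
theorem polyZ_mul_mem_of_forall (V : Submodule ℂ C(S2, ℂ)) (g : C(S2, ℂ)) (k : ℕ)
    (h : ∀ n, polyZ (derivative^[k] (legendre (n + k))) * g ∈ V) (p : ℝ[X]) :
    polyZ p * g ∈ V := by
  suffices H : ∀ n : ℕ, ∀ p : ℝ[X], p.degree < n → polyZ p * g ∈ V from
    H (p.natDegree + 1) p (by
      refine p.degree_le_natDegree.trans_lt ?_
      exact_mod_cast Nat.lt_succ_self _)
  intro n
  induction n with
  | zero =>
    intro p hp
    have : p = 0 := by
      rw [← degree_eq_bot]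
      exact Nat.WithBot.lt_zero_iff.1 hp
    subst this
    convert V.zero_mem
    ext y
    simp [polyZ]
  | succ n ih =>
    intro p hp
    set q := derivative^[k] (legendre (n + k)) with hq
    have hq0 : q.coeff n ≠ 0 := coeff_iterate_derivative_legendre_ne_zero n k
    set c := p.coeff n / q.coeff n with hc
    have h1 : (p - C c * q).degree < n := by
      rw [degree_lt_iff_coeff_zero]
      intro j hj
      rw [coeff_sub, coeff_C_mul]
      rcases hj.eq_or_lt with rfl | hj
      · rw [hc, div_mul_cancel₀ _ hq0, sub_self]
      · have h2 : p.coeff j = 0 := coeff_eq_zero_of_degree_lt (hp.trans_le (by exact_mod_cast hj))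
        have h3 : q.coeff j = 0 := by
          refine coeff_eq_zero_of_natDegree_lt ?_
          have := natDegree_iterate_derivative_legendre_le (n + k) k
          rw [← hq] at this
          omega
        rw [h2, h3, mul_zero, sub_zero]
    have h2 : polyZ p * g = polyZ (p - C c * q) * g + (c : ℂ) • (polyZ q * g) := by
      ext y
      simp [polyZ]
      ring
    rw [h2]
    exact V.add_mem (ih _ h1) (V.smul_mem _ (h n))

theorem polyZ_mul_coordW_pow_mem (p : Polynomial ℝ) (k : ℕ) :
    polyZ p * coordW ^ k ∈ harmSpan := by
  refine polyZ_mul_mem_of_forall _ _ k (fun n => ?_) p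
  have hc : ((harmConst (n + k) k : ℝ) : ℂ) ≠ 0 := by exact_mod_cast harmConst_ne_zero _ _
  rw [← inv_smul_smul₀ hc (polyZ _ * coordW ^ k)]
  refine Submodule.smul_mem _ _ (Submodule.subset_span
    ⟨⟨n + k, (k : ℤ), Finset.mem_Icc.2 ⟨by omega, by omega⟩⟩, fun y => ?_⟩)
  exact (onSphere_harm_of_nonneg (n + k) k y).symm

theorem polyZ_mul_star_coordW_pow_mem (p : Polynomial ℝ) (k : ℕ) :
    polyZ p * (star coordW) ^ k ∈ harmSpan := by
  refine polyZ_mul_mem_of_forall _ _ k (fun n => ?_) p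
  have hc : ((harmConst (n + k) (-(k : ℤ)) : ℝ) : ℂ) ≠ 0 := by
    exact_mod_cast harmConst_ne_zero _ _
  rw [← inv_smul_smul₀ hc (polyZ _ * (star coordW) ^ k)]
  refine Submodule.smul_mem _ _ (Submodule.subset_span
    ⟨⟨n + k, -(k : ℤ), Finset.mem_Icc.2 ⟨by omega, by omega⟩⟩, fun y => ?_⟩)
  have h := onSphere_harm_of_nonpos (n + k) k y
  rw [h]
  simp only [harmPoly, Int.natAbs_neg, Int.natAbs_natCast]

/-- The products `z^a (x + iy)^b` and `z^a (x - iy)^b`. -/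
def sphereMonomials : Set C(S2, ℂ) :=
  {f | ∃ a b : ℕ, f = coordZ ^ a * coordW ^ b ∨ f = coordZ ^ a * (star coordW) ^ b}

theorem span_sphereMonomials_le : Submodule.span ℂ sphereMonomials ≤ harmSpan := by
  rw [Submodule.span_le]
  rintro f ⟨a, b, rfl | rfl⟩
  · have : coordZ ^ a = polyZ (Polynomial.X ^ a) := by ext y; simp [coordZ, polyZ]
    rw [this]
    exact polyZ_mul_coordW_pow_mem _ _
  · have : coordZ ^ a = polyZ (Polynomial.X ^ a) := by ext y; simp [coordZ, polyZ]
    rw [this]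
    exact polyZ_mul_star_coordW_pow_mem _ _

/-- The relation `w w̄ = 1 - z²` for `w = x + iy` eliminates mixed products, so monomials containing
only one of `w` and `w̄` span an algebra. -/
theorem mul_mem_span_sphereMonomials {g f : C(S2, ℂ)}
    (hg : g ∈ ({coordZ, coordW, star coordW} : Set C(S2, ℂ)))
    (hf : f ∈ Submodule.span ℂ sphereMonomials) : g * f ∈ Submodule.span ℂ sphereMonomials := by
  have hww := coordW_mul_star
  induction hf using Submodule.span_induction with
  | zero => rw [mul_zero]; exact Submodule.zero_mem _
  | add f₁ f₂ _ _ h₁ h₂ => rw [mul_add]; exact Submodule.add_mem _ h₁ h₂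
  | smul c f _ h => rw [mul_smul_comm]; exact Submodule.smul_mem _ c h
  | mem f hf =>
    have hsub : ∀ a b : ℕ, coordZ ^ a * coordW ^ b ∈ Submodule.span ℂ sphereMonomials :=
      fun a b => Submodule.subset_span ⟨a, b, Or.inl rfl⟩
    have hsub' : ∀ a b : ℕ, coordZ ^ a * (star coordW) ^ b ∈ Submodule.span ℂ sphereMonomials :=
      fun a b => Submodule.subset_span ⟨a, b, Or.inr rfl⟩
    rcases hg with rfl | rfl | rfl
    · rcases hf with ⟨a, b, rfl | rfl⟩
      · convert hsub (a + 1) b using 1; ring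
      · convert hsub' (a + 1) b using 1; ring
    · rcases hf with ⟨a, b, rfl | rfl⟩
      · convert hsub a (b + 1) using 1; ring
      · rcases b with _ | b
        · convert hsub a 1 using 1; ring
        · convert Submodule.sub_mem _ (hsub' a b) (hsub' (a + 2) b) using 1
          linear_combination (coordZ ^ a * (star coordW) ^ b) * hww
    · rcases hf with ⟨a, b, rfl | rfl⟩
      · rcases b with _ | b
        · convert hsub' a 1 using 1; ring
        · convert Submodule.sub_mem _ (hsub a b) (hsub (a + 2) b) using 1
          linear_combination (coordZ ^ a * coordW ^ b) * hww
      · convert hsub' a (b + 1) using 1; ring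

theorem starAlgebra_adjoin_coords_le :
    Subalgebra.toSubmodule (StarAlgebra.adjoin ℂ ({coordZ, coordW} : Set C(S2, ℂ))).toSubalgebra ≤
      harmSpan := by
  refine le_trans ?_ span_sphereMonomials_le
  have hs : ({coordZ, coordW} : Set C(S2, ℂ)) ∪ star {coordZ, coordW} ⊆
      {coordZ, coordW, star coordW} := by
    rintro f (hf | hf)
    · rcases hf with rfl | rfl <;> simp
    · rw [Set.mem_star] at hf
      rcases hf with hf | hf
      · rw [← star_star f, hf, star_coordZ]; simp
      · rw [Set.mem_singleton_iff] at hf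
        rw [← star_star f, hf]; simp
  rw [StarAlgebra.adjoin_toSubalgebra, Algebra.adjoin_eq_span, Submodule.span_le]
  intro f hf
  induction hf using Submonoid.closure_induction_left with
  | one => exact Submodule.subset_span ⟨0, 0, Or.inl (by simp)⟩
  | mul_left g hg f _ h => exact mul_mem_span_sphereMonomials (hs hg) h

theorem separatesPoints_coords :
    (StarAlgebra.adjoin ℂ ({coordZ, coordW} : Set C(S2, ℂ))).toSubalgebra.SeparatesPoints := by
  intro x y hxy
  by_contra hcon
  push Not at hcon
  have hZ := hcon coordZ ⟨coordZ, StarAlgebra.subset_adjoin ℂ _ (by simp), rfl⟩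
  have hW := hcon coordW ⟨coordW, StarAlgebra.subset_adjoin ℂ _ (by simp), rfl⟩
  have h2 : (x : EuclideanSpace ℝ (Fin 3)) 2 = (y : EuclideanSpace ℝ (Fin 3)) 2 :=
    Complex.ofReal_injective hZ
  have h0 := congrArg Complex.re hW
  have h1 := congrArg Complex.im hW
  simp only [coordW, ContinuousMap.coe_mk, Complex.add_re, Complex.ofReal_re, Complex.mul_re,
    Complex.I_re, Complex.ofReal_im, Complex.I_im, Complex.add_im, Complex.mul_im, mul_zero,
    mul_one, sub_zero, add_zero, zero_add] at h0 h1
  apply hxy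
  apply Subtype.ext
  ext i
  fin_cases i
  exacts [h0, h1, h2]

/-- Stone-Weierstrass: the star algebra generated by `z` and `x + iy` separates points and consists
of combinations of harmonics. -/
theorem dense_harmSpan : Dense (harmSpan : Set C(S2, ℂ)) := by
  have h := ContinuousMap.starSubalgebra_topologicalClosure_eq_top_of_separatesPoints
    _ separatesPoints_coords
  have h1 : Dense ((StarAlgebra.adjoin ℂ ({coordZ, coordW} : Set C(S2, ℂ)) :
      StarSubalgebra ℂ C(S2, ℂ)) : Set C(S2, ℂ)) := by
    rw [dense_iff_closure_eq, ← StarSubalgebra.topologicalClosure_coe, h]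
    rfl
  exact h1.mono starAlgebra_adjoin_coords_le

/-- The spherical harmonics are total in `L²(𝕊²)`. -/
theorem span_Y_topologicalClosure :
    ⊤ ≤ (Submodule.span ℂ (Set.range fun i : HarmIndex => Y i.1 i.2.1)).topologicalClosure := by
  -- Uniform density in the continuous functions passes to `L²`, because these are dense there and
  -- the inclusion is continuous.
  have hd : Dense ((ContinuousMap.toLp (E := ℂ) 2 surf ℂ) '' (harmSpan : Set C(S2, ℂ))) :=
    (ContinuousMap.toLp_denseRange ℂ surf ℂ (by simp)).dense_image
      (ContinuousLinearMap.continuous _) dense_harmSpan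
  have hsub : (ContinuousMap.toLp (E := ℂ) 2 surf ℂ) '' (harmSpan : Set C(S2, ℂ)) ⊆
      Submodule.span ℂ (Set.range fun i : HarmIndex => Y i.1 i.2.1) := by
    rintro _ ⟨f, hf, rfl⟩
    induction hf using Submodule.span_induction with
    | zero => rw [map_zero]; exact Submodule.zero_mem _
    | add f₁ f₂ _ _ h₁ h₂ => rw [map_add]; exact Submodule.add_mem _ h₁ h₂
    | smul c f _ h => rw [map_smul]; exact Submodule.smul_mem _ c h
    | mem f hf =>
      obtain ⟨i, hi⟩ := hf
      refine Submodule.subset_span ⟨i, ?_⟩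
      apply Lp.ext
      filter_upwards [(memLp_harm i.1 i.2.1).coeFn_toLp,
        ContinuousMap.coeFn_toLp (E := ℂ) (p := 2) surf (𝕜 := ℂ) f] with y h1 h2
      rw [h2, hi y]
      exact h1
  intro f _
  exact (hd.mono hsub) f

/-! ### Parseval's identity, components of fixed degree and truncation. -/

/-- The spherical harmonics as a Hilbert basis of `L²(𝕊²)`. -/
def harmBasis : HilbertBasis HarmIndex ℂ L2S :=
  HilbertBasis.mk orthonormal_Y span_Y_topologicalClosure

theorem harmBasis_apply (i : HarmIndex) : harmBasis i = Y i.1 i.2.1 := by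
  unfold harmBasis
  rw [HilbertBasis.coe_mk]

/-- The squared norm `∑_{m=-ℓ}^{ℓ} |(f, Y_{ℓm})|²` of the component of degree `ℓ` of `f`. -/
def degreeSq (l : ℕ) (f : L2S) : ℝ := ∑ m ∈ Finset.Icc (-(l : ℤ)) l, ‖pair f (harm l m)‖ ^ 2

theorem degreeSq_nonneg (l : ℕ) (f : L2S) : 0 ≤ degreeSq l f :=
  Finset.sum_nonneg fun _ _ => by positivity

/-- Parseval's identity. -/
theorem hasSum_degreeSq (f : L2S) : HasSum (fun l => degreeSq l f) (‖f‖ ^ 2) := by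
  have h1 := harmBasis.hasSum_inner_mul_inner f f
  have h2 := Complex.hasSum_re h1
  have h3 : ∀ i : HarmIndex, (inner ℂ f (harmBasis i) * inner ℂ (harmBasis i) f).re =
      ‖pair f (harm i.1 i.2.1)‖ ^ 2 := by
    intro i
    rw [harmBasis_apply, pair_harm]
    refine (inner_mul_symm_re_eq_norm (𝕜 := ℂ) f (Y i.1 i.2.1)).trans ?_
    rw [norm_mul, norm_inner_symm, pow_two]
  have h4 : (inner ℂ f f).re = ‖f‖ ^ 2 := inner_self_eq_norm_sq (𝕜 := ℂ) f
  simp only [h3, h4] at h2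
  convert h2.sigma (fun l => hasSum_fintype _) with l
  exact (Finset.sum_coe_sort (Finset.Icc (-(l : ℤ)) l) fun m => ‖pair f (harm l m)‖ ^ 2).symm

theorem degreePart_eq (l : ℕ) (f : L2S) :
    degreePart l f = ∑ m ∈ Finset.Icc (-(l : ℤ)) l, inner ℂ (Y l m) f • Y l m := by
  simp only [degreePart, pair_harm]

theorem inner_Y_sum_smul (l l' : ℕ) (c : ℤ → ℂ) {m : ℤ} (hm : m ∈ Finset.Icc (-(l : ℤ)) l) :
    inner ℂ (Y l m) (∑ m' ∈ Finset.Icc (-(l' : ℤ)) l', c m' • Y l' m') =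
      if l = l' then c m else 0 := by
  rw [inner_sum]
  have h1 : ∀ m' ∈ Finset.Icc (-(l' : ℤ)) l', inner ℂ (Y l m) (c m' • Y l' m') =
      if l = l' ∧ m = m' then c m' else 0 := by
    intro m' hm'
    rw [inner_smul_right, inner_Y l l' m m' (natAbs_le_of_mem_Icc hm')]
    simp
  rw [Finset.sum_congr rfl h1]
  split_ifs with h
  · subst h
    simp only [true_and]
    rw [Finset.sum_ite_eq, if_pos hm]
  · simp [h]

theorem pair_degreePart (l l' : ℕ) (f : L2S) {m : ℤ} (hm : m ∈ Finset.Icc (-(l : ℤ)) l) :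
    pair (degreePart l' f) (harm l m) = if l = l' then pair f (harm l m) else 0 := by
  rw [pair_harm, degreePart_eq, inner_Y_sum_smul l l' _ hm, pair_harm]
  split_ifs with h
  · rw [h]
  · rfl

theorem pair_truncate (l κ : ℕ) (f : L2S) {m : ℤ} (hm : m ∈ Finset.Icc (-(l : ℤ)) l) :
    pair (truncate κ f) (harm l m) = if l < κ + 1 then pair f (harm l m) else 0 := by
  have h : pair (truncate κ f) (harm l m) =
      ∑ l' ∈ Finset.range (κ + 1), pair (degreePart l' f) (harm l m) := by
    simp only [truncate, pair_harm, inner_sum]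
  rw [h, Finset.sum_congr rfl fun l' _ => pair_degreePart l l' f hm, Finset.sum_ite_eq]
  simp only [Finset.mem_range]

theorem pair_sub_truncate (l κ : ℕ) (f : L2S) {m : ℤ} (hm : m ∈ Finset.Icc (-(l : ℤ)) l) :
    pair (f - truncate κ f) (harm l m) = if l < κ + 1 then 0 else pair f (harm l m) := by
  rw [pair_harm, inner_sub_right, ← pair_harm, ← pair_harm, pair_truncate l κ f hm]
  split_ifs <;> simp

/-- Parseval for the remainder, whose coefficients vanish up to degree `κ` inclusive (hence the
shift `κ + 1`) and agree with those of `f` afterwards. -/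
theorem hasSum_norm_sub_truncate_sq (κ : ℕ) (f : L2S) :
    HasSum (fun i => degreeSq (i + (κ + 1)) f) (‖f - truncate κ f‖ ^ 2) := by
  have h := (hasSum_nat_add_iff' (κ + 1)).2 (hasSum_degreeSq (f - truncate κ f))
  have h0 : ∑ i ∈ Finset.range (κ + 1), degreeSq i (f - truncate κ f) = 0 := by
    refine Finset.sum_eq_zero fun i hi => Finset.sum_eq_zero fun m hm => ?_
    rw [pair_sub_truncate i κ f hm, if_pos (Finset.mem_range.1 hi)]
    simp
  rw [h0, sub_zero] at h
  have he : ∀ i, degreeSq (i + (κ + 1)) f = degreeSq (i + (κ + 1)) (f - truncate κ f) :=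
    fun i => Finset.sum_congr rfl fun m hm => by
      rw [pair_sub_truncate _ κ f hm, if_neg (by omega)]
  simpa only [he] using h

theorem norm_sub_truncate_sq (κ : ℕ) (f : L2S) :
    ‖f - truncate κ f‖ ^ 2 = ∑' i, degreeSq (i + (κ + 1)) f :=
  (hasSum_norm_sub_truncate_sq κ f).tsum_eq.symm

theorem degreeSq_of_degreePart_eq {l : ℕ} {v : L2S} (hv : degreePart l v = v) :
    degreeSq l v = ‖v‖ ^ 2 := by
  refine ((hasSum_degreeSq v).unique (hasSum_single l fun l' hl' => ?_)).symm
  refine Finset.sum_eq_zero fun m hm => ?_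
  rw [← hv, pair_degreePart l' l v hm, if_neg hl']
  simp

theorem inner_eq_zero_of_degreePart_eq {l l' : ℕ} (h : l ≠ l') {v w : L2S}
    (hv : degreePart l v = v) (hw : degreePart l' w = w) : inner ℂ v w = 0 := by
  rw [← hv, degreePart_eq, sum_inner]
  refine Finset.sum_eq_zero fun m hm => ?_
  rw [inner_smul_left, ← pair_harm w, ← hw, pair_degreePart l l' w hm, if_neg h, mul_zero]

/-- An orthogonal series converges as soon as its squared norms are summable. The condition
`degreePart l v = v` serves throughout as membership in the space of degree `l`. -/
theorem summable_of_degreePart_eq {v : ℕ → L2S} (hv : ∀ l, degreePart l (v l) = v l)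
    (hs : Summable fun l => ‖v l‖ ^ 2) : Summable v := by
  have hO : OrthogonalFamily ℂ (fun l => Submodule.span ℂ {v l})
      fun l => (Submodule.span ℂ {v l}).subtypeₗᵢ := by
    refine OrthogonalFamily.of_pairwise fun l l' hl => ?_
    refine Submodule.isOrtho_span.2 ?_
    rintro x rfl y rfl
    exact inner_eq_zero_of_degreePart_eq hl (hv l) (hv l')
  exact (hO.summable_iff_norm_sq_summable
    (fun l => ⟨v l, Submodule.mem_span_singleton_self _⟩)).2 hs

theorem pair_tsum {v : ℕ → L2S} (hv : ∀ l, degreePart l (v l) = v l) (hs : Summable v)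
    (l : ℕ) {m : ℤ} (hm : m ∈ Finset.Icc (-(l : ℤ)) l) :
    pair (∑' l, v l) (harm l m) = pair (v l) (harm l m) := by
  rw [pair_harm]
  have h := (innerSL ℂ (Y l m)).map_tsum hs
  simp only [innerSL_apply_apply] at h
  rw [h, tsum_eq_single l, ← pair_harm]
  intro l' hl'
  rw [← pair_harm, ← hv l', pair_degreePart l l' _ hm, if_neg hl'.symm]

theorem degreeSq_tsum {v : ℕ → L2S} (hv : ∀ l, degreePart l (v l) = v l) (hs : Summable v)
    (l : ℕ) : degreeSq l (∑' l, v l) = ‖v l‖ ^ 2 := by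
  rw [← degreeSq_of_degreePart_eq (hv l)]
  exact Finset.sum_congr rfl fun m hm => by rw [pair_tsum hv hs l hm]

theorem truncate_tsum {v : ℕ → L2S} (hv : ∀ l, degreePart l (v l) = v l) (hs : Summable v)
    (κ : ℕ) : truncate κ (∑' l, v l) = ∑ l ∈ Finset.range (κ + 1), v l := by
  refine Finset.sum_congr rfl fun l _ => ?_
  conv_rhs => rw [← hv l]
  exact Finset.sum_congr rfl fun m hm => by rw [pair_tsum hv hs l hm]

theorem degreePart_add (l : ℕ) (f g : L2S) :
    degreePart l (f + g) = degreePart l f + degreePart l g := by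
  simp only [degreePart_eq, inner_add_right, add_smul, Finset.sum_add_distrib]

theorem degreePart_real_smul (l : ℕ) (r : ℝ) (f : L2S) :
    degreePart l (r • f) = r • degreePart l f := by
  have h : ∀ g : L2S, r • g = (r : ℂ) • g := fun g => (Complex.coe_smul r g).symm
  rw [h, h]
  simp only [degreePart_eq, inner_smul_right, Finset.smul_sum, smul_smul]

theorem degreePart_sum_smul (l : ℕ) (c : ℤ → ℂ) :
    degreePart l (∑ m ∈ Finset.Icc (-(l : ℤ)) l, c m • Y l m) =
      ∑ m ∈ Finset.Icc (-(l : ℤ)) l, c m • Y l m := by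
  rw [degreePart_eq]
  exact Finset.sum_congr rfl fun m hm => by rw [inner_Y_sum_smul l l c hm, if_pos rfl]

theorem degreePart_degreePart (l : ℕ) (f : L2S) :
    degreePart l (degreePart l f) = degreePart l f :=
  degreePart_sum_smul l _

theorem norm_sum_smul_sq (l : ℕ) (c : ℤ → ℂ) :
    ‖∑ m ∈ Finset.Icc (-(l : ℤ)) l, c m • Y l m‖ ^ 2 =
      ∑ m ∈ Finset.Icc (-(l : ℤ)) l, ‖c m‖ ^ 2 := by
  rw [← degreeSq_of_degreePart_eq (degreePart_sum_smul l c)]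
  exact Finset.sum_congr rfl fun m hm => by
    rw [pair_harm, inner_Y_sum_smul l l c hm, if_pos rfl]

theorem norm_degreePart_sq (l : ℕ) (f : L2S) : ‖degreePart l f‖ ^ 2 = degreeSq l f :=
  norm_sum_smul_sq l _

theorem degreePart_gridPart (A : ℕ → ℝ) (τ : ℕ → ℝ) (ξ : ℕ → ℕ → ℕ → Fin 2 → ℝ) (x₀ : L2S)
    (l k : ℕ) : degreePart l (gridPart A τ ξ x₀ l k) = gridPart A τ ξ x₀ l k := by
  induction k with
  | zero => exact degreePart_degreePart l x₀
  | succ k ih =>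
    rw [gridPart, degreePart_add, degreePart_real_smul, degreePart_real_smul, ih,
      degreePart_sum_smul]

/-! ### From weighted summability to rates. -/

/-- Tails of a series that converges with the weight `ℓ^{2b}` decay like `κ^{-2b}`. -/
theorem exists_forall_tsum_tail_le {d : ℕ → ℝ} (hd : ∀ l, 0 ≤ d l) {b : ℝ} (hb : 0 ≤ b)
    (hs : Summable fun l : ℕ => (l : ℝ) ^ (2 * b) * d l) :
    ∃ K : ℕ, ∀ κ ≥ K, Summable (fun i => d (i + (κ + 1))) ∧
      ∑' i, d (i + (κ + 1)) ≤ ((κ : ℝ) ^ (-b)) ^ 2 := by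
  have ht := (tendsto_sum_nat_add fun l : ℕ => (l : ℝ) ^ (2 * b) * d l).comp
    (tendsto_add_atTop_nat 1)
  -- Waiting until the weighted tail is below `1` gives the rate with no constant in front.
  obtain ⟨K, hK⟩ := eventually_atTop.1 (ht.eventually (gt_mem_nhds zero_lt_one))
  refine ⟨max K 1, fun κ hκ => ?_⟩
  have hκ1 : 1 ≤ κ := (le_max_right _ _).trans hκ
  have hκ0 : (0 : ℝ) < κ := by exact_mod_cast hκ1
  have h1 := hK κ ((le_max_left _ _).trans hκ)
  simp only [Function.comp] at h1
  have hs' := (summable_nat_add_iff (κ + 1)).2 hs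
  have hp : (0 : ℝ) < (κ : ℝ) ^ (2 * b) := Real.rpow_pos_of_pos hκ0 _
  have hle : ∀ i : ℕ, (κ : ℝ) ^ (2 * b) * d (i + (κ + 1)) ≤
      ((i + (κ + 1) : ℕ) : ℝ) ^ (2 * b) * d (i + (κ + 1)) := by
    intro i
    refine mul_le_mul_of_nonneg_right ?_ (hd _)
    refine Real.rpow_le_rpow hκ0.le ?_ (by positivity)
    push_cast
    linarith [(Nat.cast_nonneg i : (0 : ℝ) ≤ i)]
  have hs2 : Summable fun i => (κ : ℝ) ^ (2 * b) * d (i + (κ + 1)) :=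
    hs'.of_nonneg_of_le (fun i => mul_nonneg hp.le (hd _)) hle
  have hs3 : Summable fun i => d (i + (κ + 1)) := (summable_mul_left_iff hp.ne').1 hs2
  refine ⟨hs3, ?_⟩
  have h2 : (κ : ℝ) ^ (2 * b) * ∑' i, d (i + (κ + 1)) ≤ 1 := by
    rw [← tsum_mul_left]
    exact (hs2.tsum_le_tsum hle hs').trans h1.le
  have h3 : ((κ : ℝ) ^ (-b)) ^ 2 = ((κ : ℝ) ^ (2 * b))⁻¹ := by
    rw [← Real.rpow_natCast, ← Real.rpow_mul hκ0.le, ← Real.rpow_neg hκ0.le]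
    congr 1
    push_cast
    ring
  rw [h3, ← one_div, le_div_iff₀ hp, mul_comm]
  exact h2

/-- A uniform bound on the components of a family of functions gives a uniform rate for the
truncations. -/
theorem exists_forall_norm_sub_truncate_le {ι : Type*} (s : Set ι) (g : ι → L2S) {d : ℕ → ℝ}
    (hd : ∀ l, 0 ≤ d l) {b : ℝ} (hb : 0 ≤ b)
    (hs : Summable fun l : ℕ => (l : ℝ) ^ (2 * b) * d l) {L : ℕ}
    (hg : ∀ l ≥ L, ∀ i ∈ s, degreeSq l (g i) ≤ d l) :
    ∃ K : ℕ, ∀ κ ≥ K, ∀ i ∈ s, ‖g i - truncate κ (g i)‖ ≤ (κ : ℝ) ^ (-b) := by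
  obtain ⟨K, hK⟩ := exists_forall_tsum_tail_le hd hb hs
  refine ⟨max K L, fun κ hκ i hi => ?_⟩
  obtain ⟨hs1, h1⟩ := hK κ ((le_max_left _ _).trans hκ)
  have hL : L ≤ κ := (le_max_right _ _).trans hκ
  refine abs_le_of_sq_le_sq' ?_ (by positivity) |>.2
  rw [norm_sub_truncate_sq]
  exact ((hasSum_norm_sub_truncate_sq κ (g i)).summable.tsum_le_tsum
    (fun j => hg _ (by omega) i hi) hs1).trans h1

/-- It suffices to prove a rate for nonnegative exponents. -/
theorem exists_rate_of_nonneg {ι : Type*} (s : Set ι) (N : ℕ → ι → ℝ) {a : ℝ} (ha : 0 < a)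
    (h : ∀ b < a, 0 ≤ b → ∃ K : ℕ, ∀ κ ≥ K, ∀ i ∈ s, N κ i ≤ (κ : ℝ) ^ (-b)) {b : ℝ}
    (hb : b < a) : ∃ K : ℕ, ∀ κ ≥ K, ∀ i ∈ s, N κ i ≤ (κ : ℝ) ^ (-b) := by
  obtain ⟨K, hK⟩ := h (max b 0) (max_lt hb ha) (le_max_right _ _)
  refine ⟨max K 1, fun κ hκ i hi => (hK κ ((le_max_left _ _).trans hκ) i hi).trans ?_⟩
  have hκ1 : (1 : ℝ) ≤ κ := by exact_mod_cast (le_max_right _ _).trans hκ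
  exact Real.rpow_le_rpow_of_exponent_le hκ1 (neg_le_neg (le_max_left _ _))

/-! ### Almost sure bounds for countable families of normal variables. -/

variable {Ω : Type*} [MeasurableSpace Ω] {P : Measure Ω}

/-- One term of the exponential series is at most the whole. It turns exponential decay into decay
of any polynomial order, both for Gaussian tails and for the heat semigroup. -/
theorem exp_neg_le_factorial_div_pow (q : ℕ) {y : ℝ} (hy : 0 < y) :
    Real.exp (-y) ≤ (q.factorial : ℝ) / y ^ q := by
  have h := Real.pow_div_factorial_le_exp y hy.le q
  rw [Real.exp_neg, ← inv_div]
  exact inv_anti₀ (by positivity) h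

/-- Polynomial tail bounds of every order for a centred normal variable. -/
theorem measure_lt_abs_le_of_hasLaw_gaussianReal [IsProbabilityMeasure P] {Z : Ω → ℝ} {v : ℝ≥0}
    (hv : 0 < v) (hZ : HasLaw Z (gaussianReal 0 v) P) {x : ℝ} (hx : 0 < x) (q : ℕ) :
    P {ω | x < |Z ω|} ≤ ENNReal.ofReal (2 * (q.factorial * 2 ^ q) * ((v : ℝ) / x ^ 2) ^ q) := by
  have hsub : HasSubgaussianMGF Z v P := by
    have hae : AEMeasurable Z P := hZ.aemeasurable
    refine ⟨fun t => ?_, fun t => ?_⟩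
    · have h := integrable_exp_mul_gaussianReal (μ := 0) (v := v) t
      rw [← hZ.map_eq] at h
      exact h.comp_aemeasurable hae
    · rw [mgf_gaussianReal hZ.map_eq]
      simp
  have hv' : (0 : ℝ) < v := hv
  have hb : Real.exp (-x ^ 2 / (2 * v)) ≤
      q.factorial * 2 ^ q * ((v : ℝ) / x ^ 2) ^ q := by
    have h := exp_neg_le_factorial_div_pow q (y := x ^ 2 / (2 * v)) (by positivity)
    rw [← neg_div] at h
    refine h.trans (le_of_eq ?_)
    rw [div_pow, div_pow, mul_pow]
    field_simp
  have h1 := (hsub.measure_ge_le hx.le).trans hb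
  have h2 := (hsub.neg.measure_ge_le hx.le).trans hb
  have hle : {ω | x < |Z ω|} ⊆ {ω | x ≤ Z ω} ∪ {ω | x ≤ (-Z) ω} := by
    intro ω hω
    have hω' : x < |Z ω| := hω
    rcases lt_abs.1 hω' with h | h
    · exact Or.inl h.le
    · exact Or.inr h.le
  refine (measure_mono hle).trans ((measure_union_le _ _).trans ?_)
  rw [← ofReal_measureReal (μ := P) (s := {ω | x ≤ Z ω}),
    ← ofReal_measureReal (μ := P) (s := {ω | x ≤ (-Z) ω}),
    ← ENNReal.ofReal_add (by positivity) (by positivity)]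
  refine ENNReal.ofReal_le_ofReal ?_
  linarith

/-- A family of centred normal variables is almost surely bounded by any thresholds against which
the standard deviations are summable to some power. -/
theorem ae_exists_abs_le_of_summable [IsProbabilityMeasure P] {ι : Type*} [Countable ι]
    (Z : ι → Ω → ℝ)
    (v : ι → ℝ≥0) (hv : ∀ i, 0 < v i) (hZ : ∀ i, HasLaw (Z i) (gaussianReal 0 (v i)) P)
    (s : ι → ℝ) (hs : ∀ i, 0 < s i) (q : ℕ)
    (hsum : Summable fun i => ((v i : ℝ) / s i ^ 2) ^ q) :
    ∀ᵐ ω ∂P, ∃ C : ℝ, 0 ≤ C ∧ ∀ i, |Z i ω| ≤ C * s i := by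
  have h1 : ∑' i, P {ω | s i < |Z i ω|} ≠ ∞ := by
    refine ne_top_of_le_ne_top ?_ (ENNReal.tsum_le_tsum fun i =>
      measure_lt_abs_le_of_hasLaw_gaussianReal (hv i) (hZ i) (hs i) q)
    exact (hsum.mul_left _).tsum_ofReal_ne_top
  -- Borel-Cantelli: only finitely many thresholds are exceeded, and the largest ratio among these
  -- exceptions goes into the constant.
  filter_upwards [ae_finite_setOfPred_mem h1] with ω hω
  obtain ⟨B, hB⟩ := (hω.image fun i => |Z i ω| / s i).bddAbove
  refine ⟨max 1 B, zero_le_one.trans (le_max_left _ _), fun i => ?_⟩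
  by_cases hi : s i < |Z i ω|
  · have h2 : |Z i ω| / s i ≤ B := hB ⟨i, hi, rfl⟩
    rw [← div_le_iff₀ (hs i)]
    exact h2.trans (le_max_right _ _)
  · have h3 : s i ≤ max 1 B * s i := le_mul_of_one_le_left (hs i).le (le_max_left _ _)
    exact (not_lt.1 hi).trans h3

/-- The weight of a multi-index. -/
def idxWeight (p : ℕ × ℕ × ℕ × ℕ × Fin 2) : ℝ :=
  ((p.1 : ℝ) + 1) * ((p.2.1 + 1) * ((p.2.2.1 + 1) * (p.2.2.2.1 + 1)))

theorem one_le_idxWeight (p : ℕ × ℕ × ℕ × ℕ × Fin 2) : 1 ≤ idxWeight p := by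
  unfold idxWeight
  have h : ∀ n : ℕ, (1 : ℝ) ≤ (n : ℝ) + 1 := fun n => by linarith [(Nat.cast_nonneg n : (0 : ℝ) ≤ n)]
  exact one_le_mul_of_one_le_of_one_le (h _) (one_le_mul_of_one_le_of_one_le (h _)
    (one_le_mul_of_one_le_of_one_le (h _) (h _)))

/-- Each of the four unbounded indices carries a summable inverse square; the index in `Fin 2` only
doubles the sum. -/
theorem summable_inv_idxWeight_sq : Summable fun p => ((idxWeight p) ^ 2)⁻¹ := by
  have h1 : Summable fun n : ℕ => (((n : ℝ) + 1) ^ 2)⁻¹ := by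
    have := (summable_nat_add_iff 1).2 (Real.summable_nat_pow_inv.2 one_lt_two)
    simpa using this
  have hnn : ∀ n : ℕ, 0 ≤ (((n : ℝ) + 1) ^ 2)⁻¹ := fun n => by positivity
  have h2 : Summable fun p : ℕ × Fin 2 => (((p.1 : ℝ) + 1) ^ 2)⁻¹ := by
    have := h1.mul_of_nonneg (g := fun _ : Fin 2 => (1 : ℝ)) (hasSum_fintype _).summable hnn
      (fun _ => zero_le_one)
    simpa using this
  have h3 := h1.mul_of_nonneg h2 hnn (fun p => hnn p.1)
  have h4 := h1.mul_of_nonneg h3 hnn (fun p => mul_nonneg (hnn _) (hnn _))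
  have h5 := h1.mul_of_nonneg h4 hnn
    (fun p => mul_nonneg (hnn _) (mul_nonneg (hnn _) (hnn _)))
  refine h5.congr fun p => ?_
  unfold idxWeight
  simp only [mul_pow, mul_inv]

/-- A countable family of centred normal variables is almost surely bounded by its standard
deviations times any small power of the index. -/
theorem ae_exists_abs_le_idxWeight [IsProbabilityMeasure P] (Z : ℕ × ℕ × ℕ × ℕ × Fin 2 → Ω → ℝ)
    (v : ℕ × ℕ × ℕ × ℕ × Fin 2 → ℝ≥0) (J : ℕ × ℕ × ℕ × ℕ × Fin 2 → Prop)
    (hv : ∀ i, J i → 0 < v i) (hZ : ∀ i, J i → HasLaw (Z i) (gaussianReal 0 (v i)) P) {δ : ℝ}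
    (hδ : 0 < δ) :
    ∀ᵐ ω ∂P, ∃ C : ℝ, 0 ≤ C ∧ ∀ i, J i → |Z i ω| ≤ C * (Real.sqrt (v i) * idxWeight i ^ δ) := by
  -- A tail bound of order `q ≥ 1/δ` makes the probabilities `O(W^(-2δq))`, hence `O(W^(-2))`, in
  -- the weight `W`.
  obtain ⟨q, hq⟩ := exists_nat_ge (1 / δ)
  have hW : ∀ i, 0 < idxWeight i := fun i => zero_lt_one.trans_le (one_le_idxWeight i)
  have h := ae_exists_abs_le_of_summable (P := P) (ι := {i // J i}) (fun i => Z i.1)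
    (fun i => v i.1) (fun i => hv i.1 i.2) (fun i => hZ i.1 i.2)
    (fun i => Real.sqrt (v i.1) * idxWeight i.1 ^ δ)
    (fun i => mul_pos (Real.sqrt_pos.2 (hv i.1 i.2)) (Real.rpow_pos_of_pos (hW _) _)) q ?_
  · filter_upwards [h] with ω hω
    obtain ⟨C, hC, hb⟩ := hω
    exact ⟨C, hC, fun i hi => hb ⟨i, hi⟩⟩
  · refine Summable.of_nonneg_of_le (fun i => by positivity) (fun i => ?_)
      (summable_inv_idxWeight_sq.comp_injective (Subtype.val_injective (p := J)))
    have hvi : (0 : ℝ) < v i.1 := hv i.1 i.2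
    rw [mul_pow, Real.sq_sqrt hvi.le, div_mul_eq_div_div, div_self hvi.ne', one_div, inv_pow]
    refine inv_anti₀ (by have := hW i.1; positivity) ?_
    rw [← pow_mul, ← Real.rpow_natCast _ (2 * q), ← Real.rpow_natCast _ 2,
      ← Real.rpow_mul (hW _).le]
    refine Real.rpow_le_rpow_of_exponent_le (one_le_idxWeight _) ?_
    have : 1 ≤ δ * q := by
      rw [div_le_iff₀ hδ] at hq
      linarith
    push_cast
    linarith

/-! ### Hölder continuity from dyadic increments. -/

/-- On refining the dyadic grid, the approximation of a point from below stays put or moves by one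
step of the finer grid. -/
theorem floor_two_mul_eq (x : ℝ) (hx : 0 ≤ x) :
    ⌊2 * x⌋₊ = 2 * ⌊x⌋₊ ∨ ⌊2 * x⌋₊ = 2 * ⌊x⌋₊ + 1 := by
  have h1 := Nat.floor_le hx
  have h2 := Nat.lt_floor_add_one x
  have h3 : 2 * ⌊x⌋₊ ≤ ⌊2 * x⌋₊ := Nat.le_floor (by push_cast; linarith)
  have h4 : ⌊2 * x⌋₊ < 2 * ⌊x⌋₊ + 2 := by
    rw [Nat.floor_lt (by positivity)]
    push_cast
    linarith
  omega

/-- Dyadic approximation of a continuous function with small dyadic increments. -/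
theorem abs_sub_dyadic_le {f : ℝ → ℝ} {T M r : ℝ} (hT : 0 < T) (hr0 : 0 < r) (hr1 : r < 1)
    (hM : 0 ≤ M) (hf : ContinuousOn f (Set.Icc 0 T))
    (hinc : ∀ n k : ℕ, k < 2 ^ n → |f ((k + 1 : ℝ) * T / 2 ^ n) - f (k * T / 2 ^ n)| ≤ M * r ^ n)
    {t : ℝ} (ht : t ∈ Set.Icc 0 T) (n : ℕ) :
    |f t - f (⌊t / T * 2 ^ n⌋₊ * T / 2 ^ n)| ≤ M * r ^ n / (1 - r) := by
  set u : ℕ → ℝ := fun n => ⌊t / T * 2 ^ n⌋₊ * T / 2 ^ n with hu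
  have hx0 : 0 ≤ t / T := div_nonneg ht.1 hT.le
  have hx1 : t / T ≤ 1 := (div_le_one hT).2 ht.2
  have hupper : ∀ n, u n ≤ t := by
    intro n
    simp only [hu]
    rw [div_le_iff₀ (by positivity)]
    have h1 := Nat.floor_le (show 0 ≤ t / T * 2 ^ n by positivity)
    calc (⌊t / T * 2 ^ n⌋₊ : ℝ) * T ≤ t / T * 2 ^ n * T := by gcongr
      _ = t * 2 ^ n := by field_simp
  have hlower : ∀ n, t - T * (1 / 2) ^ n ≤ u n := by
    intro n
    simp only [hu]
    rw [le_div_iff₀ (by positivity)]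
    have h1 := (Nat.lt_floor_add_one (t / T * 2 ^ n)).le
    have h2 : (t - T * (1 / 2) ^ n) * 2 ^ n = (t / T * 2 ^ n - 1) * T := by
      rw [one_div, inv_pow]
      field_simp
    rw [h2]
    gcongr
    linarith
  have hmem : ∀ n, u n ∈ Set.Icc 0 T := fun n => ⟨by simp only [hu]; positivity,
    (hupper n).trans ht.2⟩
  have hlim : Tendsto u atTop (𝓝 t) := by
    refine tendsto_of_tendsto_of_tendsto_of_le_of_le (h := fun _ => t) ?_ tendsto_const_nhds
      hlower hupper
    have := (tendsto_pow_atTop_nhds_zero_of_lt_one (r := (1 / 2 : ℝ)) (by norm_num)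
      (by norm_num)).const_mul T
    simpa using this.const_sub t
  have hlimf : Tendsto (fun n => f (u n)) atTop (𝓝 (f t)) := by
    have := hf t ht
    exact this.tendsto.comp (tendsto_nhdsWithin_iff.2 ⟨hlim, Eventually.of_forall hmem⟩)
  -- Consecutive approximations differ by at most one increment of level `n + 1`; summing the
  -- geometric series yields the factor `1 / (1 - r)`.
  have hstep : ∀ n, dist (f (u n)) (f (u (n + 1))) ≤ M * r ^ n := by
    intro n
    have h2 : t / T * 2 ^ (n + 1) = 2 * (t / T * 2 ^ n) := by rw [pow_succ]; ring
    have hk : ⌊2 * (t / T * 2 ^ n)⌋₊ ≤ 2 ^ (n + 1) := by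
      refine Nat.floor_le_of_le ?_
      push_cast
      rw [pow_succ]
      nlinarith [pow_pos (zero_lt_two (α := ℝ)) n]
    have hrr : M * r ^ (n + 1) ≤ M * r ^ n := by
      gcongr M * ?_
      exact pow_le_pow_of_le_one hr0.le hr1.le (Nat.le_succ n)
    simp only [hu]
    rw [h2]
    rcases floor_two_mul_eq (t / T * 2 ^ n) (by positivity) with h | h
    · rw [h]
      have : ((2 * ⌊t / T * 2 ^ n⌋₊ : ℕ) : ℝ) * T / 2 ^ (n + 1) =
          ⌊t / T * 2 ^ n⌋₊ * T / 2 ^ n := by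
        push_cast
        rw [pow_succ]
        field_simp
      rw [this, dist_self]
      positivity
    · rw [h] at hk ⊢
      have h3 := hinc (n + 1) (2 * ⌊t / T * 2 ^ n⌋₊) (by omega)
      have : ((2 * ⌊t / T * 2 ^ n⌋₊ : ℕ) : ℝ) * T / 2 ^ (n + 1) =
          ⌊t / T * 2 ^ n⌋₊ * T / 2 ^ n := by
        push_cast
        rw [pow_succ]
        field_simp
      rw [this] at h3
      rw [dist_comm, Real.dist_eq]
      push_cast at h3 ⊢
      exact h3.trans hrr
  have := dist_le_of_le_geometric_of_tendsto r M hr1 hstep hlimf n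
  rwa [dist_comm, Real.dist_eq] at this

/-- A continuous function with geometrically small dyadic increments is Hölder continuous. -/
theorem abs_sub_le_rpow_of_dyadic {f : ℝ → ℝ} {T M γ : ℝ} (hT : 0 < T) (hγ : 0 < γ)
    (hM : 0 ≤ M) (hf : ContinuousOn f (Set.Icc 0 T))
    (hinc : ∀ n k : ℕ, k < 2 ^ n →
      |f ((k + 1 : ℝ) * T / 2 ^ n) - f (k * T / 2 ^ n)| ≤ M * ((1 / 2 : ℝ) ^ γ) ^ n)
    {s t : ℝ} (hs : s ∈ Set.Icc 0 T) (ht : t ∈ Set.Icc 0 T) (hst : s ≤ t) :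
    |f t - f s| ≤ M * ((1 + 2 / (1 - (1 / 2 : ℝ) ^ γ)) * ((1 / 2 : ℝ) ^ γ)⁻¹ * (T ^ γ)⁻¹) *
      (t - s) ^ γ := by
  set r : ℝ := (1 / 2 : ℝ) ^ γ with hr
  have hr0 : 0 < r := by positivity
  have hr1 : r < 1 := Real.rpow_lt_one (by norm_num) (by norm_num) hγ
  have hr2 : 0 < 1 - r := by linarith
  rcases hst.eq_or_lt with rfl | hlt
  · rw [sub_self, abs_zero]
    have : (0 : ℝ) ≤ (s - s) ^ γ := by rw [sub_self]; exact Real.rpow_nonneg le_rfl _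
    positivity
  have hx0 : 0 < (t - s) / T := div_pos (by linarith) hT
  have hx1 : (t - s) / T ≤ 1 := (div_le_one hT).2 (by linarith [hs.1, ht.2])
  -- The level `n` is the one with `2^(-n-1) < (t - s)/T ≤ 2^(-n)`. The upper bound makes the
  -- approximations of `s` and `t` equal or adjacent; the lower one converts `r^n` into `(t - s)^γ`
  -- at the cost of a factor `r⁻¹`.
  obtain ⟨n, hn1, hn2⟩ := exists_nat_pow_near_of_lt_one hx0 hx1 (y := (1 / 2 : ℝ)) (by norm_num)
    (by norm_num)
  have h1 := abs_sub_dyadic_le hT hr0 hr1 hM hf hinc hs n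
  have h2 := abs_sub_dyadic_le hT hr0 hr1 hM hf hinc ht n
  have h3 : |f (⌊t / T * 2 ^ n⌋₊ * T / 2 ^ n) - f (⌊s / T * 2 ^ n⌋₊ * T / 2 ^ n)| ≤ M * r ^ n := by
    have hs0 : 0 ≤ s / T * 2 ^ n := by have := div_nonneg hs.1 hT.le; positivity
    have hle : s / T * 2 ^ n ≤ t / T * 2 ^ n := by gcongr
    have hle1 : t / T * 2 ^ n ≤ s / T * 2 ^ n + 1 := by
      have h4 : (t - s) / T * 2 ^ n ≤ 1 := by
        calc (t - s) / T * 2 ^ n ≤ (1 / 2 : ℝ) ^ n * 2 ^ n := by gcongr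
          _ = 1 := by rw [← mul_pow]; norm_num
      have h5 : (t - s) / T * 2 ^ n = t / T * 2 ^ n - s / T * 2 ^ n := by ring
      linarith
    have hf1 := Nat.floor_mono hle
    have hf2 := Nat.floor_mono hle1
    rw [Nat.floor_add_one hs0] at hf2
    have ht1 : ⌊t / T * 2 ^ n⌋₊ ≤ 2 ^ n := by
      refine Nat.floor_le_of_le ?_
      push_cast
      have : t / T ≤ 1 := (div_le_one hT).2 ht.2
      nlinarith [pow_pos (zero_lt_two (α := ℝ)) n]
    rcases hf1.eq_or_lt with he | he
    · rw [he, sub_self, abs_zero]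
      positivity
    · have he' : ⌊t / T * 2 ^ n⌋₊ = ⌊s / T * 2 ^ n⌋₊ + 1 := by omega
      have h6 := hinc n ⌊s / T * 2 ^ n⌋₊ (by omega)
      rw [he']
      push_cast
      exact h6
  have h4 : |f t - f s| ≤ M * r ^ n * (1 + 2 / (1 - r)) := by
    have h5 : f t - f s = (f t - f (⌊t / T * 2 ^ n⌋₊ * T / 2 ^ n)) +
        (f (⌊t / T * 2 ^ n⌋₊ * T / 2 ^ n) - f (⌊s / T * 2 ^ n⌋₊ * T / 2 ^ n)) -
        (f s - f (⌊s / T * 2 ^ n⌋₊ * T / 2 ^ n)) := by ring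
    rw [h5]
    refine (abs_sub _ _).trans ((add_le_add_left (abs_add_le _ _) _).trans ?_)
    calc _ ≤ M * r ^ n / (1 - r) + M * r ^ n + M * r ^ n / (1 - r) := by linarith
      _ = _ := by ring
  have h5 : r ^ n ≤ r⁻¹ * ((T ^ γ)⁻¹ * (t - s) ^ γ) := by
    have h6 : r ^ (n + 1) ≤ ((t - s) / T) ^ γ := by
      rw [hr, ← Real.rpow_natCast, ← Real.rpow_mul (by norm_num), mul_comm γ,
        Real.rpow_mul (by norm_num), Real.rpow_natCast]
      exact Real.rpow_le_rpow (by positivity) hn1.le hγ.le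
    rw [Real.div_rpow (by linarith) hT.le, div_eq_inv_mul] at h6
    rw [inv_mul_eq_div, le_div_iff₀ hr0, ← pow_succ]
    exact h6
  calc |f t - f s| ≤ M * r ^ n * (1 + 2 / (1 - r)) := h4
    _ ≤ M * (r⁻¹ * ((T ^ γ)⁻¹ * (t - s) ^ γ)) * (1 + 2 / (1 - r)) := by gcongr
    _ = _ := by ring

/-! ### The scalar equation driven by a Hölder path. -/

/-- Half of the exponential absorbs the power through `u^γ ≤ 1 + u ≤ 2 e^(u/2)`; the other half is
kept for integration in time. -/
theorem rpow_mul_exp_neg_le {u γ : ℝ} (hu : 0 ≤ u) (hγ0 : 0 ≤ γ) (hγ1 : γ ≤ 1) :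
    u ^ γ * Real.exp (-u) ≤ 2 * Real.exp (-(u / 2)) := by
  have h1 : u ^ γ ≤ 1 + u := by
    rcases le_total u 1 with h | h
    · exact (Real.rpow_le_one hu h hγ0).trans (by linarith)
    · calc u ^ γ ≤ u ^ (1 : ℝ) := Real.rpow_le_rpow_of_exponent_le h hγ1
        _ ≤ 1 + u := by rw [Real.rpow_one]; linarith
  have h2 : 1 + u ≤ 2 * Real.exp (u / 2) := by
    have := Real.add_one_le_exp (u / 2)
    linarith
  calc u ^ γ * Real.exp (-u) ≤ 2 * Real.exp (u / 2) * Real.exp (-u) := by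
        gcongr
        exact h1.trans h2
    _ = 2 * Real.exp (-(u / 2)) := by
        rw [mul_assoc, ← Real.exp_add]
        congr 2
        ring

theorem exp_neg_mul_rpow_le {l u γ : ℝ} (hl : 0 < l) (hu : 0 ≤ u) (hγ0 : 0 ≤ γ) (hγ1 : γ ≤ 1) :
    Real.exp (-(l * u)) * u ^ γ ≤ l ^ (-γ) * (2 * Real.exp (-(l * u / 2))) := by
  have h := rpow_mul_exp_neg_le (mul_nonneg hl.le hu) hγ0 hγ1
  rw [Real.mul_rpow hl.le hu] at h
  rw [Real.rpow_neg hl.le, inv_mul_eq_div, le_div_iff₀ (Real.rpow_pos_of_pos hl γ)]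
  linarith

/-- The solution of `y' = -λ y + w'` with a `γ`-Hölder continuous driving path `w` deviates from
`e^{-λt} y(0)` by `O(λ^{-γ})`. -/
theorem norm_sub_exp_mul_le {y w : ℝ → ℂ} {x₀ : ℂ} {l γ M T : ℝ} (hl : 0 < l) (hγ0 : 0 < γ)
    (hγ1 : γ ≤ 1) (hM : 0 ≤ M) (hw0 : w 0 = 0) (hwc : ContinuousOn w (Set.Icc 0 T))
    (hw : ∀ s ∈ Set.Icc 0 T, ∀ t ∈ Set.Icc 0 T, s ≤ t → ‖w t - w s‖ ≤ M * (t - s) ^ γ)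
    (hy : IntervalIntegrable y volume 0 T)
    (heq : ∀ t ∈ Set.Icc 0 T, y t = x₀ + (∫ s in (0 : ℝ)..t, -(l : ℂ) * y s) + w t)
    {t : ℝ} (ht : t ∈ Set.Icc 0 T) :
    ‖y t - (Real.exp (-(l * t)) : ℂ) * x₀‖ ≤ 6 * M * l ^ (-γ) := by
  have hT : 0 ≤ T := ht.1.trans ht.2
  have hsub : Set.Icc 0 t ⊆ Set.Icc 0 T := Set.Icc_subset_Icc_right ht.2
  -- The solution is as rough as `w`, so the calculus is done on its primitive, which is
  -- differentiable.
  set F : ℝ → ℂ := fun s => ∫ r in (0 : ℝ)..s, y r with hF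
  have heq' : ∀ s ∈ Set.Icc 0 T, y s = x₀ - l * F s + w s := by
    intro s hs
    rw [heq s hs, intervalIntegral.integral_const_mul]
    ring
  have hFc : ContinuousOn F (Set.Icc 0 T) := by
    have := intervalIntegral.continuousOn_primitive_interval'
      (hy : IntervalIntegrable y volume 0 T) (Set.left_mem_uIcc)
    rwa [Set.uIcc_of_le hT] at this
  have hyc : ContinuousOn y (Set.Icc 0 T) :=
    ((continuousOn_const.sub (continuousOn_const.mul hFc)).add hwc).congr heq'
  have hFd : ∀ s ∈ Set.Ioo 0 t, HasDerivAt F (y s) s := by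
    intro s hs
    have hsT : s ∈ Set.Ioo 0 T := ⟨hs.1, hs.2.trans_le ht.2⟩
    have hyo : ContinuousOn y (Set.Ioo 0 T) := hyc.mono Set.Ioo_subset_Icc_self
    refine intervalIntegral.integral_hasDerivAt_right ?_
      (hyo.stronglyMeasurableAtFilter isOpen_Ioo s hsT)
      (hyo.continuousAt (isOpen_Ioo.mem_nhds hsT))
    refine hy.mono_set ?_
    rw [Set.uIcc_of_le hs.1.le, Set.uIcc_of_le hT]
    exact Set.Icc_subset_Icc_right hsT.2.le
  set E : ℝ → ℂ := fun s => Complex.exp ((l : ℂ) * ((s : ℂ) - t)) with hE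
  have hEd : ∀ s : ℝ, HasDerivAt E (E s * l) s := by
    intro s
    have := (((hasDerivAt_id (s : ℂ)).sub_const (t : ℂ)).const_mul (l : ℂ)).cexp.comp_ofReal
    simpa using this
  have hEc : Continuous E := continuous_iff_continuousAt.2 fun s => (hEd s).continuousAt
  have hEn : ∀ s : ℝ, ‖E s‖ = Real.exp (-(l * (t - s))) := by
    intro s
    rw [hE]
    simp only
    rw [Complex.norm_exp]
    congr 1
    simp
    ring
  -- Variation of constants in a form that needs no derivative of `w`: subtracting the fixed value
  -- `w t` leaves only increments, which the Hölder bound controls near `s = t`.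
  have hint : ∫ s in (0 : ℝ)..t, E s * (l * (w s - w t)) =
      E t * (l * F t - x₀ - w t) - E 0 * (l * F 0 - x₀ - w t) := by
    refine intervalIntegral.integral_eq_sub_of_hasDerivAt_of_le ht.1
      (f := fun s => E s * (l * F s - x₀ - w t)) ?_ (fun s hs => ?_) ?_
    · exact hEc.continuousOn.mul (((continuousOn_const.mul (hFc.mono hsub)).sub
        continuousOn_const).sub continuousOn_const)
    · have h := (hEd s).mul ((((hFd s hs).const_mul (l : ℂ)).sub_const x₀).sub_const (w t))
      refine h.congr_deriv ?_
      have := heq' s (hsub ⟨hs.1.le, hs.2.le⟩)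
      rw [this]
      ring
    · refine ContinuousOn.intervalIntegrable ?_
      rw [Set.uIcc_of_le ht.1]
      exact hEc.continuousOn.mul (continuousOn_const.mul
        ((hwc.mono hsub).sub continuousOn_const))
  have hE0 : E 0 = (Real.exp (-(l * t)) : ℂ) := by
    rw [hE]
    simp
  have hEt : E t = 1 := by
    rw [hE]
    simp
  have hF0 : F 0 = 0 := by
    rw [hF]
    simp
  have hmain : y t - (Real.exp (-(l * t)) : ℂ) * x₀ =
      E 0 * w t - ∫ s in (0 : ℝ)..t, E s * (l * (w s - w t)) := by
    rw [hint, heq' t ht, hEt, hF0, ← hE0]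
    ring
  have h0T : (0 : ℝ) ∈ Set.Icc 0 T := ⟨le_rfl, hT⟩
  have hlg : 0 < l ^ (-γ) := Real.rpow_pos_of_pos hl _
  have hb1 : ‖E 0 * w t‖ ≤ 2 * M * l ^ (-γ) := by
    rw [norm_mul, hEn, sub_zero]
    have h1 := hw 0 h0T t ht ht.1
    rw [hw0, sub_zero, sub_zero] at h1
    have h2 := exp_neg_mul_rpow_le hl ht.1 hγ0.le hγ1
    have h3 : Real.exp (-(l * t / 2)) ≤ 1 := by
      rw [Real.exp_le_one_iff]
      have := mul_nonneg hl.le ht.1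
      linarith
    calc Real.exp (-(l * t)) * ‖w t‖ ≤ Real.exp (-(l * t)) * (M * t ^ γ) := by gcongr
      _ = M * (Real.exp (-(l * t)) * t ^ γ) := by ring
      _ ≤ M * (l ^ (-γ) * (2 * 1)) := by
        refine mul_le_mul_of_nonneg_left (h2.trans ?_) hM
        gcongr
      _ = _ := by ring
  have hb2 : ‖∫ s in (0 : ℝ)..t, E s * (l * (w s - w t))‖ ≤ 4 * M * l ^ (-γ) := by
    -- The factor `l` costs nothing, as `l ∫ exp(-l(t-s)/2) ds ≤ 2`. With the `2` from
    -- `exp_neg_mul_rpow_le` this gives `4`; the boundary term adds `2`, so the total is `6`.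
    have hd : ∀ s : ℝ, HasDerivAt (fun s => 4 * M * l ^ (-γ) * Real.exp (-(l * (t - s) / 2)))
        (2 * M * l ^ (-γ) * l * Real.exp (-(l * (t - s) / 2))) s := by
      intro s
      have h1 : HasDerivAt (fun s => -(l * (t - s) / 2)) (l / 2) s := by
        have := ((((hasDerivAt_id s).const_sub t).const_mul l).div_const 2).neg
        refine this.congr_deriv ?_
        ring
      refine (h1.exp.const_mul (4 * M * l ^ (-γ))).congr_deriv ?_
      ring
    have hii : IntervalIntegrable (fun s => 2 * M * l ^ (-γ) * l * Real.exp (-(l * (t - s) / 2)))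
        volume 0 t := Continuous.intervalIntegrable (by fun_prop) _ _
    refine (intervalIntegral.norm_integral_le_of_norm_le ht.1
      (Eventually.of_forall fun s hs => ?_) hii).trans ?_
    · have hsI : s ∈ Set.Icc 0 t := ⟨hs.1.le, hs.2⟩
      have h1 := hw s (hsub hsI) t ht hs.2
      have h2 := exp_neg_mul_rpow_le hl (sub_nonneg.2 hs.2) hγ0.le hγ1
      rw [norm_mul, hEn, norm_mul, norm_sub_rev, Complex.norm_real, Real.norm_of_nonneg hl.le]
      calc Real.exp (-(l * (t - s))) * (l * ‖w t - w s‖)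
          ≤ Real.exp (-(l * (t - s))) * (l * (M * (t - s) ^ γ)) := by gcongr
        _ = l * M * (Real.exp (-(l * (t - s))) * (t - s) ^ γ) := by ring
        _ ≤ l * M * (l ^ (-γ) * (2 * Real.exp (-(l * (t - s) / 2)))) := by gcongr
        _ = _ := by ring
    · rw [intervalIntegral.integral_eq_sub_of_hasDerivAt (fun s _ => hd s) hii]
      have : 0 ≤ 4 * M * l ^ (-γ) * Real.exp (-(l * (t - 0) / 2)) := by positivity
      simp only [sub_self, mul_zero, zero_div, neg_zero, Real.exp_zero, mul_one]
      linarith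
  rw [hmain]
  refine (norm_sub_le _ _).trans ?_
  linarith

/-! ### Size of the noise coefficients and summability with weights. -/

theorem noiseCoeff_sub (A : ℕ → ℝ) (b b' : ℕ → ℕ → Fin 2 → ℝ) (l : ℕ) (m : ℤ) :
    noiseCoeff A b l m - noiseCoeff A b' l m =
      noiseCoeff A (fun l m i => b l m i - b' l m i) l m := by
  unfold noiseCoeff
  split_ifs
  all_goals push_cast; ring

theorem norm_noiseCoeff_le {A : ℕ → ℝ} {b : ℕ → ℕ → Fin 2 → ℝ} {l : ℕ} {m : ℤ} {R : ℝ}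
    (hm : m.natAbs ≤ l) (hb : ∀ i, IsMode (l, m.natAbs, i) → |b l m.natAbs i| ≤ R) :
    ‖noiseCoeff A b l m‖ ≤ 2 * Real.sqrt (A l) * R := by
  have h0 : |b l m.natAbs 0| ≤ R := hb 0 ⟨hm, Or.inl rfl⟩
  have hR : 0 ≤ R := (abs_nonneg _).trans h0
  have hs : 0 ≤ Real.sqrt (A l) := Real.sqrt_nonneg _
  by_cases hm0 : m = 0
  · subst hm0
    simp only [noiseCoeff, if_true, norm_mul, Complex.norm_real, Real.norm_eq_abs, abs_of_nonneg hs]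
    simp only [Int.natAbs_zero] at h0
    calc Real.sqrt (A l) * |b l 0 0| ≤ Real.sqrt (A l) * R := by gcongr
      _ ≤ 2 * Real.sqrt (A l) * R := by nlinarith [mul_nonneg hs hR]
  · have h1 : |b l m.natAbs 1| ≤ R := hb 1 ⟨hm, Or.inr (by simp only; omega)⟩
    have hs2 : Real.sqrt (A l / 2) ≤ Real.sqrt (A l) := by
      rcases le_total 0 (A l) with h | h
      · exact Real.sqrt_le_sqrt (by linarith)
      · rw [Real.sqrt_eq_zero_of_nonpos h, Real.sqrt_eq_zero_of_nonpos (by linarith)]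
    have hx : ‖((b l m.natAbs 0 : ℝ) : ℂ)‖ ≤ R := by rwa [Complex.norm_real]
    have hy : ‖Complex.I * ((b l m.natAbs 1 : ℝ) : ℂ)‖ ≤ R := by
      rwa [norm_mul, Complex.norm_I, one_mul, Complex.norm_real]
    have hsub := (norm_sub_le ((b l m.natAbs 0 : ℝ) : ℂ)
      (Complex.I * ((b l m.natAbs 1 : ℝ) : ℂ))).trans (add_le_add hx hy)
    have hadd := (norm_add_le ((b l m.natAbs 0 : ℝ) : ℂ)
      (Complex.I * ((b l m.natAbs 1 : ℝ) : ℂ))).trans (add_le_add hx hy)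
    have hfin : ∀ z : ℂ, ‖z‖ ≤ R + R → Real.sqrt (A l / 2) * ‖z‖ ≤ 2 * Real.sqrt (A l) * R := by
      intro z hz
      calc Real.sqrt (A l / 2) * ‖z‖ ≤ Real.sqrt (A l) * (R + R) := by gcongr
        _ = _ := by ring
    unfold noiseCoeff
    rw [if_neg hm0]
    split_ifs
    · rw [norm_mul, Complex.norm_real, Real.norm_of_nonneg (Real.sqrt_nonneg _)]
      exact hfin _ hsub
    · rw [norm_mul, norm_mul, norm_pow, norm_neg, norm_one, one_pow, one_mul, Complex.norm_real,
        Real.norm_of_nonneg (Real.sqrt_nonneg _)]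
      exact hfin _ hadd

/-- Coefficients of size `√A_ℓ ℓ^{-1+3δ}` contribute at most `ℓ^{-1-α+6δ}` in degree `ℓ`. -/
theorem sum_norm_sq_le_of_decay {A : ℕ → ℝ} {l : ℕ} (hA : 0 ≤ A l) {α C : ℝ}
    (hl : 1 ≤ l) (hdecay : A l ≤ C * (l : ℝ) ^ (-α)) {K δ : ℝ} {a : ℤ → ℂ}
    (ha : ∀ m ∈ Finset.Icc (-(l : ℤ)) l, ‖a m‖ ≤ K * Real.sqrt (A l) * (l : ℝ) ^ (-1 + 3 * δ)) :
    ∑ m ∈ Finset.Icc (-(l : ℤ)) l, ‖a m‖ ^ 2 ≤ 3 * K ^ 2 * C * (l : ℝ) ^ (-1 - α + 6 * δ) := by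
  have hl1 : (1 : ℝ) ≤ l := by exact_mod_cast hl
  have hl0 : (0 : ℝ) < l := by linarith
  have h1 : ∀ m ∈ Finset.Icc (-(l : ℤ)) l,
      ‖a m‖ ^ 2 ≤ K ^ 2 * A l * (l : ℝ) ^ (-2 + 6 * δ) := by
    intro m hm
    refine (pow_le_pow_left₀ (norm_nonneg _) (ha m hm) 2).trans (le_of_eq ?_)
    rw [mul_pow, mul_pow, Real.sq_sqrt hA, ← Real.rpow_natCast ((l : ℝ) ^ (-1 + 3 * δ)),
      ← Real.rpow_mul hl0.le]
    congr 2
    push_cast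
    ring
  refine (Finset.sum_le_card_nsmul _ _ _ h1).trans ?_
  have hcard : ((Finset.Icc (-(l : ℤ)) l).card : ℝ) ≤ 3 * l := by
    have : (Finset.Icc (-(l : ℤ)) l).card = 2 * l + 1 := by
      rw [Int.card_Icc]; omega
    rw [this]
    push_cast
    linarith
  have hp : ∀ e : ℝ, 0 < (l : ℝ) ^ e := fun e => Real.rpow_pos_of_pos hl0 e
  have hp1 := hp (-2 + 6 * δ)
  have h2 : (l : ℝ) * ((l : ℝ) ^ (-α) * (l : ℝ) ^ (-2 + 6 * δ)) =
      (l : ℝ) ^ (-1 - α + 6 * δ) := by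
    rw [← Real.rpow_add hl0]
    nth_rewrite 1 [← Real.rpow_one (l : ℝ)]
    rw [← Real.rpow_add hl0]
    congr 1
    ring
  rw [nsmul_eq_mul]
  calc _ ≤ 3 * (l : ℝ) * (K ^ 2 * A l * (l : ℝ) ^ (-2 + 6 * δ)) := by gcongr
    _ ≤ 3 * (l : ℝ) * (K ^ 2 * (C * (l : ℝ) ^ (-α)) * (l : ℝ) ^ (-2 + 6 * δ)) := by gcongr
    _ = 3 * K ^ 2 * C * ((l : ℝ) * ((l : ℝ) ^ (-α) * (l : ℝ) ^ (-2 + 6 * δ))) := by ring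
    _ = _ := by rw [h2]

theorem summable_weight_mul_rpow {b e : ℝ} (h : 2 * b + e < -1) (B : ℝ) :
    Summable fun l : ℕ => (l : ℝ) ^ (2 * b) * (B * (l : ℝ) ^ e) := by
  have h1 := (Real.summable_nat_rpow.2 h).mul_left B
  -- Splitting the power of a sum of exponents may fail at `l = 0`, which is discarded here.
  refine h1.congr_cofinite ?_
  rw [Nat.cofinite_eq_atTop]
  filter_upwards [eventually_gt_atTop 0] with l hl
  rw [Real.rpow_add (by exact_mod_cast hl)]
  ring

/-- The heat semigroup at a positive time absorbs every power of the degree. -/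
theorem summable_weight_mul_exp {u : ℕ → ℝ} (hu : ∀ l, 0 ≤ u l) (hs : Summable u) (b : ℝ)
    {ε : ℝ} (hε : 0 < ε) :
    Summable fun l : ℕ => (l : ℝ) ^ (2 * b) * (Real.exp (-((l : ℝ) * (l + 1)) * ε) ^ 2 * u l) := by
  obtain ⟨q, hq⟩ := exists_nat_ge (2 * b)
  refine Summable.of_norm_bounded_eventually_nat (g := fun l => (q.factorial / ε ^ q) * u l)
    (hs.mul_left _) ?_
  filter_upwards [eventually_ge_atTop 1] with l hl
  have hl1 : (1 : ℝ) ≤ l := by exact_mod_cast hl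
  have hl0 : (0 : ℝ) < l := by linarith
  have h1 : (l : ℝ) ^ (2 * b) ≤ (l : ℝ) ^ q := by
    rw [← Real.rpow_natCast]
    exact Real.rpow_le_rpow_of_exponent_le hl1 hq
  have h2 : Real.exp (-((l : ℝ) * (l + 1)) * ε) ^ 2 ≤ q.factorial / (ε * l) ^ q := by
    refine le_trans ?_ (exp_neg_le_factorial_div_pow q (mul_pos hε hl0))
    rw [← Real.exp_nat_mul]
    refine Real.exp_le_exp.2 ?_
    push_cast
    nlinarith [mul_pos hε hl0, mul_pos (mul_pos hε hl0) hl0]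
  have h3 := hu l
  rw [Real.norm_of_nonneg (by positivity), ← mul_assoc]
  refine mul_le_mul_of_nonneg_right ?_ h3
  calc _ ≤ (l : ℝ) ^ q * (q.factorial / (ε * l) ^ q) := by gcongr
    _ = _ := by rw [mul_pow]; field_simp

theorem add_one_rpow_le {l : ℕ} (hl : 1 ≤ l) {δ : ℝ} (hδ0 : 0 ≤ δ) (hδ1 : δ ≤ 1) :
    ((l : ℝ) + 1) ^ δ ≤ 2 * (l : ℝ) ^ δ := by
  have hl1 : (1 : ℝ) ≤ l := by exact_mod_cast hl
  calc ((l : ℝ) + 1) ^ δ ≤ (2 * l) ^ δ := by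
        refine Real.rpow_le_rpow (by positivity) (by linarith) hδ0
    _ = 2 ^ δ * (l : ℝ) ^ δ := Real.mul_rpow (by norm_num) (by linarith)
    _ ≤ 2 * (l : ℝ) ^ δ := by
        refine mul_le_mul_of_nonneg_right ?_ (by positivity)
        calc (2 : ℝ) ^ δ ≤ 2 ^ (1 : ℝ) := Real.rpow_le_rpow_of_exponent_le (by norm_num) hδ1
          _ = 2 := Real.rpow_one 2

/-! ### Almost sure growth in the degree. -/

variable [IsProbabilityMeasure P]

/-- Almost surely, all Brownian motions of the family are Hölder continuous on `[0, T]`, with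
constants that grow at most like a small power of the degree. -/
theorem ae_exists_holder {β : ℕ → ℕ → Fin 2 → ℝ≥0 → Ω → ℝ}
    (hβ : ∀ l m i, IsMode (l, m, i) → IsBrownianReal (β l m i) P) {T : ℝ} (hT : 0 < T) {δ : ℝ}
    (hδ0 : 0 < δ) (hδ1 : δ < 1 / 2) :
    ∀ᵐ ω ∂P, ∃ C : ℝ, 0 ≤ C ∧ ∀ l m i, IsMode (l, m, i) → ∀ s ∈ Set.Icc 0 T, ∀ t ∈ Set.Icc 0 T,
      s ≤ t → |β l m i t.toNNReal ω - β l m i s.toNNReal ω| ≤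
        C * ((l : ℝ) + 1) ^ δ * (t - s) ^ (1 / 2 - δ) := by
  have hcont : ∀ᵐ ω ∂P, ∀ l m i, IsMode (l, m, i) → Continuous fun t => β l m i t ω := by
    refine ae_all_iff.2 fun l => ae_all_iff.2 fun m => ae_all_iff.2 fun i => ?_
    by_cases h : IsMode (l, m, i)
    · filter_upwards [(hβ l m i h).cont] with ω hω _
      exact hω
    · exact Eventually.of_forall fun ω h' => absurd h' h
  -- The multi-index is `(l, m, n, k, i)` with dyadic level `n` and position `k`; the increment has
  -- variance `T / 2^n`.
  have hbd := ae_exists_abs_le_idxWeight (P := P)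
    (fun p ω => β p.1 p.2.1 p.2.2.2.2
        (((p.2.2.2.1 + 1 : ℝ) * T / 2 ^ p.2.2.1).toNNReal) ω -
      β p.1 p.2.1 p.2.2.2.2 ((p.2.2.2.1 * T / 2 ^ p.2.2.1).toNNReal) ω)
    (fun p => (T / 2 ^ p.2.2.1).toNNReal)
    (fun p => IsMode (p.1, p.2.1, p.2.2.2.2))
    (fun p _ => Real.toNNReal_pos.2 (by positivity))
    (fun p hp => by
      have h := (hβ _ _ _ hp).hasLaw_sub (((p.2.2.2.1 + 1 : ℝ) * T / 2 ^ p.2.2.1).toNNReal)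
        ((p.2.2.2.1 * T / 2 ^ p.2.2.1).toNNReal)
      have hv : nndist (((p.2.2.2.1 + 1 : ℝ) * T / 2 ^ p.2.2.1).toNNReal : ℝ)
          ((p.2.2.2.1 * T / 2 ^ p.2.2.1).toNNReal : ℝ) = (T / 2 ^ p.2.2.1).toNNReal := by
        apply NNReal.eq
        rw [coe_nndist, Real.dist_eq, Real.coe_toNNReal _ (by positivity),
          Real.coe_toNNReal _ (by positivity), Real.coe_toNNReal _ (by positivity), ← sub_div,
          ← sub_mul, add_sub_cancel_left, one_mul, abs_of_nonneg (by positivity)]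
      rw [← hv]
      exact h)
    (half_pos hδ0)
  filter_upwards [hcont, hbd] with ω hc hω
  obtain ⟨C, hC, hb⟩ := hω
  set γ : ℝ := 1 / 2 - δ with hγ
  have hγ0 : 0 < γ := by linarith
  have hr1 : (1 / 2 : ℝ) ^ γ < 1 := Real.rpow_lt_one (by norm_num) (by norm_num) hγ0
  have hr2 : 0 < 1 - (1 / 2 : ℝ) ^ γ := by linarith
  refine ⟨C * Real.sqrt T * ((1 + 2 / (1 - (1 / 2 : ℝ) ^ γ)) * ((1 / 2 : ℝ) ^ γ)⁻¹ * (T ^ γ)⁻¹),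
    by positivity, fun l m i hm s hs t ht hst => ?_⟩
  have h := abs_sub_le_rpow_of_dyadic (f := fun t => β l m i t.toNNReal ω)
    (M := C * Real.sqrt T * ((l : ℝ) + 1) ^ δ) hT hγ0 (by positivity)
    ((hc l m i hm).comp continuous_real_toNNReal).continuousOn (fun n k hk => ?_) hs ht hst
  · refine h.trans (le_of_eq ?_)
    ring
  · have h1 := hb (l, m, n, k, i) hm
    simp only at h1
    refine h1.trans ?_
    rw [Real.coe_toNNReal _ (by positivity)]
    have hml : (m : ℝ) ≤ l := by exact_mod_cast hm.1
    have hk1 : (k : ℝ) + 1 ≤ 2 ^ n := by exact_mod_cast hk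
    have hn1 : (n : ℝ) + 1 ≤ 2 ^ n := by exact_mod_cast Nat.lt_two_pow_self (n := n)
    -- The weight is at most quadratic in `(l+1) 2^n`, so the exponent `δ/2` costs `(l+1)^δ` in the
    -- degree and `(2^n)^δ` in the level; the latter lowers the Hölder exponent from `1/2` to `1/2 -
    -- δ`.
    have hW : idxWeight (l, m, n, k, i) ≤ (((l : ℝ) + 1) * 2 ^ n) ^ 2 := by
      unfold idxWeight
      calc ((l : ℝ) + 1) * (((m : ℝ) + 1) * (((n : ℝ) + 1) * ((k : ℝ) + 1)))
          ≤ ((l : ℝ) + 1) * (((l : ℝ) + 1) * (2 ^ n * 2 ^ n)) := by gcongr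
        _ = _ := by ring
    have hWδ : idxWeight (l, m, n, k, i) ^ (δ / 2) ≤ ((l : ℝ) + 1) ^ δ * ((2 : ℝ) ^ n) ^ δ := by
      refine (Real.rpow_le_rpow (zero_le_one.trans (one_le_idxWeight _)) hW (by positivity)).trans
        (le_of_eq ?_)
      rw [← Real.rpow_natCast, ← Real.rpow_mul (by positivity), ← Real.mul_rpow (by positivity)
        (by positivity)]
      congr 1
      push_cast
      ring
    have hsq : Real.sqrt (T / 2 ^ n) * ((2 : ℝ) ^ n) ^ δ = Real.sqrt T * ((1 / 2 : ℝ) ^ γ) ^ n := by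
      rw [Real.sqrt_div hT.le, div_mul_eq_mul_div, mul_div_assoc]
      congr 1
      rw [Real.sqrt_eq_rpow, ← Real.rpow_sub (by positivity), ← Real.rpow_natCast,
        ← Real.rpow_natCast, ← Real.rpow_mul (by norm_num), ← Real.rpow_mul (by norm_num),
        one_div, Real.inv_rpow (by norm_num), ← Real.rpow_neg (by norm_num), hγ]
      congr 1
      ring
    calc C * (Real.sqrt (T / 2 ^ n) * idxWeight (l, m, n, k, i) ^ (δ / 2))
        ≤ C * (Real.sqrt (T / 2 ^ n) * (((l : ℝ) + 1) ^ δ * ((2 : ℝ) ^ n) ^ δ)) := by gcongr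
      _ = C * ((l : ℝ) + 1) ^ δ * (Real.sqrt (T / 2 ^ n) * ((2 : ℝ) ^ n) ^ δ) := by ring
      _ = _ := by rw [hsq]; ring

/-- Almost surely, the normal variables of the family grow at most like a small power of the
degree. -/
theorem ae_exists_abs_normal_le {n : ℕ} {ξ : ℕ → ℕ → ℕ → Fin 2 → Ω → ℝ}
    (hξ : ∀ j < n, ∀ l m i, IsMode (l, m, i) → HasLaw (ξ j l m i) (gaussianReal 0 1) P) {δ : ℝ}
    (hδ0 : 0 < δ) :
    ∀ᵐ ω ∂P, ∃ C : ℝ, 0 ≤ C ∧ ∀ j < n, ∀ l m i, IsMode (l, m, i) →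
      |ξ j l m i ω| ≤ C * ((l : ℝ) + 1) ^ δ := by
  have hbd := ae_exists_abs_le_idxWeight (P := P)
    (fun p ω => ξ p.1 p.2.1 p.2.2.1 p.2.2.2.2 ω) (fun _ => 1)
    (fun p => p.1 < n ∧ IsMode (p.2.1, p.2.2.1, p.2.2.2.2))
    (fun _ _ => one_pos) (fun p hp => hξ _ hp.1 _ _ _ hp.2) (half_pos hδ0)
  filter_upwards [hbd] with ω hω
  obtain ⟨C, hC, hb⟩ := hω
  refine ⟨C * (n : ℝ) ^ (δ / 2), by positivity, fun j hj l m i hm => ?_⟩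
  -- Only three natural indices occur here; the fourth is set to `0` and contributes the factor `1`
  -- to the weight.
  have h1 := hb (j, l, m, 0, i) ⟨hj, hm⟩
  simp only [NNReal.coe_one, Real.sqrt_one, one_mul] at h1
  refine h1.trans ?_
  have hml : (m : ℝ) ≤ l := by exact_mod_cast hm.1
  have hjn : (j : ℝ) + 1 ≤ n := by exact_mod_cast hj
  have hW : idxWeight (j, l, m, 0, i) ≤ n * ((l : ℝ) + 1) ^ 2 := by
    unfold idxWeight
    calc ((j : ℝ) + 1) * (((l : ℝ) + 1) * (((m : ℝ) + 1) * (((0 : ℕ) : ℝ) + 1)))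
        ≤ (n : ℝ) * (((l : ℝ) + 1) * (((l : ℝ) + 1) * (((0 : ℕ) : ℝ) + 1))) := by gcongr
      _ = _ := by push_cast; ring
  rw [mul_assoc]
  refine mul_le_mul_of_nonneg_left ?_ hC
  refine (Real.rpow_le_rpow (zero_le_one.trans (one_le_idxWeight _)) hW (by positivity)).trans
    (le_of_eq ?_)
  rw [Real.mul_rpow (by positivity) (by positivity), ← Real.rpow_natCast,
    ← Real.rpow_mul (by positivity)]
  congr 2
  push_cast
  ring

/-- Almost surely, the coefficients of a solution deviate from those of the heat flow of the
initial value by `O(√A_ℓ ℓ^{-1+3δ})`, uniformly in time. -/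
theorem ae_exists_norm_pair_sub_le {A : ℕ → ℝ} {β : ℕ → ℕ → Fin 2 → ℝ≥0 → Ω → ℝ} {T : ℝ}
    (hT : 0 < T) {X₀ : Ω → L2S} {X : ℝ → Ω → L2S} (hβ : IsBrownianFamily P β)
    (hX : IsSolution P A β T X₀ X) {δ : ℝ} (hδ0 : 0 < δ) (hδ1 : δ < 1 / 2) :
    ∀ᵐ ω ∂P, ∃ K : ℝ, ∀ l : ℕ, 1 ≤ l → ∀ m ∈ Finset.Icc (-(l : ℤ)) l, ∀ t ∈ Set.Icc 0 T,
      ‖pair (X t ω) (harm l m) -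
        (Real.exp (-((l : ℝ) * (l + 1) * t)) : ℂ) * pair (X₀ ω) (harm l m)‖ ≤
        K * Real.sqrt (A l) * (l : ℝ) ^ (-1 + 3 * δ) := by
  have hzero : ∀ᵐ ω ∂P, ∀ l m i, IsMode (l, m, i) → β l m i 0 ω = 0 := by
    refine ae_all_iff.2 fun l => ae_all_iff.2 fun m => ae_all_iff.2 fun i => ?_
    by_cases h : IsMode (l, m, i)
    · filter_upwards [(hβ.brownian l m i h).eval_zero_ae_eq_zero] with ω hω _
      exact hω
    · exact Eventually.of_forall fun ω h' => absurd h' h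
  have hcont : ∀ᵐ ω ∂P, ∀ l m i, IsMode (l, m, i) → Continuous fun t => β l m i t ω := by
    refine ae_all_iff.2 fun l => ae_all_iff.2 fun m => ae_all_iff.2 fun i => ?_
    by_cases h : IsMode (l, m, i)
    · filter_upwards [(hβ.brownian l m i h).cont] with ω hω _
      exact hω
    · exact Eventually.of_forall fun ω h' => absurd h' h
  filter_upwards [hzero, hcont, ae_exists_holder hβ.brownian hT hδ0 hδ1, hX.equation]
    with ω h0 hc hH heq
  obtain ⟨C, hC, hH⟩ := hH
  -- The constant is `6 * 2 * 2`, from `norm_sub_exp_mul_le`, `norm_noiseCoeff_le` and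
  -- `add_one_rpow_le`.
  refine ⟨24 * C, fun l hl m hm t ht => ?_⟩
  have hml := natAbs_le_of_mem_Icc hm
  have hl1 : (1 : ℝ) ≤ l := by exact_mod_cast hl
  have hl0 : (0 : ℝ) < l := by linarith
  have hlam : 0 < (l : ℝ) * (l + 1) := by positivity
  obtain ⟨hint, hsol⟩ := heq l m hm
  set w : ℝ → ℂ := fun t => noiseCoeff A (fun l' m' i => β l' m' i t.toNNReal ω) l m with hw
  have hwsub : ∀ s ∈ Set.Icc 0 T, ∀ t ∈ Set.Icc 0 T, s ≤ t → ‖w t - w s‖ ≤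
      (2 * Real.sqrt (A l) * (C * ((l : ℝ) + 1) ^ δ)) * (t - s) ^ (1 / 2 - δ) := by
    intro s hs t ht hst
    simp only [hw]
    rw [noiseCoeff_sub, mul_assoc]
    exact norm_noiseCoeff_le hml fun i hi => hH l m.natAbs i hi s hs t ht hst
  have hw0 : w 0 = 0 := by
    rw [← norm_le_zero_iff]
    refine (norm_noiseCoeff_le (R := 0) hml fun i hi => ?_).trans (by simp)
    simp [h0 l m.natAbs i hi]
  have hwc : ContinuousOn w (Set.Icc 0 T) := by
    have hb : ∀ i, IsMode (l, m.natAbs, i) →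
        Continuous fun t : ℝ => ((β l m.natAbs i t.toNNReal ω : ℝ) : ℂ) := fun i hi =>
      Complex.continuous_ofReal.comp ((hc l m.natAbs i hi).comp continuous_real_toNNReal)
    have hb0 := hb 0 ⟨hml, Or.inl rfl⟩
    simp only [hw]
    unfold noiseCoeff
    by_cases hm0 : m = 0
    · subst hm0
      simp only [if_true]
      exact (continuous_const.mul hb0).continuousOn
    · have hb1 := hb 1 ⟨hml, Or.inr (by simp only; omega)⟩
      simp only [if_neg hm0]
      split_ifs <;> exact Continuous.continuousOn (by fun_prop)
  -- Integrability is given for the pairing with `Δ Y`; dividing by the eigenvalue, nonzero because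
  -- `l ≥ 1`, transfers it.
  have hy : IntervalIntegrable (fun s => pair (X s ω) (harm l m)) volume 0 T := by
    have h1 := hint.const_mul (-(((l : ℝ) * (l + 1) : ℝ) : ℂ))⁻¹
    have hne : -(((l : ℝ) * (l + 1) : ℝ) : ℂ) ≠ 0 := neg_ne_zero.2 (by exact_mod_cast hlam.ne')
    refine h1.congr fun s _ => ?_
    simp only [pair_laplaceS2_harm]
    rw [inv_mul_cancel_left₀ hne]
  simp only [pair_laplaceS2_harm] at hsol
  have hmain := norm_sub_exp_mul_le (y := fun s => pair (X s ω) (harm l m)) (w := w) hlam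
    (by linarith : 0 < 1 / 2 - δ) (by linarith) (by positivity) hw0 hwc hwsub hy hsol ht
  refine hmain.trans ?_
  -- The eigenvalue contributes `2δ` to the exponent and the Hölder constant another `δ`, whence
  -- `3δ`.
  have h1 : ((l : ℝ) * (l + 1)) ^ (-(1 / 2 - δ)) ≤ (l : ℝ) ^ (-1 + 2 * δ) := by
    calc ((l : ℝ) * (l + 1)) ^ (-(1 / 2 - δ)) ≤ ((l : ℝ) ^ 2) ^ (-(1 / 2 - δ)) := by
          refine Real.rpow_le_rpow_of_nonpos (by positivity) (by nlinarith) (by linarith)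
      _ = _ := by
          rw [← Real.rpow_natCast, ← Real.rpow_mul hl0.le]
          congr 1
          push_cast
          ring
  have h2 := add_one_rpow_le hl hδ0.le (by linarith : δ ≤ 1)
  calc 6 * (2 * Real.sqrt (A l) * (C * ((l : ℝ) + 1) ^ δ)) * ((l : ℝ) * (l + 1)) ^ (-(1 / 2 - δ))
      ≤ 6 * (2 * Real.sqrt (A l) * (C * (2 * (l : ℝ) ^ δ))) * (l : ℝ) ^ (-1 + 2 * δ) := by gcongr
    _ = 24 * C * Real.sqrt (A l) * ((l : ℝ) ^ δ * (l : ℝ) ^ (-1 + 2 * δ)) := by ring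
    _ = _ := by
      rw [← Real.rpow_add hl0]
      congr 2
      ring

theorem norm_sq_le_two_mul_add (a b : ℂ) : ‖a‖ ^ 2 ≤ 2 * ‖b‖ ^ 2 + 2 * ‖a - b‖ ^ 2 := by
  have h : ‖a‖ ≤ ‖b‖ + ‖a - b‖ := by
    simpa using norm_add_le b (a - b)
  nlinarith [norm_nonneg a, sq_nonneg (‖b‖ - ‖a - b‖)]

/-- The squared norm of the component of degree `ℓ`, given the bound on the noise. -/
theorem degreeSq_le_of_norm_pair_sub_le {A : ℕ → ℝ} {l : ℕ} (hA : 0 ≤ A l) {α C : ℝ}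
    (hl : 1 ≤ l) (hdecay : A l ≤ C * (l : ℝ) ^ (-α)) {K δ c : ℝ} {f g : L2S}
    (h : ∀ m ∈ Finset.Icc (-(l : ℤ)) l, ‖pair f (harm l m) - (c : ℂ) * pair g (harm l m)‖ ≤
      K * Real.sqrt (A l) * (l : ℝ) ^ (-1 + 3 * δ)) :
    degreeSq l f ≤ 2 * (c ^ 2 * degreeSq l g) +
      6 * K ^ 2 * C * (l : ℝ) ^ (-1 - α + 6 * δ) := by
  have h1 := sum_norm_sq_le_of_decay hA hl hdecay h
  have h2 : degreeSq l f ≤ ∑ m ∈ Finset.Icc (-(l : ℤ)) l, (2 * (c ^ 2 * ‖pair g (harm l m)‖ ^ 2) +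
      2 * ‖pair f (harm l m) - (c : ℂ) * pair g (harm l m)‖ ^ 2) := by
    refine Finset.sum_le_sum fun m _ => ?_
    refine (norm_sq_le_two_mul_add _ ((c : ℂ) * pair g (harm l m))).trans (le_of_eq ?_)
    rw [norm_mul, Complex.norm_real, mul_pow, Real.norm_eq_abs, sq_abs]
  rw [Finset.sum_add_distrib, ← Finset.mul_sum, ← Finset.mul_sum, ← Finset.mul_sum] at h2
  unfold degreeSq at h2 ⊢
  linarith

/-! ### The convergence rates. -/

/-- The parameter `δ` runs through the countable sequence `1/(N+3)`, so that one null set serves all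
exponents `b`; the shift by `3` keeps `δ < 1/2`. -/
theorem exists_nat_small {a b : ℝ} (h : b < a / 2) :
    ∃ N : ℕ, 2 * b + (-1 - a + 6 * (1 / ((N : ℝ) + 3))) < -1 := by
  have h1 : 0 < (a - 2 * b) / 6 := by linarith
  obtain ⟨N, hN⟩ := exists_nat_one_div_lt h1
  refine ⟨N, ?_⟩
  have h2 : 1 / ((N : ℝ) + 3) ≤ 1 / ((N : ℝ) + 1) := by
    apply one_div_le_one_div_of_le <;> [positivity; linarith]
  linarith

theorem inv_nat_add_three (N : ℕ) : 0 < 1 / ((N : ℝ) + 3) ∧ 1 / ((N : ℝ) + 3) < 1 / 2 := by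
  refine ⟨by positivity, ?_⟩
  apply one_div_lt_one_div_of_lt <;> linarith [(Nat.cast_nonneg N : (0 : ℝ) ≤ N)]

/-- The rate of the truncations of a solution in continuous time. -/
theorem ae_rate_solution {A : ℕ → ℝ} (hA : ∀ l, 0 ≤ A l) {α C : ℝ} {l₀ : ℕ} (hα : 0 < α)
    (hdecay : ∀ l : ℕ, l₀ < l → A l ≤ C * (l : ℝ) ^ (-α))
    {β : ℕ → ℕ → Fin 2 → ℝ≥0 → Ω → ℝ} {T : ℝ}
    (hT : 0 < T) {X₀ : Ω → L2S} {X : ℝ → Ω → L2S} (hβ : IsBrownianFamily P β)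
    (hX : IsSolution P A β T X₀ X) :
    ∀ᵐ ω ∂P,
      (∀ b < α / 2, ∀ ε > 0, ∃ K : ℕ, ∀ κ ≥ K, ∀ t ∈ Set.Icc ε T,
        ‖X t ω - truncate κ (X t ω)‖ ≤ (κ : ℝ) ^ (-b)) ∧
      ((∀ b < α / 2, ∃ K : ℕ, ∀ κ ≥ K, ‖X₀ ω - truncate κ (X₀ ω)‖ ≤ (κ : ℝ) ^ (-b)) →
        ∀ b < α / 2, ∃ K : ℕ, ∀ κ ≥ K, ∀ t ∈ Set.Icc 0 T,
          ‖X t ω - truncate κ (X t ω)‖ ≤ (κ : ℝ) ^ (-b)) := by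
  have hN : ∀ᵐ ω ∂P, ∀ N : ℕ, _ := ae_all_iff.2 fun N : ℕ =>
    ae_exists_norm_pair_sub_le hT hβ hX (inv_nat_add_three N).1 (inv_nat_add_three N).2
  filter_upwards [hN] with ω hω
  have hbound : ∀ b < α / 2, ∃ B e : ℝ, 0 ≤ B ∧ 2 * b + e < -1 ∧ ∀ l ≥ max 1 (l₀ + 1),
      ∀ t ∈ Set.Icc 0 T, degreeSq l (X t ω) ≤
        2 * (Real.exp (-((l : ℝ) * (l + 1) * t)) ^ 2 * degreeSq l (X₀ ω)) +
          B * (l : ℝ) ^ e := by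
    intro b hb
    obtain ⟨N, hN⟩ := exists_nat_small hb
    obtain ⟨K, hK⟩ := hω N
    refine ⟨6 * K ^ 2 * max C 0, _, by positivity, hN, fun l hl t ht => ?_⟩
    have hl1 : 1 ≤ l := (le_max_left _ _).trans hl
    have hl2 : l₀ < l := (le_max_right 1 (l₀ + 1)).trans hl
    refine degreeSq_le_of_norm_pair_sub_le (hA l) hl1 ?_ fun m hm => hK l hl1 m hm t ht
    refine (hdecay l hl2).trans (mul_le_mul_of_nonneg_right (le_max_left _ _) (by positivity))
  constructor
  · intro b hb ε hε
    refine exists_rate_of_nonneg (Set.Icc ε T) (fun κ t => ‖X t ω - truncate κ (X t ω)‖)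
      (half_pos hα) (fun b hb hb0 => ?_) hb
    obtain ⟨B, e, hB, he, hle⟩ := hbound b hb
    have hs := ((summable_weight_mul_exp (fun l => degreeSq_nonneg l (X₀ ω))
      (hasSum_degreeSq (X₀ ω)).summable b hε).mul_left 2).add (summable_weight_mul_rpow he B)
    refine exists_forall_norm_sub_truncate_le (Set.Icc ε T) (fun t => X t ω)
      (d := fun l => 2 * (Real.exp (-((l : ℝ) * (l + 1)) * ε) ^ 2 * degreeSq l (X₀ ω)) +
        B * (l : ℝ) ^ e) (fun l => ?_) hb0 ?_ (L := max 1 (l₀ + 1)) (fun l hl t ht => ?_)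
    · have := degreeSq_nonneg l (X₀ ω)
      positivity
    · refine hs.congr fun l => ?_
      ring
    · refine (hle l hl t ⟨hε.le.trans ht.1, ht.2⟩).trans ?_
      have := degreeSq_nonneg l (X₀ ω)
      have hexp : Real.exp (-((l : ℝ) * (l + 1) * t)) ≤ Real.exp (-((l : ℝ) * (l + 1)) * ε) := by
        refine Real.exp_le_exp.2 ?_
        have h1 : (l : ℝ) * (l + 1) * ε ≤ (l : ℝ) * (l + 1) * t :=
          mul_le_mul_of_nonneg_left ht.1 (by positivity)
        linarith
      gcongr
  · intro h0 b hb
    refine exists_rate_of_nonneg (Set.Icc 0 T) (fun κ t => ‖X t ω - truncate κ (X t ω)‖)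
      (half_pos hα) (fun b hb hb0 => ?_) hb
    -- Room for constants: with the rate `b'`, the initial value enters twice and the noise once,
    -- and `κ^(2(b'-b)) ≥ 3` absorbs this for large `κ`.
    obtain ⟨b', hbb', hb'⟩ := exists_between hb
    obtain ⟨B, e, hB, he, hle⟩ := hbound b' hb'
    obtain ⟨K₁, hK₁⟩ := h0 b' hb'
    obtain ⟨K₂, hK₂⟩ := exists_forall_tsum_tail_le (d := fun l : ℕ => B * (l : ℝ) ^ e)
      (fun l => by positivity) (hb0.trans hbb'.le) (summable_weight_mul_rpow he B)
    have hlim : Tendsto (fun κ : ℕ => (κ : ℝ) ^ (2 * (b' - b))) atTop atTop :=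
      (tendsto_rpow_atTop (by linarith)).comp tendsto_natCast_atTop_atTop
    obtain ⟨K₃, hK₃⟩ := eventually_atTop.1 (hlim.eventually_ge_atTop 3)
    refine ⟨max (max K₁ K₂) (max K₃ (max 1 (l₀ + 1))), fun κ hκ t ht => ?_⟩
    simp only [ge_iff_le, max_le_iff] at hκ
    obtain ⟨⟨hκ1, hκ2⟩, hκ3, hκ4, hκ5⟩ := hκ
    have hκ0 : (0 : ℝ) < κ := by exact_mod_cast hκ4
    obtain ⟨hs, htail⟩ := hK₂ κ hκ2
    have hX0 := pow_le_pow_left₀ (norm_nonneg _) (hK₁ κ hκ1) 2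
    have hs0 := hasSum_norm_sub_truncate_sq κ (X₀ ω)
    have hcmp : ‖X t ω - truncate κ (X t ω)‖ ^ 2 ≤
        2 * ‖X₀ ω - truncate κ (X₀ ω)‖ ^ 2 +
          ∑' i : ℕ, B * ((i + (κ + 1) : ℕ) : ℝ) ^ e := by
      refine hasSum_le (fun i => ?_) (hasSum_norm_sub_truncate_sq κ (X t ω))
        ((hs0.mul_left 2).add hs.hasSum)
      refine (hle (i + (κ + 1)) (max_le (by omega) (by omega)) t ht).trans ?_
      have h1 := degreeSq_nonneg (i + (κ + 1)) (X₀ ω)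
      have h2 : Real.exp (-(((i + (κ + 1) : ℕ) : ℝ) * (((i + (κ + 1) : ℕ) : ℝ) + 1) * t)) ^ 2 ≤
          1 := by
        refine pow_le_one₀ (Real.exp_pos _).le (Real.exp_le_one_iff.2 ?_)
        have := ht.1
        have : 0 ≤ ((i + (κ + 1) : ℕ) : ℝ) * (((i + (κ + 1) : ℕ) : ℝ) + 1) * t := by positivity
        linarith
      have h3 := mul_le_mul_of_nonneg_right h2 h1
      rw [one_mul] at h3
      linarith
    refine (abs_le_of_sq_le_sq' ?_ (by positivity)).2
    have h3 := hK₃ κ hκ3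
    have hpow : ∀ c : ℝ, ((κ : ℝ) ^ (-c)) ^ 2 = (κ : ℝ) ^ (-(2 * c)) := by
      intro c
      rw [← Real.rpow_natCast, ← Real.rpow_mul hκ0.le]
      congr 1
      push_cast
      ring
    have h4 : (κ : ℝ) ^ (-(2 * b)) = (κ : ℝ) ^ (2 * (b' - b)) * (κ : ℝ) ^ (-(2 * b')) := by
      rw [← Real.rpow_add hκ0]
      congr 1
      ring
    have h5 : 3 * (κ : ℝ) ^ (-(2 * b')) ≤ (κ : ℝ) ^ (2 * (b' - b)) * (κ : ℝ) ^ (-(2 * b')) := by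
      gcongr
    rw [hpow] at htail hX0 ⊢
    rw [h4]
    linarith

/-- The standard deviation `convStd l h` is at most `1/l` whatever the step. The exponent is
weakened to that of the continuous solution so that `sum_norm_sq_le_of_decay` applies to both. -/
theorem norm_convStd_mul_le {A : ℕ → ℝ} {b : ℕ → ℕ → Fin 2 → ℝ} {l : ℕ} (hl : 1 ≤ l) {h : ℝ}
    {C δ : ℝ} (hδ0 : 0 ≤ δ) (hδ1 : δ ≤ 1) (hC : 0 ≤ C)
    (hb : ∀ m i, IsMode (l, m, i) → |b l m i| ≤ C * ((l : ℝ) + 1) ^ δ) {m : ℤ}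
    (hm : m ∈ Finset.Icc (-(l : ℤ)) l) :
    ‖(convStd l h : ℂ) * noiseCoeff A b l m‖ ≤
      4 * C * Real.sqrt (A l) * (l : ℝ) ^ (-1 + 3 * δ) := by
  have hl1 : (1 : ℝ) ≤ l := by exact_mod_cast hl
  have hl0 : (0 : ℝ) < l := by linarith
  have h1 := norm_noiseCoeff_le (A := A) (natAbs_le_of_mem_Icc hm) fun i hi => hb m.natAbs i hi
  have h2 := add_one_rpow_le hl hδ0 hδ1
  have h3 : convStd l h ≤ (l : ℝ) ^ (-1 : ℝ) := by
    rw [convStd, if_neg (by omega), Real.rpow_neg_one]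
    refine Real.sqrt_le_iff.2 ⟨by positivity, ?_⟩
    rw [inv_pow, ← one_div]
    refine div_le_div₀ zero_le_one ?_ (by positivity) (by nlinarith)
    linarith [Real.exp_pos (-2 * ((l : ℝ) * (l + 1)) * h)]
  have h4 : 0 ≤ convStd l h := by
    rw [convStd, if_neg (by omega)]
    exact Real.sqrt_nonneg _
  have h5 : (l : ℝ) ^ (-1 : ℝ) * (l : ℝ) ^ δ ≤ (l : ℝ) ^ (-1 + 3 * δ) := by
    rw [← Real.rpow_add hl0]
    exact Real.rpow_le_rpow_of_exponent_le hl1 (by linarith)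
  rw [norm_mul, Complex.norm_real, Real.norm_of_nonneg h4]
  calc convStd l h * ‖noiseCoeff A b l m‖
      ≤ (l : ℝ) ^ (-1 : ℝ) * (2 * Real.sqrt (A l) * (C * (2 * (l : ℝ) ^ δ))) := by
        refine mul_le_mul h3 (h1.trans ?_) (norm_nonneg _) (by positivity)
        gcongr
    _ = 4 * C * Real.sqrt (A l) * ((l : ℝ) ^ (-1 : ℝ) * (l : ℝ) ^ δ) := by ring
    _ ≤ _ := by gcongr

theorem norm_add_sq_le_two_mul (x y : L2S) : ‖x + y‖ ^ 2 ≤ 2 * ‖x‖ ^ 2 + 2 * ‖y‖ ^ 2 := by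
  nlinarith [norm_add_le x y, norm_nonneg (x + y), norm_nonneg x, norm_nonneg y,
    sq_nonneg (‖x‖ - ‖y‖)]

/-- One step of the recursion. -/
theorem norm_gridPart_succ_sq_le {A : ℕ → ℝ} {l : ℕ} (hA : 0 ≤ A l) {α D : ℝ} (hl : 1 ≤ l)
    (hdecay : A l ≤ D * (l : ℝ) ^ (-α)) (τ : ℕ → ℝ) {ξ : ℕ → ℕ → ℕ → Fin 2 → ℝ} (x₀ : L2S)
    (k : ℕ) {C δ : ℝ} (hδ0 : 0 ≤ δ) (hδ1 : δ ≤ 1) (hC : 0 ≤ C)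
    (hb : ∀ m i, IsMode (l, m, i) → |ξ k l m i| ≤ C * ((l : ℝ) + 1) ^ δ) :
    ‖gridPart A τ ξ x₀ l (k + 1)‖ ^ 2 ≤
      2 * (Real.exp (-((l : ℝ) * (l + 1)) * (τ (k + 1) - τ k)) ^ 2 *
        ‖gridPart A τ ξ x₀ l k‖ ^ 2) +
      6 * (4 * C) ^ 2 * D * (l : ℝ) ^ (-1 - α + 6 * δ) := by
  rw [gridPart]
  refine (norm_add_sq_le_two_mul _ _).trans ?_
  have h1 : convStd l (τ (k + 1) - τ k) •
      ∑ m ∈ Finset.Icc (-(l : ℤ)) l, noiseCoeff A (ξ k) l m • Y l m =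
      ∑ m ∈ Finset.Icc (-(l : ℤ)) l,
        ((convStd l (τ (k + 1) - τ k) : ℂ) * noiseCoeff A (ξ k) l m) • Y l m := by
    rw [Finset.smul_sum]
    refine Finset.sum_congr rfl fun m _ => ?_
    rw [mul_smul]
    exact (Complex.coe_smul _ _).symm
  rw [h1, norm_sum_smul_sq, norm_smul, mul_pow, Real.norm_eq_abs, sq_abs]
  have h2 := sum_norm_sq_le_of_decay hA hl hdecay
    (fun m hm => norm_convStd_mul_le (A := A) (h := τ (k + 1) - τ k) hl hδ0 hδ1 hC hb hm)
  linarith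

/-- The rate of the truncations of the recursive representation. -/
theorem ae_rate_grid {A : ℕ → ℝ} (hA : ∀ l, 0 ≤ A l) {α C : ℝ} {l₀ : ℕ} (hα : 0 < α)
    (hdecay : ∀ l : ℕ, l₀ < l → A l ≤ C * (l : ℝ) ^ (-α)) (X₀ : Ω → L2S) (n : ℕ) (τ : ℕ → ℝ)
    (ξ : ℕ → ℕ → ℕ → Fin 2 → Ω → ℝ) (hτ : StrictMonoOn τ (Set.Iic n))
    (hξ : IsNormalFamily P n ξ) :
    ∀ᵐ ω ∂P,
      (∀ k ≤ n, Summable fun l =>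
        gridPart A τ (fun j l' m i => ξ j l' m i ω) (X₀ ω) l k) ∧
      ∀ b < α / 2, ∃ K : ℕ, ∀ κ ≥ K, ∀ k, 1 ≤ k → k ≤ n →
        ‖(∑' l, gridPart A τ (fun j l' m i => ξ j l' m i ω) (X₀ ω) l k) -
          ∑ l ∈ Finset.range (κ + 1),
            gridPart A τ (fun j l' m i => ξ j l' m i ω) (X₀ ω) l k‖ ≤ (κ : ℝ) ^ (-b) := by
  have hN : ∀ᵐ ω ∂P, ∀ N : ℕ, _ := ae_all_iff.2 fun N : ℕ =>
    ae_exists_abs_normal_le hξ.normal (inv_nat_add_three N).1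
  filter_upwards [hN] with ω hω
  set g : ℕ → ℕ → L2S := fun l k =>
    gridPart A τ (fun j l' m i => ξ j l' m i ω) (X₀ ω) l k with hg
  have hgd : ∀ k l, degreePart l (g l k) = g l k := fun k l => degreePart_gridPart _ _ _ _ l k
  -- Plain square summability at step `k` already gives weighted summability at step `k + 1`,
  -- because a positive time step absorbs every power of the degree. Hence the initial value needs
  -- no rate; the case `b = 0` drives the induction `hsq`.
  have hstep : ∀ b < α / 2, ∀ k < n, (Summable fun l => ‖g l k‖ ^ 2) →
      Summable fun l : ℕ => (l : ℝ) ^ (2 * b) * ‖g l (k + 1)‖ ^ 2 := by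
    intro b hb k hk hs
    obtain ⟨N, hN⟩ := exists_nat_small hb
    obtain ⟨D, hD, hξb⟩ := hω N
    have hpos : 0 < τ (k + 1) - τ k :=
      sub_pos.2 (hτ (by simp only [Set.mem_Iic]; omega) (by simp only [Set.mem_Iic]; omega)
        (Nat.lt_succ_self k))
    have hsum := ((summable_weight_mul_exp (fun l => sq_nonneg ‖g l k‖) hs b hpos).mul_left 2).add
      (summable_weight_mul_rpow hN (6 * (4 * D) ^ 2 * C))
    refine Summable.of_norm_bounded_eventually_nat hsum ?_
    filter_upwards [eventually_ge_atTop (max 1 (l₀ + 1))] with l hl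
    have hl1 : 1 ≤ l := (le_max_left _ _).trans hl
    have hl2 : l₀ < l := (le_max_right 1 (l₀ + 1)).trans hl
    have h1 := norm_gridPart_succ_sq_le (hA l) hl1 (hdecay l hl2) τ
      (ξ := fun j l' m i => ξ j l' m i ω) (X₀ ω) k (inv_nat_add_three N).1.le
      (by linarith [(inv_nat_add_three N).2]) hD (fun m i hm => hξb k hk l m i hm)
    rw [Real.norm_of_nonneg (by positivity)]
    refine (mul_le_mul_of_nonneg_left h1 (by positivity)).trans (le_of_eq ?_)
    ring
  have hsq : ∀ k ≤ n, Summable fun l => ‖g l k‖ ^ 2 := by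
    intro k
    induction k with
    | zero =>
      intro _
      refine (hasSum_degreeSq (X₀ ω)).summable.congr fun l => ?_
      exact (norm_degreePart_sq l (X₀ ω)).symm
    | succ k ih =>
      intro hk
      have := hstep 0 (half_pos hα) k (by omega) (ih (by omega))
      simpa using this
  have hsummable : ∀ k ≤ n, Summable fun l => g l k := fun k hk =>
    summable_of_degreePart_eq (hgd k) (hsq k hk)
  refine ⟨hsummable, fun b hb => ?_⟩
  have hrate := exists_rate_of_nonneg {k : ℕ | 1 ≤ k ∧ k ≤ n}
    (fun κ k => ‖(∑' l, g l k) - truncate κ (∑' l, g l k)‖) (half_pos hα)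
    (fun b hb hb0 => ?_) hb
  · obtain ⟨K, hK⟩ := hrate
    refine ⟨K, fun κ hκ k hk1 hkn => ?_⟩
    have h1 := hK κ hκ k ⟨hk1, hkn⟩
    rwa [truncate_tsum (hgd k) (hsummable k hkn)] at h1
  · refine exists_forall_norm_sub_truncate_le {k : ℕ | 1 ≤ k ∧ k ≤ n} (fun k => ∑' l, g l k)
      -- The grid is finite, so the sum over its points after the first is a common majorant, which
      -- makes the rate uniform in `k`.
      (d := fun l => ∑ k ∈ Finset.range n, ‖g l (k + 1)‖ ^ 2)
      (fun l => Finset.sum_nonneg fun _ _ => by positivity) hb0 ?_ (L := 0) ?_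
    · simp only [Finset.mul_sum]
      exact summable_sum fun k hk => hstep b hb k (Finset.mem_range.1 hk)
        (hsq k (Finset.mem_range.1 hk).le)
    · rintro l _ k ⟨hk1, hkn⟩
      rw [degreeSq_tsum (hgd k) (hsummable k hkn)]
      obtain ⟨j, rfl⟩ : ∃ j, k = j + 1 := ⟨k - 1, by omega⟩
      exact Finset.single_le_sum (f := fun k => ‖g l (k + 1)‖ ^ 2) (fun _ _ => by positivity)
        (Finset.mem_range.2 (by omega))

end SphereHeat

end

theorem mainTheorem8 {Ω : Type*} [MeasurableSpace Ω] (P : Measure Ω) [IsProbabilityMeasure P]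
    (T : ℝ) (hT : 0 < T)
    (A : ℕ → ℝ) (hA : ∀ l, 0 ≤ A l)
    (α C : ℝ) (l₀ : ℕ) (hα : 0 < α) (hdecay : ∀ l : ℕ, l₀ < l → A l ≤ C * (l : ℝ) ^ (-α))
    (X₀ : Ω → SphereHeat.L2S) (hX₀ : MemLp X₀ 2 P) :
    -- the solution in continuous time
    (∀ (β : ℕ → ℕ → Fin 2 → ℝ≥0 → Ω → ℝ) (X : ℝ → Ω → SphereHeat.L2S),
      SphereHeat.IsBrownianFamily P β → SphereHeat.IsSolution P A β T X₀ X →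
      ∀ᵐ ω ∂P,
        (∀ b < α / 2, ∀ ε > 0, ∃ K : ℕ, ∀ κ ≥ K, ∀ t ∈ Set.Icc ε T,
          ‖X t ω - SphereHeat.truncate κ (X t ω)‖ ≤ (κ : ℝ) ^ (-b)) ∧
        ((∀ b < α / 2, ∃ K : ℕ, ∀ κ ≥ K,
            ‖X₀ ω - SphereHeat.truncate κ (X₀ ω)‖ ≤ (κ : ℝ) ^ (-b)) →
          ∀ b < α / 2, ∃ K : ℕ, ∀ κ ≥ K, ∀ t ∈ Set.Icc 0 T,
            ‖X t ω - SphereHeat.truncate κ (X t ω)‖ ≤ (κ : ℝ) ^ (-b))) ∧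
    -- its recursive representation on an arbitrary time grid
    (∀ (n : ℕ) (τ : ℕ → ℝ) (ξ : ℕ → ℕ → ℕ → Fin 2 → Ω → ℝ),
      τ 0 = 0 → StrictMonoOn τ (Set.Iic n) → τ n ≤ T → SphereHeat.IsNormalFamily P n ξ →
      ∀ᵐ ω ∂P,
        (∀ k ≤ n, Summable fun l =>
          SphereHeat.gridPart A τ (fun j l' m i => ξ j l' m i ω) (X₀ ω) l k) ∧
        ∀ b < α / 2, ∃ K : ℕ, ∀ κ ≥ K, ∀ k, 1 ≤ k → k ≤ n →
          ‖(∑' l, SphereHeat.gridPart A τ (fun j l' m i => ξ j l' m i ω) (X₀ ω) l k) -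
            ∑ l ∈ Finset.range (κ + 1),
              SphereHeat.gridPart A τ (fun j l' m i => ξ j l' m i ω) (X₀ ω) l k‖
            ≤ (κ : ℝ) ^ (-b)) := by
  refine ⟨fun β X hβ hX => ?_, fun n τ ξ _ hτ _ hξ => ?_⟩
  · exact SphereHeat.ae_rate_solution hA hα hdecay hT hβ hX
  · exact SphereHeat.ae_rate_grid hA hα hdecay X₀ n τ ξ hτ hξ
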